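/- **Setting.** Let $G_H$ be the complex Heisenberg group of matrices $\begin{pmatrix}1&\zeta_1&\zeta_3\\0&1&\zeta_2\\0&0&1\end{pmatrix}$, $\zeta_i\in\mathbb C$, let $\Gamma\subset G_H$ be the subgroup of those with Gaussian integer entries, and let $M=\Gamma\backslash G_H$ be the Iwasawa manifold, regarded as a smooth real 6-manifold. Let $(e^1,\dots,e^6)$ be the real 1-forms on $M$ induced by the left-invariant forms with $$d\zeta_1=e^1+ie^2,\qquad d\zeta_2=e^3+ie^4,\qquad -d\zeta_3+\zeta_1d\zeta_2=e^5+ie^6 ,$$ and write $e^{ij\cdots}=e^i\wedge e^j\wedge\cdots$. Give $M$ the Riemannian metric $g=\sum_i e^i\otimes e^i$, with Levi-Civita connection $\nabla$, and the orientation $e^{123456}$. Let $\mathcal Z$ be the set of almost complex structures $J$ on $M$ that are orthogonal for $g$, induce the given orientation, and are invariant (have constant coefficients in the basis $(e^i)$). The fundamental form of $J$ is $\omega(X,Y)=g(JX,Y)$; points of $\mathcal Z$ are labelled by their fundamental forms. **Classes.** At each point, $\nabla\omega$ lies in the space $\mathcal W$ of tensors $\alpha$ on the tangent space with $\alpha(x;y,z)=-\alpha(x;z,y)=-\alpha(x;Jy,Jz)$.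 Gray and Hervella decompose $\mathcal W=\mathcal W_1\oplus\mathcal W_2\oplus\mathcal W_3\oplus\mathcal W_4$ into irreducible $U(3)$-modules, consisting of the $\alpha\in\mathcal W$ with respectively: - $\mathcal W_1$: $\alpha(x;x,z)=0$; - $\mathcal W_2$: $\alpha(x;y,z)+\alpha(y;z,x)+\alpha(z;x,y)=0$; - $\mathcal W_3$: $\alpha(Jx;Jy,z)=\alpha(x;y,z)$ and $\sum_i\alpha(b_i;b_i,z)=0$ for orthonormal bases $(b_i)$; - $\mathcal W_4$: $\alpha(x;y,z)=g(x,y)\theta(z)-g(x,z)\theta(y)-g(x,Jy)\theta(Jz)+g(x,Jz)\theta(Jy)$ for some 1-form $\theta$. For $I\subseteq\{1,2,3,4\}$ let $\mathcal Z_I=\{J\in\mathcal Z:\nabla\omega\in\bigoplus_{i\in I}\mathcal W_i\text{ at every point}\}$. Thus $\mathcal Z_\emptyset$ is the set of Kähler structures, $\mathcal Z_{34}$ that of Hermitian structures and $\mathcal Z_{123}$ that of cosymplectic structures in $\mathcal Z$. **Subsets of $\mathcal Z$.** Put $$\omega_0=e^{12}+e^{34}+e^{56},\quad \omega_1=e^{12}-e^{34}-e^{56},\quad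 \omega_2=-e^{12}+e^{34}-e^{56},\quad \omega_3=-e^{12}-e^{34}+e^{56}.$$ Let $V=\mathbb C^4$ have basis $v^0,\dots,v^3$, write $v^{ij}=v^i\wedge v^j$, and identify $\bigwedge^2V$ with the complex span of the $e^i$ by $$2v^{01}=e^1+ie^2,\ \ 2v^{23}=e^1-ie^2,\ \ 2v^{02}=e^3+ie^4,\ \ 2v^{31}=e^3-ie^4,\ \ 2v^{03}=e^5+ie^6,\ \ 2v^{12}=e^5-ie^6 .$$ Let $J$ act on 1-forms by $(J\varphi)(X)=\varphi(JX)$. Then $\mathcal Z\cong\mathbb{CP}^3$, where $J$ corresponds to the point $[u]$ for which the $i$-eigenspace of $J$ on invariant complex 1-forms is $\{u\wedge v:v\in V\}$; the structure with fundamental form $\omega_i$ corresponds to $[v^i]$. In $\mathcal Z\cong\mathbb{CP}^3$, let $\mathcal E_{ij}$ be the projective line (edge) through $\omega_i$ and $\omega_j$, and $\mathcal F_i$ the projective plane (face) $u_i=0$ opposite $\omega_i$. Finally, for $P\in SO(4)$ acting on $\langle e^1,e^2,e^3,e^4\rangle$ put $f^j=P(e^j)$ and $\omega(P;a,b)=e^5\wedge(ae^6+bf^1)-f^2\wedge(af^1-be^6)+f^3\wedge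 f^4$; let $P_+$ be the matrix of the action of $P$ on self-dual 2-forms in the basis $(e^{12}+e^{34},\,e^{13}+e^{42},\,e^{14}+e^{23})$, and let $$\mathcal S=\{\omega(P;0,1): P\in SO(4),\ (P_+)_{11}=1\},$$ a 3-sphere in $\mathcal Z$. **Statement.** The 16 Gray–Hervella classes of invariant almost Hermitian structures on the Iwasawa manifold are $$\begin{aligned} &\mathcal Z_{1234}=\mathcal Z,\\ &\mathcal Z_{123}=\mathcal F_0\cup\mathcal F_3,\\ &\mathcal Z_{23}=\mathcal Z_{234}=\mathcal F_3,\\ &\mathcal Z_{12}=\mathcal Z_{124}=\{\omega_3\}\cup\mathcal S,\\ &\mathcal Z_{2}=\mathcal Z_{24}=\mathcal S,\\ &\mathcal Z_{3}=\mathcal Z_{13}=\mathcal Z_{34}=\mathcal Z_{134}=\{\omega_0\}\cup\mathcal E_{12},\\ &\mathcal Z_{\emptyset}=\mathcal Z_{1}=\mathcal Z_{4}=\mathcal Z_{14}=\emptyset . \end{aligned}$$ In particular $\mathcal Z_{34}\subseteq\mathcal Z_{123}$: every Hermitian structure in $\mathcal Z$ is cosymplectic. -/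

import Mathlib

open scoped Manifold ContDiff Topology

noncomputable section

namespace Iwasawa

/-- The real vector space `ℂ³ ≅ ℝ⁶` on which all manifolds below are modelled. -/
abbrev C3 : Type := ℂ × ℂ × ℂ

/-- The complex Heisenberg group `G_H`: the point `(ζ₁, ζ₂, ζ₃)` stands for the upper triangular
matrix `toMatrix (ζ₁, ζ₂, ζ₃)`. -/
def Heis : Type := C3

namespace Heis

instance : TopologicalSpace Heis := inferInstanceAs (TopologicalSpace C3)
instance : T2Space Heis := inferInstanceAs (T2Space C3)
instance : LocallyCompactSpace Heis := inferInstanceAs (LocallyCompactSpace C3)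
instance : ChartedSpace C3 Heis := chartedSpaceSelf C3
instance : IsManifold 𝓘(ℝ, C3) ∞ Heis :=
  inferInstanceAs (IsManifold 𝓘(ℝ, C3) ∞ C3)

/-- The unipotent matrix with entries `ζ₁` at (1,2), `ζ₂` at (2,3) and `ζ₃` at (1,3). -/
def toMatrix (x : Heis) : Matrix (Fin 3) (Fin 3) ℂ :=
  !![1, x.1, x.2.2; 0, 1, x.2.1; 0, 0, 1]

theorem toMatrix_injective : Function.Injective toMatrix := by
  intro x y h
  have h1 := congrFun (congrFun h 0) 1
  have h2 := congrFun (congrFun h 0) 2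
  have h3 := congrFun (congrFun h 1) 2
  simp [toMatrix] at h1 h2 h3
  exact Prod.ext h1 (Prod.ext h3 h2)

instance : Mul Heis := ⟨fun x y => (x.1 + y.1, x.2.1 + y.2.1, x.2.2 + y.2.2 + x.1 * y.2.1)⟩
instance : One Heis := ⟨((0 : ℂ), (0 : ℂ), (0 : ℂ))⟩
instance : Inv Heis := ⟨fun x => (-x.1, -x.2.1, -x.2.2 + x.1 * x.2.1)⟩

theorem mul_def (x y : Heis) :
    x * y = (x.1 + y.1, x.2.1 + y.2.1, x.2.2 + y.2.2 + x.1 * y.2.1) := rfl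
theorem one_def : (1 : Heis) = ((0 : ℂ), (0 : ℂ), (0 : ℂ)) := rfl
theorem inv_def (x : Heis) : x⁻¹ = (-x.1, -x.2.1, -x.2.2 + x.1 * x.2.1) := rfl

theorem toMatrix_mul (x y : Heis) : toMatrix (x * y) = toMatrix x * toMatrix y := by
  ext i j
  fin_cases i <;> fin_cases j <;> simp [toMatrix, mul_def, Matrix.mul_apply, Fin.sum_univ_three] <;> ring

theorem toMatrix_one : toMatrix 1 = 1 := by
  ext i j
  fin_cases i <;> fin_cases j <;> simp [toMatrix, one_def]

theorem toMatrix_inv_mul (x : Heis) : toMatrix (x⁻¹ * x) = 1 := by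
  rw [← toMatrix_one]; congr 1
  change ((-x.1 + x.1, -x.2.1 + x.2.1, -x.2.2 + x.1 * x.2.1 + x.2.2 + -x.1 * x.2.1) :
    C3) = (0, 0, 0)
  refine Prod.ext ?_ (Prod.ext ?_ ?_) <;> simp

instance : Group Heis :=
  Group.ofLeftAxioms
    (fun x y z => toMatrix_injective (by simp only [toMatrix_mul, mul_assoc]))
    (fun x => toMatrix_injective (by simp only [toMatrix_mul, toMatrix_one, one_mul]))
    (fun x => toMatrix_injective (by rw [toMatrix_inv_mul, toMatrix_one]))

end Heis

open Heis

/-- The discrete subgroup `Γ` of matrices whose entries are Gaussian integers. -/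
def lattice : Subgroup Heis where
  carrier := {x | (∃ a : GaussianInt, (a : ℂ) = x.1) ∧ (∃ a : GaussianInt, (a : ℂ) = x.2.1) ∧
    ∃ a : GaussianInt, (a : ℂ) = x.2.2}
  mul_mem' := by
    rintro x y ⟨⟨a, ha⟩, ⟨b, hb⟩, ⟨c, hc⟩⟩ ⟨⟨a', ha'⟩, ⟨b', hb'⟩, ⟨c', hc'⟩⟩
    refine ⟨⟨a + a', ?_⟩, ⟨b + b', ?_⟩, ⟨c + c' + a * b', ?_⟩⟩ <;>
      simp [mul_def, ha, hb, hc, ha', hb', hc', GaussianInt.toComplex_add, GaussianInt.toComplex_mul]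
  one_mem' := by
    refine ⟨⟨0, ?_⟩, ⟨0, ?_⟩, ⟨0, ?_⟩⟩ <;> simp [one_def, GaussianInt.toComplex_zero]
  inv_mem' := by
    rintro x ⟨⟨a, ha⟩, ⟨b, hb⟩, ⟨c, hc⟩⟩
    refine ⟨⟨-a, ?_⟩, ⟨-b, ?_⟩, ⟨-c + a * b, ?_⟩⟩ <;>
      simp [inv_def, ha, hb, hc]

theorem continuous_mul_left' (g : Heis) : Continuous (fun x : Heis => g * x) := by
  change Continuous (fun x : C3 => ((g.1 + x.1, g.2.1 + x.2.1, g.2.2 + x.2.2 + g.1 * x.2.1) : C3))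
  fun_prop

instance : ContinuousConstSMul lattice Heis := ⟨fun g => continuous_mul_left' g.1⟩

theorem finite_gauss (r : ℝ) : {a : ℂ | (∃ z : GaussianInt, (z : ℂ) = a) ∧ ‖a‖ ≤ r}.Finite := by
  have : {a : ℂ | (∃ z : GaussianInt, (z : ℂ) = a) ∧ ‖a‖ ≤ r} ⊆
      (fun p : ℤ × ℤ => ((p.1 : ℂ) + p.2 * Complex.I)) '' (Set.Icc (-⌈r⌉) ⌈r⌉ ×ˢ Set.Icc (-⌈r⌉) ⌈r⌉) := by
    rintro a ⟨⟨z, rfl⟩, h⟩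
    have h1 := (Complex.abs_re_le_norm (z : ℂ)).trans h
    have h2 := (Complex.abs_im_le_norm (z : ℂ)).trans h
    simp only [← GaussianInt.intCast_re, ← GaussianInt.intCast_im] at h1 h2
    have h3 := Int.le_ceil r
    rw [abs_le] at h1 h2
    refine ⟨(z.re, z.im), ⟨⟨?_, ?_⟩, ⟨?_, ?_⟩⟩, (GaussianInt.toComplex_def z).symm⟩
    all_goals (first | (have : (-(⌈r⌉ : ℤ) : ℝ) ≤ _ := le_trans (neg_le_neg h3) h1.1; exact_mod_cast this) | (have := h1.2.trans h3; exact_mod_cast this) | (have : (-(⌈r⌉ : ℤ) : ℝ) ≤ _ := le_trans (neg_le_neg h3) h2.1; exact_mod_cast this) | (have := h2.2.trans h3; exact_mod_cast this))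
  exact ((Set.toFinite _).image _).subset this

instance : ProperlyDiscontinuousSMul lattice Heis := by
  refine ⟨fun {K L} hK hL => ?_⟩
  have hc : Continuous (fun p : Heis × Heis => p.2 * p.1⁻¹) := by
    change Continuous (fun p : C3 × C3 =>
      ((p.2.1 + -p.1.1, p.2.2.1 + -p.1.2.1,
        p.2.2.2 + (-p.1.2.2 + p.1.1 * p.1.2.1) + p.2.1 * -p.1.2.1) : C3))
    fun_prop
  obtain ⟨r, hr⟩ := ((hK.prod hL).image hc).isBounded.exists_norm_le (E := C3)
  have hfin := (finite_gauss r).prod ((finite_gauss r).prod (finite_gauss r))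
  refine Set.Finite.of_injOn (f := fun g : lattice => (g.1 : C3)) ?_ ?_ hfin
  · rintro g ⟨y, ⟨x, hx, rfl⟩, hy⟩
    have h := hr g.1 ⟨(x, g • x), ⟨hx, hy⟩, by change g.1 * x * x⁻¹ = g.1; simp⟩
    have h1 := (norm_fst_le (g.1 : C3)).trans h
    have h2 := (norm_snd_le (g.1 : C3)).trans h
    have h3 := (norm_fst_le (g.1 : C3).2).trans h2
    have h4 := (norm_snd_le (g.1 : C3).2).trans h2
    exact ⟨⟨g.2.1, h1⟩, ⟨g.2.2.1, h3⟩, ⟨g.2.2.2, h4⟩⟩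
  · intro a _ b _ h
    exact Subtype.ext h

/-- The Iwasawa manifold `Γ \ G_H`: the space of cosets `Γ g`. -/
def IwasawaManifold : Type := MulAction.orbitRel.Quotient lattice Heis

instance : TopologicalSpace IwasawaManifold := inferInstanceAs (TopologicalSpace (MulAction.orbitRel.Quotient lattice Heis))

/-- The projection `G_H → Γ \ G_H`. -/
def proj : Heis → IwasawaManifold := Quotient.mk _

theorem proj_surjective : Function.Surjective proj := Quotient.mk_surjective

theorem proj_eq_iff {x y : Heis} : proj x = proj y ↔ ∃ g ∈ lattice, g * y = x := by
  refine (Quotient.eq (r := MulAction.orbitRel lattice Heis)).trans ?_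
  change x ∈ MulAction.orbit lattice y ↔ _
  constructor
  · rintro ⟨g, rfl⟩; exact ⟨g.1, g.2, rfl⟩
  · rintro ⟨g, hg, rfl⟩; exact ⟨⟨g, hg⟩, rfl⟩

theorem isLocalHomeomorph_proj : IsLocalHomeomorph proj :=
  isQuotientCoveringMap_quotientMk_of_properlyDiscontinuousSMul (E := Heis) (G := lattice)
    |>.isCoveringMap.isLocalHomeomorph

/-- The charts are the local inverses of the projection, followed by `(ζ₁, ζ₂, ζ₃)`. -/
instance : ChartedSpace C3 IwasawaManifold :=
  isLocalHomeomorph_proj.chartedSpace proj_surjective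

theorem mem_atlas {e : OpenPartialHomeomorph IwasawaManifold C3} (he : e ∈ atlas C3 IwasawaManifold)
    (x : C3) : e.symm x = proj x := by
  obtain ⟨q, rfl⟩ := he
  exact congrFun (isLocalHomeomorph_proj.localInverseAt_symm
    (proj_surjective.hasRightInverse.choose q)) x

/-- Left translation, in the global coordinates. -/
def mulL (g : Heis) (x : C3) : C3 :=
  (g.1 + x.1, g.2.1 + x.2.1, g.2.2 + x.2.2 + g.1 * x.2.1)

theorem smooth_mul_left (g : Heis) :
    ContDiff ℝ ∞ (fun x : C3 => mulL g x) := by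
  change ContDiff ℝ ∞ (fun x : C3 =>
    ((g.1 + x.1, g.2.1 + x.2.1, g.2.2 + x.2.2 + g.1 * x.2.1) : C3))
  fun_prop

/-- Two charts differ locally by a left translation. -/
theorem chart_transition {e e' : OpenPartialHomeomorph IwasawaManifold C3}
    (he : e ∈ atlas C3 IwasawaManifold) (he' : e' ∈ atlas C3 IwasawaManifold) {x : C3}
    (hx : x ∈ (e.symm ≫ₕ e').source) :
    ∃ g ∈ lattice, ∀ᶠ y in 𝓝 x, (e.symm ≫ₕ e') y = mulL g y := by
  have hs : ∀ y : C3, y ∈ (e.symm ≫ₕ e').source → proj ((e.symm ≫ₕ e') y) = proj y := by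
    intro y hy
    rw [← mem_atlas he', ← mem_atlas he]
    rw [OpenPartialHomeomorph.trans_source] at hy
    exact e'.left_inv hy.2
  obtain ⟨g, hg, hgx⟩ := proj_eq_iff.1 (hs x hx)
  refine ⟨g, hg, ?_⟩
  have hc : Continuous (fun y : C3 => mulL g y) :=
    continuous_mul_left' g
  have ht : mulL g x ∈ e'.target := by
    change (g * (show Heis from x) : Heis) ∈ e'.target
    rw [hgx]; exact e'.map_source (by rw [OpenPartialHomeomorph.trans_source] at hx; exact hx.2)
  filter_upwards [(e.symm ≫ₕ e').open_source.mem_nhds hx,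
    hc.continuousAt.preimage_mem_nhds (e'.open_target.mem_nhds ht)] with y hy hy'
  have h1 : proj ((e.symm ≫ₕ e') y) = proj (mulL g y) := by
    rw [hs y hy]
    exact proj_eq_iff.2 ⟨g⁻¹, inv_mem hg, inv_mul_cancel_left g _⟩
  rw [← mem_atlas he', ← mem_atlas he'] at h1
  refine e'.symm.injOn ?_ hy' h1
  rw [OpenPartialHomeomorph.trans_source] at hy
  exact e'.map_source hy.2

/-- The Iwasawa manifold is a smooth (real, 6-dimensional) manifold. -/
instance : IsManifold 𝓘(ℝ, C3) ∞ IwasawaManifold := by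
  apply isManifold_of_contDiffOn
  intro e e' he he' x hx
  simp only [modelWithCornersSelf_coe, modelWithCornersSelf_coe_symm, Function.comp_id,
    Function.id_comp, Set.preimage_id, Set.range_id, Set.inter_univ] at hx ⊢
  obtain ⟨g, -, h⟩ := chart_transition he he' hx
  exact ((smooth_mul_left g).contDiffAt.congr_of_eventuallyEq h).contDiffWithinAt

instance : IsManifold 𝓘(ℝ, C3) (minSmoothness ℝ 2) IwasawaManifold := by
  rw [minSmoothness_of_isRCLikeNormedField]; infer_instance

theorem two_le_infty : (2 : ℕ∞ω) ≤ ∞ := ENat.LEInfty.out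

/-- Tangent spaces of `IwasawaManifold`. -/
abbrev T (m : IwasawaManifold) : Type := TangentSpace 𝓘(ℝ, C3) m

/-- The projection `G_H → Γ \ G_H`, in the global coordinates `(ζ₁, ζ₂, ζ₃)` of `G_H`. -/
def quot (x : C3) : IwasawaManifold := proj x

theorem quot_mulL {g : Heis} (hg : g ∈ lattice) (x : C3) : quot (mulL g x) = quot x :=
  proj_eq_iff.2 ⟨g, hg, rfl⟩

theorem mulL_inv (g : Heis) (x : C3) : mulL g (mulL g⁻¹ x) = x := mul_inv_cancel_left (G := Heis) g x
theorem mulL_inv' (g : Heis) (x : C3) : mulL g⁻¹ (mulL g x) = x := inv_mul_cancel_left (G := Heis) g x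

/-- The projection has smooth local sections. -/
theorem exists_section (x : C3) : ∃ s : IwasawaManifold → C3, s (quot x) = x ∧
    ContMDiffAt 𝓘(ℝ, C3) 𝓘(ℝ, C3) ∞ s (quot x) ∧ (∀ᶠ m in 𝓝 (quot x), quot (s m) = m) ∧
    ∀ᶠ y in 𝓝 x, s (quot y) = y := by
  set e := chartAt C3 (quot x) with he
  have hse : quot x ∈ e.source := mem_chart_source C3 (quot x)
  have hsymm : ∀ y, e.symm y = quot y := mem_atlas (chart_mem_atlas C3 (quot x))
  have h0 : quot (e (quot x)) = quot x := by rw [← hsymm, e.left_inv hse]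
  obtain ⟨g, hg, hgx⟩ := proj_eq_iff.1 h0.symm
  have hgx' : mulL g (e (quot x)) = x := hgx
  have hinv : mulL g⁻¹ x = e (quot x) := by
    rw [← hgx', mulL_inv']
    rw [hgx']
  refine ⟨fun m => mulL g (e m), hgx', ?_, ?_, ?_⟩
  · have h1 : ContMDiffAt 𝓘(ℝ, C3) 𝓘(ℝ, C3) ∞ e (quot x) :=
      (contMDiffOn_chart (x := quot x)).contMDiffAt (e.open_source.mem_nhds hse)
    exact (smooth_mul_left g).contMDiff.contMDiffAt.comp (quot x) h1
  · filter_upwards [e.open_source.mem_nhds hse] with m hm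
    rw [quot_mulL hg, ← hsymm, e.left_inv hm]
  · have hc : Continuous (fun y : C3 => mulL g⁻¹ y) := (smooth_mul_left g⁻¹).continuous
    have : mulL g⁻¹ x ∈ e.target := by rw [hinv]; exact e.map_source hse
    filter_upwards [hc.continuousAt.preimage_mem_nhds (e.open_target.mem_nhds this)] with y hy
    have h2 : quot y = e.symm (mulL g⁻¹ y) := by rw [hsymm, quot_mulL (inv_mem hg)]
    rw [h2, e.right_inv hy, mulL_inv]

theorem contMDiff_quot : ContMDiff 𝓘(ℝ, C3) 𝓘(ℝ, C3) ∞ quot := by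
  intro x
  set e := chartAt C3 (quot x) with he
  have hse : quot x ∈ e.source := mem_chart_source C3 (quot x)
  have hsymm : ∀ y, e.symm y = quot y := mem_atlas (chart_mem_atlas C3 (quot x))
  have h0 : quot (e (quot x)) = quot x := by rw [← hsymm, e.left_inv hse]
  obtain ⟨g, hg, hgx⟩ := proj_eq_iff.1 h0
  have hgx' : mulL g x = e (quot x) := hgx
  have h1 : ContMDiffAt 𝓘(ℝ, C3) 𝓘(ℝ, C3) ∞ e.symm (e (quot x)) :=
    (contMDiffOn_chart_symm (x := quot x)).contMDiffAt
      (e.open_target.mem_nhds (e.map_source hse))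
  rw [← hgx'] at h1
  have h2 := h1.comp x (smooth_mul_left g).contMDiff.contMDiffAt
  refine h2.congr_of_eventuallyEq (Filter.Eventually.of_forall fun y => ?_)
  simp [hsymm, quot_mulL hg]

/-- The derivative of the projection. -/
abbrev dquot (x : C3) : TangentSpace 𝓘(ℝ, C3) x →L[ℝ] TangentSpace 𝓘(ℝ, C3) (quot x) :=
  mfderiv 𝓘(ℝ, C3) 𝓘(ℝ, C3) quot x

theorem section_deriv {x : C3} {s : IwasawaManifold → C3} (hs0 : s (quot x) = x)
    (hs' : MDifferentiableAt 𝓘(ℝ, C3) 𝓘(ℝ, C3) s (quot x))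
    (h1 : ∀ᶠ m in 𝓝 (quot x), quot (s m) = m) (h2 : ∀ᶠ y in 𝓝 x, s (quot y) = y) :
    (∀ v, (mfderiv 𝓘(ℝ, C3) 𝓘(ℝ, C3) s (quot x) (dquot x v) : C3) = v) ∧ 
    (∀ v : C3, (mfderiv 𝓘(ℝ, C3) 𝓘(ℝ, C3) quot x
      (mfderiv 𝓘(ℝ, C3) 𝓘(ℝ, C3) s (quot x) v : C3) : C3) = v) := by
  have hq := (contMDiff_quot x).mdifferentiableAt (by simp)
  constructor
  · have := mfderiv_comp x hs' hq
    have h3 : (s ∘ quot) =ᶠ[𝓝 x] id := h2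
    rw [h3.mfderiv_eq, mfderiv_id] at this
    intro v
    exact (congrArg (fun f : C3 →L[ℝ] C3 => f v) this).symm
  · have hq' : MDifferentiableAt 𝓘(ℝ, C3) 𝓘(ℝ, C3) quot (s (quot x)) := by rw [hs0]; exact hq
    have := mfderiv_comp (quot x) hq' hs'
    have h3 : (quot ∘ s) =ᶠ[𝓝 (quot x)] id := h1
    rw [h3.mfderiv_eq, mfderiv_id] at this
    intro v
    have h4 := (congrArg (fun f : C3 →L[ℝ] C3 => f v) this).symm
    rw [hs0] at h4
    exact h4

theorem dquot_isInvertible (x : C3) : (dquot x).IsInvertible := by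
  obtain ⟨s, hs0, hs, h1, h2⟩ := exists_section x
  obtain ⟨h3, h4⟩ := section_deriv hs0 (hs.mdifferentiableAt (by simp)) h1 h2
  refine ContinuousLinearMap.IsInvertible.of_inverse
    (g := (show C3 →L[ℝ] C3 from mfderiv 𝓘(ℝ, C3) 𝓘(ℝ, C3) s (quot x))) ?_ ?_
  · ext1 v; exact h4 v
  · ext1 v; exact h3 v

/-- The left-invariant 1-forms `α¹ = dζ₁`, `α² = dζ₂`, `α³ = -dζ₃ + ζ₁ dζ₂` on `G_H`, at `x`. -/
def alpha (x : C3) : Fin 3 → (C3 →L[ℝ] ℂ) :=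
  ![ContinuousLinearMap.fst ℝ ℂ (ℂ × ℂ),
    (ContinuousLinearMap.fst ℝ ℂ ℂ).comp (ContinuousLinearMap.snd ℝ ℂ (ℂ × ℂ)),
    -((ContinuousLinearMap.snd ℝ ℂ ℂ).comp (ContinuousLinearMap.snd ℝ ℂ (ℂ × ℂ))) +
      x.1 • ((ContinuousLinearMap.fst ℝ ℂ ℂ).comp (ContinuousLinearMap.snd ℝ ℂ (ℂ × ℂ)))]

/-- The left-invariant real coframe `(e¹, …, e⁶)` on `G_H`, where `α¹ = e¹ + i e²`,
`α² = e³ + i e⁴`, `α³ = e⁵ + i e⁶`. The index `k : Fin 6` stands for `e^(k+1)`. -/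
def groupCoframe (x : C3) : C3 →L[ℝ] (Fin 6 → ℝ) :=
  ContinuousLinearMap.pi
    ![Complex.reCLM.comp (alpha x 0), Complex.imCLM.comp (alpha x 0),
      Complex.reCLM.comp (alpha x 1), Complex.imCLM.comp (alpha x 1),
      Complex.reCLM.comp (alpha x 2), Complex.imCLM.comp (alpha x 2)]

theorem groupCoframe_apply (x v : C3) : groupCoframe x v =
    ![v.1.re, v.1.im, v.2.1.re, v.2.1.im, (-v.2.2 + x.1 * v.2.1).re,
      (-v.2.2 + x.1 * v.2.1).im] := by
  ext i
  fin_cases i <;> simp [groupCoframe, alpha]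

/-- The left-invariant vector field on `G_H` with constant components `c` in the dual frame. -/
def groupFrame (c : Fin 6 → ℝ) (x : C3) : C3 :=
  (⟨c 0, c 1⟩, ⟨c 2, c 3⟩, -⟨c 4, c 5⟩ + x.1 * ⟨c 2, c 3⟩)

theorem groupCoframe_groupFrame (c : Fin 6 → ℝ) (x : C3) :
    groupCoframe x (groupFrame c x) = c := by
  rw [groupCoframe_apply]
  ext i
  fin_cases i <;> simp [groupFrame]

theorem groupFrame_groupCoframe (x v : C3) : groupFrame (groupCoframe x v) x = v := by
  rw [groupCoframe_apply]
  refine Prod.ext ?_ (Prod.ext ?_ ?_) <;> apply Complex.ext <;> simp [groupFrame] <;> ring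

theorem groupCoframe_isInvertible (x : C3) : (groupCoframe x).IsInvertible := by
  refine ⟨ContinuousLinearEquiv.ofBijective (groupCoframe x) ?_ ?_,
    ContinuousLinearMap.ext fun v => rfl⟩
  · exact LinearMap.ker_eq_bot.2 fun v w h => by
      rw [← groupFrame_groupCoframe x v, ← groupFrame_groupCoframe x w]
      exact congrArg (fun c => groupFrame c x) h
  · exact LinearMap.range_eq_top.2 (fun c => ⟨_, groupCoframe_groupFrame c x⟩)

theorem mfderiv_mulL (g : Heis) (x v : C3) :
    (mfderiv 𝓘(ℝ, C3) 𝓘(ℝ, C3) (mulL g) x v : C3) = (v.1, v.2.1, v.2.2 + g.1 * v.2.1) := by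
  have h1 : HasFDerivAt (𝕜 := ℝ) (mulL g) ((ContinuousLinearMap.fst ℝ ℂ (ℂ × ℂ)).prod
      (((ContinuousLinearMap.fst ℝ ℂ ℂ).comp (ContinuousLinearMap.snd ℝ ℂ (ℂ × ℂ))).prod
        (((ContinuousLinearMap.snd ℝ ℂ ℂ).comp (ContinuousLinearMap.snd ℝ ℂ (ℂ × ℂ))) +
      g.1 • ((ContinuousLinearMap.fst ℝ ℂ ℂ).comp (ContinuousLinearMap.snd ℝ ℂ (ℂ × ℂ)))))) x := by
    have f1 : HasFDerivAt (𝕜 := ℝ) (fun x : C3 => x.1) (ContinuousLinearMap.fst ℝ ℂ (ℂ × ℂ)) x :=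
      hasFDerivAt_fst
    have f2 : HasFDerivAt (𝕜 := ℝ) (fun x : C3 => x.2.1)
      ((ContinuousLinearMap.fst ℝ ℂ ℂ).comp (ContinuousLinearMap.snd ℝ ℂ (ℂ × ℂ))) x :=
      ((ContinuousLinearMap.fst ℝ ℂ ℂ).comp (ContinuousLinearMap.snd ℝ ℂ (ℂ × ℂ))).hasFDerivAt
    have f3 : HasFDerivAt (𝕜 := ℝ) (fun x : C3 => x.2.2)
      ((ContinuousLinearMap.snd ℝ ℂ ℂ).comp (ContinuousLinearMap.snd ℝ ℂ (ℂ × ℂ))) x :=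
      ((ContinuousLinearMap.snd ℝ ℂ ℂ).comp (ContinuousLinearMap.snd ℝ ℂ (ℂ × ℂ))).hasFDerivAt
    exact (f1.const_add g.1).prodMk ((f2.const_add g.2.1).prodMk
      ((f3.const_add g.2.2).add (f2.const_mul g.1)))
  rw [mfderiv_eq_fderiv, h1.fderiv]
  rfl

/-- The coframe is left-invariant. -/
theorem groupCoframe_mulL (g : Heis) (x v : C3) :
    groupCoframe (mulL g x) (mfderiv 𝓘(ℝ, C3) 𝓘(ℝ, C3) (mulL g) x v : C3) = groupCoframe x v := by
  rw [mfderiv_mulL, groupCoframe_apply, groupCoframe_apply]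
  have : -(v.2.2 + g.1 * v.2.1) + (mulL g x).1 * v.2.1 = -v.2.2 + x.1 * v.2.1 := by
    simp only [mulL]; ring
  simp only [this]

/-- The coframe `(e¹, …, e⁶)` on the Iwasawa manifold: the forms whose pull-backs to `G_H` are the
left-invariant forms `(e¹, …, e⁶)`, see `coframe_quot`. -/
def coframe (m : IwasawaManifold) : TangentSpace 𝓘(ℝ, C3) m →L[ℝ] (Fin 6 → ℝ) :=
  (groupCoframe (Function.surjInv proj_surjective m)).comp
    (show C3 →L[ℝ] C3 from dquot (Function.surjInv proj_surjective m)).inverse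

/-- The pull-back of the coframe by the projection is the left-invariant coframe of `G_H`. -/
theorem coframe_quot (x v : C3) : coframe (quot x) (dquot x v) = groupCoframe x v := by
  set y : C3 := Function.surjInv proj_surjective (quot x) with hy
  have hyx : quot y = quot x := Function.surjInv_eq proj_surjective (quot x)
  obtain ⟨g, hg, hgx⟩ := proj_eq_iff.1 hyx
  have hgx' : mulL g x = y := hgx
  have h1 : quot ∘ mulL g = quot := funext fun z => quot_mulL hg z
  have h2 : (dquot x v : C3) =
      (mfderiv 𝓘(ℝ, C3) 𝓘(ℝ, C3) quot y (mfderiv 𝓘(ℝ, C3) 𝓘(ℝ, C3) (mulL g) x v : C3) : C3) := by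
    have h3 := mfderiv_comp (I := 𝓘(ℝ, C3)) (I' := 𝓘(ℝ, C3)) (I'' := 𝓘(ℝ, C3)) x
      ((contMDiff_quot (mulL g x)).mdifferentiableAt (by simp))
      ((smooth_mul_left g).contMDiff.contMDiffAt.mdifferentiableAt (by simp))
    have h4 : (mfderiv 𝓘(ℝ, C3) 𝓘(ℝ, C3) (quot ∘ mulL g) x v : C3) = (dquot x v : C3) := by
      rw [h1]
    rw [← h4]
    rw [hgx'] at h3
    exact congrArg (fun f : C3 →L[ℝ] C3 => f v) h3
  have h5 : (show C3 →L[ℝ] C3 from dquot y).inverse (dquot x v : C3) =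
      (mfderiv 𝓘(ℝ, C3) 𝓘(ℝ, C3) (mulL g) x v : C3) := by
    rw [h2]
    exact (dquot_isInvertible y).inverse_apply_self _
  change groupCoframe y ((show C3 →L[ℝ] C3 from dquot y).inverse (dquot x v : C3)) = _
  rw [h5, ← hgx', groupCoframe_mulL]

theorem coframe_isInvertible (m : IwasawaManifold) : (coframe m).IsInvertible :=
  (groupCoframe_isInvertible _).comp (dquot_isInvertible _).inverse

/-- The vector field on the Iwasawa manifold with constant components `c` in the dual frame. -/
def frame (c : Fin 6 → ℝ) (m : IwasawaManifold) : TangentSpace 𝓘(ℝ, C3) m := (coframe m).inverse c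

@[simp] theorem coframe_frame (c : Fin 6 → ℝ) (m : IwasawaManifold) : coframe m (frame c m) = c :=
  (coframe_isInvertible m).self_apply_inverse c

@[simp] theorem frame_coframe (m : IwasawaManifold) (v : TangentSpace 𝓘(ℝ, C3) m) : frame (coframe m v) m = v :=
  (coframe_isInvertible m).inverse_apply_self v

theorem frame_quot (c : Fin 6 → ℝ) (x : C3) :
    frame c (quot x) = dquot x (groupFrame c x : C3) := by
  apply (coframe_isInvertible _).injective
  rw [coframe_frame]
  exact ((coframe_quot x (groupFrame c x)).trans (groupCoframe_groupFrame c x)).symm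

theorem mpullback_frame (c : Fin 6 → ℝ) :
    VectorField.mpullback 𝓘(ℝ, C3) 𝓘(ℝ, C3) quot (frame c) = groupFrame c := by
  ext1 x
  rw [VectorField.mpullback_apply, frame_quot]
  exact (dquot_isInvertible x).inverse_apply_self _

open VectorField

theorem contDiff_groupFrame (c : Fin 6 → ℝ) : ContDiff ℝ ∞ (groupFrame c) := by
  unfold groupFrame
  fun_prop

theorem mdifferentiable_groupFrame (c : Fin 6 → ℝ) (x : C3) :
    MDifferentiableAt 𝓘(ℝ, C3) (𝓘(ℝ, C3).prod 𝓘(ℝ, C3))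
      (fun y => (⟨y, groupFrame c y⟩ : TangentBundle 𝓘(ℝ, C3) C3)) x :=
  ((contMDiffAt_vectorSpace_iff_contDiffAt (V := groupFrame c)).2
    (contDiff_groupFrame c).contDiffAt).mdifferentiableAt (by simp)

theorem frame_eventuallyEq {x : C3} {s : IwasawaManifold → C3} (hs0 : s (quot x) = x)
    (hs : ContMDiffAt 𝓘(ℝ, C3) 𝓘(ℝ, C3) ∞ s (quot x))
    (h1 : ∀ᶠ m in 𝓝 (quot x), quot (s m) = m)
    (h2 : ∀ᶠ y in 𝓝 x, s (quot y) = y) (c : Fin 6 → ℝ) :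
    ∀ᶠ m in 𝓝 (quot x), frame c m = mpullback 𝓘(ℝ, C3) 𝓘(ℝ, C3) s (groupFrame c) m := by
  have hs1 : ContMDiffAt 𝓘(ℝ, C3) 𝓘(ℝ, C3) 1 s (quot x) := hs.of_le (by simp)
  have h2' : ∀ᶠ m in 𝓝 (quot x), ∀ᶠ y in 𝓝 (s m), s (quot y) = y := by
    have := hs.continuousAt.tendsto
    rw [hs0] at this
    exact this.eventually h2.eventually_nhds
  filter_upwards [(contMDiffAt_iff_contMDiffAt_nhds (by simp)).1 hs1, h1.eventually_nhds, h2']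
    with m hm h1m h2m
  have hqm : quot (s m) = m := h1m.self_of_nhds
  obtain ⟨y, hy⟩ : ∃ y, y = s m := ⟨_, rfl⟩
  rw [← hy] at hqm h2m
  subst hqm
  obtain ⟨h3, h4⟩ := section_deriv hy.symm (hm.mdifferentiableAt (by simp)) h1m h2m
  change frame c (quot y) = (show C3 →L[ℝ] C3 from mfderiv 𝓘(ℝ, C3) 𝓘(ℝ, C3) s (quot y)).inverse
    (groupFrame c (s (quot y)))
  rw [← hy, frame_quot]
  have hinv : (show C3 →L[ℝ] C3 from mfderiv 𝓘(ℝ, C3) 𝓘(ℝ, C3) s (quot y)).IsInvertible :=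
    ContinuousLinearMap.IsInvertible.of_inverse (g := (show C3 →L[ℝ] C3 from dquot y))
      (ContinuousLinearMap.ext h3) (ContinuousLinearMap.ext h4)
  apply hinv.injective
  refine (h3 (groupFrame c y)).trans ?_
  exact (hinv.self_apply_inverse _).symm

theorem mdifferentiable_frame (c : Fin 6 → ℝ) (m : IwasawaManifold) :
    MDifferentiableAt 𝓘(ℝ, C3) (𝓘(ℝ, C3).prod 𝓘(ℝ, C3))
      (fun p => (⟨p, frame c p⟩ : TangentBundle 𝓘(ℝ, C3) IwasawaManifold)) m := by
  obtain ⟨x, rfl⟩ : ∃ x, quot x = m := proj_surjective m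
  obtain ⟨s, hs0, hs, h1, h2⟩ := exists_section x
  obtain ⟨h3, h4⟩ := section_deriv hs0 (hs.mdifferentiableAt (by simp)) h1 h2
  have hinv : (mfderiv 𝓘(ℝ, C3) 𝓘(ℝ, C3) s (quot x)).IsInvertible := by
    refine ContinuousLinearMap.IsInvertible.of_inverse (f := (show C3 →L[ℝ] C3 from 
      mfderiv 𝓘(ℝ, C3) 𝓘(ℝ, C3) s (quot x))) (g := (show C3 →L[ℝ] C3 from dquot x))
      (ContinuousLinearMap.ext h3) (ContinuousLinearMap.ext h4)
  have h5 : MDifferentiableAt 𝓘(ℝ, C3) (𝓘(ℝ, C3).prod 𝓘(ℝ, C3))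
      (fun y => (⟨y, groupFrame c y⟩ : TangentBundle 𝓘(ℝ, C3) C3)) (s (quot x)) :=
    mdifferentiable_groupFrame c _
  have h6 := h5.mpullback_vectorField hs hinv two_le_infty
  refine h6.congr_of_eventuallyEq ?_
  filter_upwards [frame_eventuallyEq hs0 hs h1 h2 c] with p hp
  rw [hp]

/-- The Lie bracket on components in the dual frame, dual to `de⁵ = e¹∧e³ + e⁴∧e²`,
`de⁶ = e¹∧e⁴ + e²∧e³`; see `mlieBracket_frame`. -/
def bracket (v w : Fin 6 → ℝ) : Fin 6 → ℝ :=
  ![0, 0, 0, 0, -(v 0 * w 2 - v 2 * w 0 + (v 3 * w 1 - v 1 * w 3)),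
    -(v 0 * w 3 - v 3 * w 0 + (v 1 * w 2 - v 2 * w 1))]

theorem fderiv_groupFrame (c : Fin 6 → ℝ) (x u : C3) :
    fderiv ℝ (groupFrame c) x u = (0, 0, u.1 * ⟨c 2, c 3⟩) := by
  have f1 : HasFDerivAt (𝕜 := ℝ) (fun x : C3 => x.1) (ContinuousLinearMap.fst ℝ ℂ (ℂ × ℂ)) x :=
    hasFDerivAt_fst
  have : HasFDerivAt (𝕜 := ℝ) (groupFrame c) _ x :=
    (hasFDerivAt_const (⟨c 0, c 1⟩ : ℂ) x).prodMk ((hasFDerivAt_const (⟨c 2, c 3⟩ : ℂ) x).prodMk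
      ((f1.mul_const (⟨c 2, c 3⟩ : ℂ)).const_add (-⟨c 4, c 5⟩)))
  rw [this.fderiv]
  refine Prod.ext ?_ (Prod.ext ?_ ?_) <;> simp [mul_comm]

theorem lieBracket_groupFrame (v w : Fin 6 → ℝ) (x : C3) :
    lieBracket ℝ (groupFrame v) (groupFrame w) x = groupFrame (bracket v w) x := by
  rw [lieBracket_eq]
  simp only [fderiv_groupFrame]
  refine Prod.ext ?_ (Prod.ext ?_ ?_) <;> apply Complex.ext <;> simp [groupFrame, bracket] <;> ring

theorem mlieBracket_eq_lieBracket (V W : ∀ x : C3, TangentSpace 𝓘(ℝ, C3) x) (x : C3) :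
    mlieBracket 𝓘(ℝ, C3) V W x = lieBracket ℝ V W x := by
  rw [← mlieBracketWithin_univ, mlieBracketWithin_eq_lieBracketWithin]
  exact congrFun (lieBracketWithin_univ (𝕜 := ℝ) (V := V) (W := W)) x

/-- Lie brackets of invariant vector fields on the Iwasawa manifold. -/
theorem mlieBracket_frame (v w : Fin 6 → ℝ) (m : IwasawaManifold) :
    mlieBracket 𝓘(ℝ, C3) (frame v) (frame w) m = frame (bracket v w) m := by
  obtain ⟨x, rfl⟩ : ∃ x, quot x = m := proj_surjective m
  have h := mpullback_mlieBracket (mdifferentiable_frame v (quot x))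
    (mdifferentiable_frame w (quot x)) (contMDiff_quot x)
    (by rw [minSmoothness_of_isRCLikeNormedField]; exact two_le_infty)
  rw [mpullback_frame, mpullback_frame] at h
  have h2 : mlieBracket 𝓘(ℝ, C3) (groupFrame v) (groupFrame w) x = groupFrame (bracket v w) x := by
    exact (mlieBracket_eq_lieBracket _ _ x).trans (lieBracket_groupFrame v w x)
  rw [h2, mpullback_apply] at h
  rw [frame_quot, ← h]
  exact ((dquot_isInvertible x).self_apply_inverse _).symm

/-- The vector field `Y` is differentiable at `m`. -/
abbrev FieldDiffAt (Y : ∀ p : IwasawaManifold, TangentSpace 𝓘(ℝ, C3) p) (m : IwasawaManifold) : Prop :=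
  MDifferentiableAt 𝓘(ℝ, C3) (𝓘(ℝ, C3).prod 𝓘(ℝ, C3))
    (fun p => (⟨p, Y p⟩ : TangentBundle 𝓘(ℝ, C3) IwasawaManifold)) m

/-- The components of a differentiable vector field are differentiable functions. -/
theorem mdifferentiable_coframe {Y : ∀ m : IwasawaManifold, TangentSpace 𝓘(ℝ, C3) m} {m : IwasawaManifold}
    (hY : MDifferentiableAt 𝓘(ℝ, C3) (𝓘(ℝ, C3).prod 𝓘(ℝ, C3))
      (fun p => (⟨p, Y p⟩ : TangentBundle 𝓘(ℝ, C3) IwasawaManifold)) m) :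
    MDifferentiableAt 𝓘(ℝ, C3) 𝓘(ℝ, Fin 6 → ℝ) (fun p => coframe p (Y p)) m := by
  obtain ⟨x, rfl⟩ : ∃ x, quot x = m := proj_surjective m
  obtain ⟨s, hs0, hs, h1, h2⟩ := exists_section x
  have h3 := hY.mpullback_vectorField (contMDiff_quot x) (dquot_isInvertible x) two_le_infty
  set V : C3 → C3 := mpullback 𝓘(ℝ, C3) 𝓘(ℝ, C3) quot Y with hV
  have h4 : DifferentiableAt ℝ V x := mdifferentiableAt_iff_differentiableAt.1
    (((contMDiff_snd_tangentBundle_modelSpace (n := 1) C3 𝓘(ℝ, C3)).mdifferentiable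
      (by simp)).mdifferentiableAt.comp x h3)
  have h5 : ∀ y, groupCoframe y (V y) = coframe (quot y) (Y (quot y)) := by
    intro y
    rw [← coframe_quot]
    congr 1
    exact (dquot_isInvertible y).self_apply_inverse _
  have h6 : DifferentiableAt ℝ (fun y => groupCoframe y (V y)) x := by
    simp only [groupCoframe_apply]
    rw [differentiableAt_pi]
    intro i
    have a1 : DifferentiableAt ℝ (fun y => (V y).1) x := h4.fst
    have a2 : DifferentiableAt ℝ (fun y => (V y).2.1) x := h4.snd.fst
    have a3 : DifferentiableAt ℝ (fun y => -(V y).2.2 + y.1 * (V y).2.1) x :=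
      h4.snd.snd.neg.add (differentiableAt_fst.mul a2)
    have hre : ∀ f : C3 → ℂ, DifferentiableAt ℝ f x → DifferentiableAt ℝ (fun y => (f y).re) x :=
      fun f hf => Complex.reCLM.differentiableAt.comp x hf
    have him : ∀ f : C3 → ℂ, DifferentiableAt ℝ f x → DifferentiableAt ℝ (fun y => (f y).im) x :=
      fun f hf => Complex.imCLM.differentiableAt.comp x hf
    fin_cases i
    · exact hre _ a1
    · exact him _ a1
    · exact hre _ a2
    · exact him _ a2
    · exact hre _ a3
    · exact him _ a3
  have h7 : MDifferentiableAt 𝓘(ℝ, C3) 𝓘(ℝ, Fin 6 → ℝ)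
    (fun y => groupCoframe y (V y)) (s (quot x)) := by rw [hs0]; exact h6.mdifferentiableAt
  refine (h7.comp (quot x) (hs.mdifferentiableAt (by simp))).congr_of_eventuallyEq ?_
  filter_upwards [h1] with p hp
  rw [Function.comp_apply, h5, hp]

/-- The components of the Levi-Civita connection on invariant fields, by the Koszul formula
`2 g(∇_v w, z) = g([v, w], z) - g([w, z], v) + g([z, v], w)`. -/
def christoffel : (Fin 6 → ℝ) →ₗ[ℝ] (Fin 6 → ℝ) →ₗ[ℝ] (Fin 6 → ℝ) :=
  LinearMap.mk₂ ℝ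
    (fun v w k => 1 / 2 * (bracket v w k - bracket w (Pi.single k 1) ⬝ᵥ v +
      bracket (Pi.single k 1) v ⬝ᵥ w))
    (by
      intro v v' w; ext k; fin_cases k <;>
        simp [bracket, dotProduct, Fin.sum_univ_succ, Pi.single_apply] <;> ring)
    (by
      intro c v w; ext k; fin_cases k <;>
        simp [bracket, dotProduct, Fin.sum_univ_succ, Pi.single_apply] <;> ring)
    (by
      intro v v' w; ext k; fin_cases k <;>
        simp [bracket, dotProduct, Fin.sum_univ_succ, Pi.single_apply] <;> ring)
    (by
      intro c v w; ext k; fin_cases k <;>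
        simp [bracket, dotProduct, Fin.sum_univ_succ, Pi.single_apply] <;> ring)

theorem christoffel_torsion (v w : Fin 6 → ℝ) :
    christoffel v w - christoffel w v = bracket v w := by
  ext k; fin_cases k <;>
    simp [christoffel, bracket, dotProduct, Fin.sum_univ_succ, Pi.single_apply] <;> ring

theorem christoffel_metric (u v w : Fin 6 → ℝ) :
    christoffel u v ⬝ᵥ w + v ⬝ᵥ christoffel u w = 0 := by
  simp [christoffel, bracket, dotProduct, Fin.sum_univ_succ, Pi.single_apply]; ring

/-- The invariant Riemannian metric `g = ∑ eⁱ ⊗ eⁱ`. -/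
def metric (m : IwasawaManifold) (u v : TangentSpace 𝓘(ℝ, C3) m) : ℝ :=
  ∑ i, coframe m u i * coframe m v i

/-- `D` is the Levi-Civita connection of `metric`: it has no torsion and `D g = 0`.
Here `D Y m u` is `∇_u Y` at `m`. -/
structure IsLeviCivita (D : CovariantDerivative 𝓘(ℝ, C3) C3 (TangentSpace 𝓘(ℝ, C3) : IwasawaManifold → Type)) :
    Prop where
  torsion_eq_zero : D.torsion = 0
  compatible : ∀ (m : IwasawaManifold) (X Y : ∀ p : IwasawaManifold, TangentSpace 𝓘(ℝ, C3) p), FieldDiffAt X m →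
    FieldDiffAt Y m → ∀ u : TangentSpace 𝓘(ℝ, C3) m,
      mvfderiv 𝓘(ℝ, C3) (fun p => metric p (X p) (Y p)) m u =
        metric m (D X m u) (Y m) + metric m (X m) (D Y m u)

/-- The Levi-Civita connection of `metric`; see `isLeviCivita_leviCivita`. In components with respect
to the invariant frame, `∇_u Y = dY(u) + Γ(u, Y)`. -/
def leviCivita : CovariantDerivative 𝓘(ℝ, C3) C3 (TangentSpace 𝓘(ℝ, C3) : IwasawaManifold → Type) where
  toFun Y m := (coframe m).inverse.comp
    (mvfderiv 𝓘(ℝ, C3) (fun p => coframe p (Y p)) m +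
      (LinearMap.toContinuousLinearMap (christoffel.flip (coframe m (Y m)))).comp (coframe m))
  isCovariantDerivativeOnUniv := by
    constructor
    · intro Y Y' m hY hY' _
      have h := mvfderiv_add (mdifferentiable_coframe hY) (mdifferentiable_coframe hY')
      have h' : (fun p => coframe p ((Y + Y') p)) =
          (fun p => coframe p (Y p)) + fun p => coframe p (Y' p) := by
        ext1 p; simp
      rw [h', h]
      ext1 u
      simp
      abel
    · intro Y f m hY hf _
      have h := mvfderiv_smul hf (mdifferentiable_coframe hY)
      have h' : (fun p => coframe p ((f • Y) p)) =
          f • fun p => coframe p (Y p) := by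
        ext1 p; simp
      rw [h', h]
      ext1 u
      simp only [Pi.smul_apply', map_smul]
      have h'' : (coframe m).inverse (coframe m (Y m)) = Y m := frame_coframe m (Y m)
      simp [h'']
      abel

theorem leviCivita_apply (Y : ∀ p : IwasawaManifold, TangentSpace 𝓘(ℝ, C3) p) (m : IwasawaManifold)
    (u : TangentSpace 𝓘(ℝ, C3) m) : coframe m (leviCivita Y m u) =
      mvfderiv 𝓘(ℝ, C3) (fun p => coframe p (Y p)) m u +
        christoffel (coframe m u) (coframe m (Y m)) :=
  (coframe_isInvertible m).self_apply_inverse _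

theorem mvfderiv_component {a : IwasawaManifold → Fin 6 → ℝ} {m : IwasawaManifold}
    (ha : MDifferentiableAt 𝓘(ℝ, C3) 𝓘(ℝ, Fin 6 → ℝ) a m) (i : Fin 6) :
    MDifferentiableAt 𝓘(ℝ, C3) 𝓘(ℝ, ℝ) (fun p => a p i) m ∧
    ∀ u, mvfderiv 𝓘(ℝ, C3) (fun p => a p i) m u = mvfderiv 𝓘(ℝ, C3) a m u i := by
  have h := ((ContinuousLinearMap.proj (R := ℝ) (φ := fun _ : Fin 6 => ℝ)
    i).hasMFDerivAt (x := a m)).comp m ha.hasMFDerivAt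
  refine ⟨h.mdifferentiableAt, fun u => ?_⟩
  have h2 : mfderiv 𝓘(ℝ, C3) 𝓘(ℝ, ℝ) (fun p => a p i) m = _ := h.mfderiv
  unfold mvfderiv
  rw [h2]
  rfl

theorem mvfderiv_sum {f : Fin 6 → IwasawaManifold → ℝ} {m : IwasawaManifold}
    (hf : ∀ i, MDifferentiableAt 𝓘(ℝ, C3) 𝓘(ℝ, ℝ) (f i) m) (s : Finset (Fin 6)) :
    mvfderiv 𝓘(ℝ, C3) (∑ i ∈ s, f i) m = ∑ i ∈ s, mvfderiv 𝓘(ℝ, C3) (f i) m := by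
  induction s using Finset.induction_on with
  | empty => simp
  | insert a s ha ih =>
    rw [Finset.sum_insert ha, Finset.sum_insert ha, ← ih]
    exact mvfderiv_add (hf a) (MDifferentiableAt.sum fun i _ => hf i)

theorem isLeviCivita_leviCivita : IsLeviCivita leviCivita := by
  constructor
  · ext m u v
    have h := leviCivita.torsion_apply (mdifferentiable_frame (coframe m u) m)
      (mdifferentiable_frame (coframe m v) m)
    rw [frame_coframe, frame_coframe, mlieBracket_frame] at h
    rw [h]
    apply (coframe_isInvertible m).injective
    simp only [map_sub, leviCivita_apply, coframe_frame, mvfderiv_const]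
    simp [← christoffel_torsion]
  · intro m X Y hX hY u
    have hX' := mdifferentiable_coframe hX
    have hY' := mdifferentiable_coframe hY
    have h1 : (fun p => metric p (X p) (Y p)) =
        ∑ i, (fun p => coframe p (X p) i) * (fun p => coframe p (Y p) i) := by
      ext1 p; simp [metric]
    have h2 := christoffel_metric (coframe m u) (coframe m (X m)) (coframe m (Y m))
    simp only [dotProduct] at h2
    have h3 : ∀ i, mvfderiv 𝓘(ℝ, C3)
        ((fun p => coframe p (X p) i) * (fun p => coframe p (Y p) i)) m u = 
        coframe m (X m) i * mvfderiv 𝓘(ℝ, C3) (fun p => coframe p (Y p)) m u i +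
        coframe m (Y m) i * mvfderiv 𝓘(ℝ, C3) (fun p => coframe p (X p)) m u i := by
      intro i
      rw [mvfderiv_mul (mvfderiv_component hX' i).1 (mvfderiv_component hY' i).1]
      simp [(mvfderiv_component hX' i).2, (mvfderiv_component hY' i).2]
    rw [h1, mvfderiv_sum fun i =>
      (mvfderiv_component hX' i).1.mul (mvfderiv_component hY' i).1]
    rw [sum_apply]
    simp only [h3, metric, leviCivita_apply, Pi.add_apply, add_mul, mul_add,
      Finset.sum_add_distrib] at h2 ⊢
    rw [Finset.sum_congr rfl fun i _ => mul_comm (coframe m (Y m) i)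
      (mvfderiv 𝓘(ℝ, C3) (fun p => coframe p (X p)) m u i)]
    linarith

/-- Fields of endomorphisms of the tangent spaces of `IwasawaManifold`. -/
abbrev EndField : Type := ∀ m : IwasawaManifold, T m →L[ℝ] T m

/-- `J` is invariant: it has constant coefficients `a` with respect to the coframe,
`J eʲ = ∑ᵢ a i j eⁱ`, where `J` acts on 1-forms by `(J φ)(u) = φ (J u)`. -/
def IsInvariant (J : EndField) : Prop :=
  ∃ a : Matrix (Fin 6) (Fin 6) ℝ, ∀ (m : IwasawaManifold) (u : T m) (j : Fin 6),
    coframe m (J m u) j = ∑ i, a i j * coframe m u i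

/-- The volume form `υ = e¹∧e²∧e³∧e⁴∧e⁵∧e⁶`. -/
def volume (m : IwasawaManifold) (u : Fin 6 → T m) : ℝ :=
  Matrix.det (Matrix.of fun i j => coframe m (u j) i)

/-- `J` is an almost complex structure that is orthogonal for `metric` and induces the orientation
given by `volume`, that is, every complex basis `(u, v, w)` gives a positive real basis
`(u, J u, v, J v, w, J w)`. -/
structure IsPositiveOrthogonal (J : EndField) : Prop where
  sq : ∀ (m : IwasawaManifold) (u : T m), J m (J m u) = -u
  orthogonal : ∀ (m : IwasawaManifold) (u v : T m), metric m (J m u) (J m v) = metric m u v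
  positive : ∀ (m : IwasawaManifold) (u v w : T m), 0 ≤ volume m ![u, J m u, v, J m v, w, J m w]

/-- The set `𝒵` of invariant, positively oriented, orthogonal almost complex structures. -/
def Z : Set EndField := {J | IsInvariant J ∧ IsPositiveOrthogonal J}

/-- The fundamental 2-form `ω(u, v) = g(J u, v)`. -/
def fundamentalForm (J : EndField) (m : IwasawaManifold) (u v : T m) : ℝ := metric m (J m u) v

/-- The tensor `α` is the covariant derivative `∇η` at `m` of the 2-form `η`:
`(∇_u η)(X, Y) = u(η(X, Y)) - η(∇_u X, Y) - η(X, ∇_u Y)` for all vector fields `X, Y`. -/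
def IsCovariantDerivativeAt (η : ∀ m : IwasawaManifold, T m → T m → ℝ) (m : IwasawaManifold)
    (α : T m →ₗ[ℝ] T m →ₗ[ℝ] T m →ₗ[ℝ] ℝ) : Prop :=
  ∀ Y Y' : ∀ p : IwasawaManifold, T p, FieldDiffAt Y m → FieldDiffAt Y' m → ∀ u : T m,
    α u (Y m) (Y' m) = mvfderiv 𝓘(ℝ, C3) (fun p => η p (Y p) (Y' p)) m u -
      η m (leviCivita Y m u) (Y' m) - η m (Y m) (leviCivita Y' m u)

/-- The Gray-Hervella space `W` of tensors with the symmetries of `∇ω`: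
`α(x; y, z) = -α(x; z, y) = -α(x; J y, J z)`. -/
def ghTotal {V : Type} [AddCommGroup V] [Module ℝ V] (J : V → V) :
    Submodule ℝ (V →ₗ[ℝ] V →ₗ[ℝ] V →ₗ[ℝ] ℝ) where
  carrier := {α | ∀ x y z, α x z y = -α x y z ∧ α x (J y) (J z) = -α x y z}
  zero_mem' := by simp
  add_mem' := by
    intro α β hα hβ x y z
    simp only [LinearMap.add_apply, (hα x y z).1, (hα x y z).2, (hβ x y z).1, (hβ x y z).2]
    constructor <;> ring
  smul_mem' := by
    intro c α hα x y z
    simp only [LinearMap.smul_apply, (hα x y z).1, (hα x y z).2, smul_eq_mul]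
    constructor <;> ring

/-- `W₁` (nearly Kähler): the tensors in `W` with `α(x; x, z) = 0`. -/
def ghW1 {V : Type} [AddCommGroup V] [Module ℝ V] (J : V → V) :
    Submodule ℝ (V →ₗ[ℝ] V →ₗ[ℝ] V →ₗ[ℝ] ℝ) := ghTotal J ⊓
  { carrier := {α | ∀ x z, α x x z = 0}
    zero_mem' := by simp
    add_mem' := by
      intro α β hα hβ x z
      simp [hα x z, hβ x z]
    smul_mem' := by
      intro c α hα x z
      simp [hα x z] }

/-- `W₂` (almost Kähler): the tensors in `W` whose cyclic sum vanishes. -/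
def ghW2 {V : Type} [AddCommGroup V] [Module ℝ V] (J : V → V) :
    Submodule ℝ (V →ₗ[ℝ] V →ₗ[ℝ] V →ₗ[ℝ] ℝ) := ghTotal J ⊓
  { carrier := {α | ∀ x y z, α x y z + α y z x + α z x y = 0}
    zero_mem' := by simp
    add_mem' := by
      intro α β hα hβ x y z
      simp only [LinearMap.add_apply]
      linear_combination hα x y z + hβ x y z
    smul_mem' := by
      intro c α hα x y z
      simp only [LinearMap.smul_apply, smul_eq_mul]
      linear_combination c * hα x y z }

/-- `W₃` (cosymplectic Hermitian), for 6-dimensional `V`: the tensors in `W` with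
`α(J x; J y, z) = α(x; y, z)` and `∑ α(bᵢ; bᵢ, z) = 0` for orthonormal bases `b`. -/
def ghW3 {V : Type} [AddCommGroup V] [Module ℝ V] (g : V → V → ℝ) (J : V → V) :
    Submodule ℝ (V →ₗ[ℝ] V →ₗ[ℝ] V →ₗ[ℝ] ℝ) := ghTotal J ⊓
  { carrier := {α | (∀ x y z, α (J x) (J y) z = α x y z) ∧
      ∀ b : Module.Basis (Fin 6) ℝ V, (∀ i j, g (b i) (b j) = if i = j then 1 else 0) →
        ∀ z, ∑ i, α (b i) (b i) z = 0}
    zero_mem' := by simp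
    add_mem' := by
      intro α β hα hβ
      refine ⟨fun x y z => ?_, fun b hb z => ?_⟩
      · simp only [LinearMap.add_apply, hα.1 x y z, hβ.1 x y z]
      · simp only [LinearMap.add_apply, Finset.sum_add_distrib, hα.2 b hb z, hβ.2 b hb z, add_zero]
    smul_mem' := by
      intro c α hα
      refine ⟨fun x y z => ?_, fun b hb z => ?_⟩
      · simp only [LinearMap.smul_apply, hα.1 x y z]
      · simp only [LinearMap.smul_apply, ← Finset.smul_sum, hα.2 b hb z, smul_zero] }

/-- `W₄`: the tensors in `W` of the form
`α(x; y, z) = g(x, y) θ(z) - g(x, z) θ(y) - g(x, J y) θ(J z) + g(x, J z) θ(J y)`,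
where `θ` is a 1-form (necessarily `θ(z) = ∑ α(bᵢ; bᵢ, z) / (dim V - 2)`). -/
def ghW4 {V : Type} [AddCommGroup V] [Module ℝ V] (g : V → V → ℝ) (J : V → V) :
    Submodule ℝ (V →ₗ[ℝ] V →ₗ[ℝ] V →ₗ[ℝ] ℝ) := ghTotal J ⊓
  { carrier := {α | ∃ θ : V →ₗ[ℝ] ℝ, ∀ x y z, α x y z =
      g x y * θ z - g x z * θ y - g x (J y) * θ (J z) + g x (J z) * θ (J y)}
    zero_mem' := ⟨0, by simp⟩
    add_mem' := by
      rintro α β ⟨θ, hθ⟩ ⟨η, hη⟩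
      refine ⟨θ + η, fun x y z => ?_⟩
      simp only [LinearMap.add_apply, hθ, hη]
      ring
    smul_mem' := by
      rintro c α ⟨θ, hθ⟩
      refine ⟨c • θ, fun x y z => ?_⟩
      simp only [LinearMap.smul_apply, hθ, smul_eq_mul]
      ring }

/-- The component `W_i` of the Gray-Hervella decomposition `W = W₁ ⊕ W₂ ⊕ W₃ ⊕ W₄`. -/
def ghComponent {V : Type} [AddCommGroup V] [Module ℝ V] (g : V → V → ℝ) (J : V → V) :
    ℕ → Submodule ℝ (V →ₗ[ℝ] V →ₗ[ℝ] V →ₗ[ℝ] ℝ)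
  | 1 => ghW1 J
  | 2 => ghW2 J
  | 3 => ghW3 g J
  | 4 => ghW4 g J
  | _ => ⊥

/-- The Gray-Hervella class `𝒵_S = {J ∈ 𝒵 : ∇ω ∈ ⨁_{i ∈ S} W_i}`. So `ghClass ∅` is the Kähler class,
`ghClass {3, 4}` the Hermitian class and `ghClass {1, 2, 3}` the cosymplectic class. -/
def ghClass (S : Set ℕ) : Set EndField :=
  {J | J ∈ Z ∧ ∀ m : IwasawaManifold, ∃ α : T m →ₗ[ℝ] T m →ₗ[ℝ] T m →ₗ[ℝ] ℝ,
    IsCovariantDerivativeAt (fundamentalForm J) m α ∧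
      α ∈ ⨆ i ∈ S, ghComponent (metric m) (J m) i}

/-- The wedge product `α ∧ β` of two 1-forms at a point. -/
def wedge {V : Type} (α β : V → ℝ) (u v : V) : ℝ := α u * β v - α v * β u

/-- The 1-form `e i`; the index `i : Fin 6` stands for `e^(i+1)`. -/
def e (i : Fin 6) (m : IwasawaManifold) (u : T m) : ℝ := coframe m u i

/-- The 2-form `ε₁ e¹∧e² + ε₂ e³∧e⁴ + ε₃ e⁵∧e⁶`. -/
def diagForm (ε : Fin 3 → ℝ) (m : IwasawaManifold) (u v : T m) : ℝ :=
  ε 0 * wedge (e 0 m) (e 1 m) u v + ε 1 * wedge (e 2 m) (e 3 m) u v +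
    ε 2 * wedge (e 4 m) (e 5 m) u v

/-- The 2-forms `ω₀, ω₁, ω₂, ω₃`, the vertices of the standard tetrahedron. -/
def vertexForm : Fin 4 → ∀ m : IwasawaManifold, T m → T m → ℝ :=
  ![diagForm ![1, 1, 1], diagForm ![1, -1, -1], diagForm ![-1, 1, -1], diagForm ![-1, -1, 1]]

/-- The one-point set `{ω_i}`, a point of `𝒵` being labelled by its fundamental form. -/
def vertex (i : Fin 4) : Set EndField := {J | J ∈ Z ∧ fundamentalForm J = vertexForm i}

/-- The element `u ∧ v` of `⋀²V`, `V = ℂ⁴`, as a complex 1-form `∑ c_j eʲ` under the identification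
of `⋀²V` with the complexified cotangent space for which
`2v⁰¹ = e¹ + ie²`, `2v²³ = e¹ - ie²`, `2v⁰² = e³ + ie⁴`, `2v³¹ = e³ - ie⁴`,
`2v⁰³ = e⁵ + ie⁶`, `2v¹² = e⁵ - ie⁶`. -/
def klein (u v : Fin 4 → ℂ) : Fin 6 → ℂ :=
  let p : Fin 4 → Fin 4 → ℂ := fun i j => u i * v j - u j * v i
  ![(p 0 1 + p 2 3) / 2, Complex.I * (p 0 1 - p 2 3) / 2,
    (p 0 2 + p 3 1) / 2, Complex.I * (p 0 2 - p 3 1) / 2,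
    (p 0 3 + p 1 2) / 2, Complex.I * (p 0 3 - p 1 2) / 2]

/-- `J` is the point `[u]` of `ℂP³ ≅ 𝒵`: the `i`-eigenspace of `J` on invariant complex 1-forms
is `V_u = {u ∧ v : v ∈ ℂ⁴}`. -/
def IsPoint (J : EndField) (u : Fin 4 → ℂ) : Prop :=
  ∀ c : Fin 6 → ℂ,
    (∀ (m : IwasawaManifold) (x : T m), ∑ j, c j * (e j m (J m x) : ℂ) = Complex.I * ∑ j, c j * (e j m x : ℂ)) ↔
      ∃ v : Fin 4 → ℂ, c = klein u v

/-- The edge `E_ij ≅ ℂP¹` of the tetrahedron, the projective line joining `ω_i` and `ω_j`. -/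
def edge (i j : Fin 4) : Set EndField :=
  {J | J ∈ Z ∧ ∃ u : Fin 4 → ℂ, u ≠ 0 ∧ (∀ k, k ≠ i → k ≠ j → u k = 0) ∧ IsPoint J u}

/-- The face `F_i ≅ ℂP²` of the tetrahedron opposite `ω_i`, the projective plane `u_i = 0`. -/
def face (i : Fin 4) : Set EndField :=
  {J | J ∈ Z ∧ ∃ u : Fin 4 → ℂ, u ≠ 0 ∧ u i = 0 ∧ IsPoint J u}

/-- The 1-form `f^(j+1) = P(e^(j+1))`, for a matrix `P` acting on `⟨e¹, e², e³, e⁴⟩`. -/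
def rotated (P : Matrix (Fin 4) (Fin 4) ℝ) (j : Fin 4) (m : IwasawaManifold) (u : T m) : ℝ :=
  ∑ i : Fin 4, P i j * e (Fin.castLE (by decide) i) m u

/-- The 2-form `ω(P; a, b) = e⁵∧(a e⁶ + b f¹) - f²∧(a f¹ - b e⁶) + f³∧f⁴`, with `fʲ = P(eʲ)`. -/
def omegaForm (P : Matrix (Fin 4) (Fin 4) ℝ) (a b : ℝ) (m : IwasawaManifold) (u v : T m) : ℝ :=
  wedge (e 4 m) (fun x => a * e 5 m x + b * rotated P 0 m x) u v -
    wedge (rotated P 1 m) (fun x => a * rotated P 0 m x - b * e 5 m x) u v +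
      wedge (rotated P 2 m) (rotated P 3 m) u v

/-- The basis `e¹²+e³⁴, e¹³+e⁴², e¹⁴+e²³` of the self-dual 2-forms on `⟨e¹, e², e³, e⁴⟩`, where a
skew-symmetric matrix `σ` stands for the 2-form `∑_{i<j} σ i j eⁱ∧eʲ`. -/
def selfDual : Fin 3 → Matrix (Fin 4) (Fin 4) ℝ :=
  ![!![0, 1, 0, 0; -1, 0, 0, 0; 0, 0, 0, 1; 0, 0, -1, 0],
    !![0, 0, 1, 0; 0, 0, 0, -1; -1, 0, 0, 0; 0, 1, 0, 0],
    !![0, 0, 0, 1; 0, 0, 1, 0; 0, -1, 0, 0; -1, 0, 0, 0]]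

/-- The matrix `P₊` of the action of `P ∈ SO(4)` on self-dual 2-forms, in the basis `selfDual`.
The action is `σ ↦ P σ Pᵀ`, and `trace (σ τᵀ) / 4` is the inner product for which this basis is
orthonormal. -/
def plusPart (P : Matrix (Fin 4) (Fin 4) ℝ) : Matrix (Fin 3) (Fin 3) ℝ :=
  Matrix.of fun i j =>
    (selfDual i * (P * selfDual j * P.transpose).transpose).trace / 4

/-- The 3-sphere `𝒮`: the forms `ω(P; 0, 1)` with `P ∈ SO(4)` such that the top left entry `r` of `P₊`
equals 1. -/
def sphereS : Set EndField :=
  {J | J ∈ Z ∧ ∃ P ∈ Matrix.specialOrthogonalGroup (Fin 4) ℝ,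
    plusPart P 0 0 = 1 ∧ fundamentalForm J = omegaForm P 0 1}

end Iwasawa

end

/-! Since $J$ has constant coefficients, $\nabla\omega$ is one constant trilinear form, built by the
Koszul formula from $g([x,y],z)$ and the matrix $B$ of $J$. The question becomes algebraic: for
which $[u]\in\mathbb{CP}^3$ do prescribed Gray–Hervella components of this form vanish?

The components separate under $\alpha(x;y,z)\mapsto\alpha(Jx;Jy,z)$, which is $-1$ on $W_1\oplus
W_2$ and $+1$ on $W_3\oplus W_4$. Writing a $(0,1)$-vector as $x+iJx$, the first half is the Koszul
form on three $(0,1)$-vectors, and the second its value on one $(1,0)$-vector and two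
$(0,1)$-vectors (`IsNabla.koszul_antiholomorphic`, `IsNabla.koszul_conj_antiholomorphic`). The
metric identifies the $(0,1)$-vectors with $V_u=\{u\wedge v\}$, so in Plücker coordinates each test
becomes a polynomial condition on $u$ and $\bar u$.

Four conditions carry everything. No $W_1$ part: the cyclic sum on $V_u$ is
$\pm\tfrac12u_3^2\det(u,a,b,c)$, so $u_3=0$. No $W_2$ part: $u_0=u_3=0$ or $u_1=u_2=u_3=0$, and then
$W_1$ vanishes too (`eq_zero_of_koszul_swap`, `koszul_klein_eq_zero`). No $W_4$ part: the trace of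
$\nabla\omega$ is governed by $u_0\bar u_3$, so $u_0u_3=0$ (`IsNabla.trace12_eq_zero_iff`). No $W_3$
part: $u_0=u_1=u_2=0$, or $u_3=0$ and $|u_0|^2=|u_1|^2+|u_2|^2$, and then $W_4$ vanishes too
(`point_of_koszul_conj`).

These loci are the faces, vertices, edge and 3-sphere of the statement. This uses that every
$J\in\mathcal Z$ is some $[u]$ (`exists_isTwistor`), which rests on $*\tfrac12\omega^2=\omega$ for
positively oriented orthogonal $J$. All sixteen classes then follow by monotonicity in the index
set: each is squeezed between known loci, or lies in two disjoint ones. -/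

noncomputable section

namespace Iwasawa

/-! ### Linear algebra of the Gray–Hervella components in dimension six. -/

section GrayHervella

variable {V : Type} [AddCommGroup V] [Module ℝ V]

/-- The inner product on `V` transported from `ℝ⁶`. -/
def pullDot (φ : V ≃ₗ[ℝ] (Fin 6 → ℝ)) (x y : V) : ℝ := ∑ i, φ x i * φ y i

/-- The trilinear map with the given values. -/
theorem exists_trilinear (f : V → V → V → ℝ)
    (h1 : ∀ x x' y z, f (x + x') y z = f x y z + f x' y z)
    (h2 : ∀ x y y' z, f x (y + y') z = f x y z + f x y' z)
    (h3 : ∀ x y z z', f x y (z + z') = f x y z + f x y z')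
    (s1 : ∀ (c : ℝ) x y z, f (c • x) y z = c * f x y z)
    (s2 : ∀ (c : ℝ) x y z, f x (c • y) z = c * f x y z)
    (s3 : ∀ (c : ℝ) x y z, f x y (c • z) = c * f x y z) :
    ∃ α : V →ₗ[ℝ] V →ₗ[ℝ] V →ₗ[ℝ] ℝ, ∀ x y z, α x y z = f x y z := by
  refine ⟨LinearMap.mk₂ ℝ (fun x y =>
    { toFun := f x y, map_add' := h3 x y, map_smul' := fun c z => s3 c x y z }) ?_ ?_ ?_ ?_,
    fun x y z => rfl⟩
  · exact fun x x' y => LinearMap.ext fun z => h1 x x' y z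
  · exact fun c x y => LinearMap.ext fun z => s1 c x y z
  · exact fun x y y' => LinearMap.ext fun z => h2 x y y' z
  · exact fun c x y => LinearMap.ext fun z => s2 c x y z

variable (φ : V ≃ₗ[ℝ] (Fin 6 → ℝ)) (J : V →ₗ[ℝ] V)

theorem pullDot_comm (x y : V) : pullDot φ x y = pullDot φ y x :=
  Finset.sum_congr rfl fun _ _ => mul_comm _ _

theorem pullDot_add_left (x x' y : V) :
    pullDot φ (x + x') y = pullDot φ x y + pullDot φ x' y := by
  simp [pullDot, add_mul, Finset.sum_add_distrib]

theorem pullDot_smul_left (c : ℝ) (x y : V) : pullDot φ (c • x) y = c * pullDot φ x y := by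
  simp [pullDot, Finset.mul_sum, mul_assoc]

theorem pullDot_neg_right (x y : V) : pullDot φ x (-y) = -pullDot φ x y := by
  simp [pullDot]

theorem pullDot_add_right (x y y' : V) :
    pullDot φ x (y + y') = pullDot φ x y + pullDot φ x y' := by
  simp [pullDot, mul_add, Finset.sum_add_distrib]

theorem pullDot_smul_right (c : ℝ) (x y : V) : pullDot φ x (c • y) = c * pullDot φ x y := by
  rw [pullDot_comm, pullDot_smul_left, pullDot_comm]

/-- The orthonormal basis of `V` given by `φ`. -/
def stdVec (i : Fin 6) : V := φ.symm (Pi.single i 1)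

theorem stdVec_orthonormal (i j : Fin 6) :
    pullDot φ (stdVec φ i) (stdVec φ j) = if i = j then 1 else 0 := by
  simp [pullDot, stdVec, Pi.single_apply, eq_comm]

theorem eq_sum_stdVec (x : V) : x = ∑ j, φ x j • stdVec φ j := by
  apply φ.injective
  ext k
  simp [stdVec, Pi.single_apply]

/-- The trace of a bilinear form may be computed in any orthonormal family. -/
theorem sum_orthonormal (β : V →ₗ[ℝ] V →ₗ[ℝ] ℝ) (b : Fin 6 → V)
    (hb : ∀ i j, pullDot φ (b i) (b j) = if i = j then 1 else 0) :
    ∑ i, β (b i) (b i) = ∑ i, β (stdVec φ i) (stdVec φ i) := by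
  have h1 : (Matrix.of fun i j => φ (b i) j) * (Matrix.of fun i j => φ (b i) j).transpose = 1 := by
    ext i j
    simpa [Matrix.mul_apply, Matrix.one_apply, pullDot] using hb i j
  -- Orthonormal rows of a square matrix give orthonormal columns, and it is the columns that enter
  -- the trace.
  have h2 := mul_eq_one_comm.1 h1
  have h3 : ∀ j k, ∑ i, φ (b i) j * φ (b i) k = if j = k then 1 else 0 := fun j k => by
    simpa [Matrix.mul_apply, Matrix.one_apply] using congrFun (congrFun h2 j) k
  have h4 : ∀ i, β (b i) (b i) =
      ∑ j, ∑ k, φ (b i) j * φ (b i) k * β (stdVec φ j) (stdVec φ k) := by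
    intro i
    conv_lhs => rw [eq_sum_stdVec φ (b i)]
    simp [Finset.mul_sum, mul_assoc]
    rw [Finset.sum_comm]
    exact Finset.sum_congr rfl fun _ _ => Finset.sum_congr rfl fun _ _ => by ring
  simp only [h4]
  rw [Finset.sum_comm]
  refine Finset.sum_congr rfl fun j _ => ?_
  rw [Finset.sum_comm]
  simp only [← Finset.sum_mul, h3]
  simp

/-- The trace `∑ α(bᵢ; bᵢ, z)`. -/
def trace12 (α : V →ₗ[ℝ] V →ₗ[ℝ] V →ₗ[ℝ] ℝ) : V →ₗ[ℝ] ℝ :=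
  ∑ i, α (stdVec φ i) (stdVec φ i)

theorem trace12_eq (α : V →ₗ[ℝ] V →ₗ[ℝ] V →ₗ[ℝ] ℝ) (b : Fin 6 → V)
    (hb : ∀ i j, pullDot φ (b i) (b j) = if i = j then 1 else 0) (z : V) :
    trace12 φ α z = ∑ i, α (b i) (b i) z := by
  have := sum_orthonormal φ (α.compr₂ (LinearMap.applyₗ z)) b hb
  simpa [trace12, LinearMap.sum_apply] using this.symm

/-- `J` is a complex structure that is orthogonal for `pullDot φ`. -/
structure IsOrthogonalComplex : Prop where
  sq : ∀ x, J (J x) = -x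
  orthogonal : ∀ x y, pullDot φ (J x) (J y) = pullDot φ x y

variable {φ J} {α : V →ₗ[ℝ] V →ₗ[ℝ] V →ₗ[ℝ] ℝ}

theorem IsOrthogonalComplex.skew (h : IsOrthogonalComplex φ J) (x y : V) :
    pullDot φ (J x) y = -pullDot φ x (J y) := by
  rw [← h.orthogonal x (J y), h.sq, pullDot_neg_right, neg_neg]

theorem IsOrthogonalComplex.apply_self (h : IsOrthogonalComplex φ J) (x : V) :
    pullDot φ x (J x) = 0 := by
  have := h.skew x x
  rw [pullDot_comm] at this
  linarith

/-- If $(b_i)$ is orthonormal then so is $(Jb_i)$, and the two computations of the same trace differ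
by a sign. -/
theorem trace12_eq_zero_of_anti (h : IsOrthogonalComplex φ J)
    (hα : ∀ x y z, α (J x) (J y) z = -α x y z) (z : V) : trace12 φ α z = 0 := by
  have h1 := trace12_eq φ α (stdVec φ) (stdVec_orthonormal φ) z
  have h2 := trace12_eq φ α (fun i => J (stdVec φ i))
    (fun i j => by rw [h.orthogonal, stdVec_orthonormal]) z
  simp only [hα, Finset.sum_neg_distrib] at h2
  linarith

theorem ghTotal_swap (hα : α ∈ ghTotal J) (x y z : V) : α x z y = -α x y z := (hα x y z).1

theorem ghTotal_move (h : IsOrthogonalComplex φ J) (hα : α ∈ ghTotal J) (x y z : V) :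
    α x y (J z) = α x (J y) z := by
  have := (hα x y (J z)).2
  rw [h.sq, map_neg] at this
  linarith

theorem ghW1_swap (hα : α ∈ ghW1 J) (x y z : V) : α y x z = -α x y z := by
  have h1 : ∀ x z, α x x z = 0 := hα.2
  have := h1 (x + y) z
  simp only [map_add, LinearMap.add_apply, h1] at this
  linarith

/-- A tensor in $W_1$ is skew in all three slots, so $J$ can be inserted in the last two slots,
where it costs a sign, after permuting. -/
theorem ghW1_anti (hα : α ∈ ghW1 J) (x y z : V) : α (J x) (J y) z = -α x y z := by
  have h0 := ghTotal_swap hα.1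
  have h1 := ghW1_swap hα
  rw [h1 (J y), h0 (J y) z, neg_neg, h1 z, (hα.1 z y x).2, h1 y z, h0 y x z, h1 x y]
  ring

theorem ghW2_cyclic (hα : α ∈ ghW2 J) (x y z : V) : α x y z + α y z x + α z x y = 0 :=
  hα.2 x y z

/-- Let $A,B,C$ be the values $\alpha(Jx;Jy,z)$, $\alpha(Jy;Jz,x)$, $\alpha(Jz;Jx,y)$ and $a,b,c$
the same without $J$. The cyclic identity at triples with two $J$'s gives $B+C=a$, $A+C=b$, $A+B=c$;
with $a+b+c=0$ this yields $A=-a$. -/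
theorem ghW2_anti (h : IsOrthogonalComplex φ J) (hα : α ∈ ghW2 J) (x y z : V) :
    α (J x) (J y) z = -α x y z := by
  have hc := ghW2_cyclic hα
  have hm := ghTotal_move h hα.1
  have h1 := hc x y z
  have h2 := hc x (J y) (J z)
  have h3 := hc (J x) (J y) z
  have h4 := hc (J x) y (J z)
  rw [(hα.1 x y z).2, hm (J z) x y] at h2
  rw [(hα.1 z x y).2, hm (J y) z x] at h3
  rw [(hα.1 y z x).2, hm (J x)] at h4
  linarith

theorem ghW4_apply {θ : V →ₗ[ℝ] ℝ} (h : IsOrthogonalComplex φ J) (x y z : V)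
    (hα : ∀ x y z, α x y z = pullDot φ x y * θ z - pullDot φ x z * θ y
      - pullDot φ x (J y) * θ (J z) + pullDot φ x (J z) * θ (J y)) :
    α (J x) (J y) z = α x y z := by
  rw [hα, hα, h.sq, h.orthogonal, h.orthogonal, h.skew, pullDot_neg_right, h.skew, map_neg]
  ring

theorem ghW4_invariant (h : IsOrthogonalComplex φ J) (hα : α ∈ ghW4 (pullDot φ) J) (x y z : V) :
    α (J x) (J y) z = α x y z := by
  obtain ⟨θ, hθ⟩ := hα.2
  exact ghW4_apply h x y z hθ

theorem ghW3_invariant (hα : α ∈ ghW3 (pullDot φ) J) (x y z : V) :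
    α (J x) (J y) z = α x y z := hα.2.1 x y z

theorem ghW3_trace (hα : α ∈ ghW3 (pullDot φ) J) (z : V) : trace12 φ α z = 0 := by
  have := hα.2.2 (Module.Basis.ofEquivFun φ) (fun i j => by
    simpa [stdVec] using stdVec_orthonormal φ i j) z
  simpa [trace12, LinearMap.sum_apply, stdVec] using this

theorem ghW1_trace (hα : α ∈ ghW1 J) (z : V) : trace12 φ α z = 0 := by
  have h1 : ∀ x z, α x x z = 0 := hα.2
  simp [trace12, LinearMap.sum_apply, h1]

variable (J) in
/-- Twice the `W₁ ⊕ W₂` part of `α`. -/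
def antiPart (α : V →ₗ[ℝ] V →ₗ[ℝ] V →ₗ[ℝ] ℝ) (x y z : V) : ℝ := α x y z - α (J x) (J y) z

variable (J) in
/-- Twice the `W₃ ⊕ W₄` part of `α`. -/
def invPart (α : V →ₗ[ℝ] V →ₗ[ℝ] V →ₗ[ℝ] ℝ) (x y z : V) : ℝ := α x y z + α (J x) (J y) z

/-! ### Consequences of membership -/

/-- Without a $W_2$ component, `antiPart` is twice the $W_1$ component, which is skew. -/
theorem antiPart_swap_of_mem (h : IsOrthogonalComplex φ J)
    (hα : α ∈ ⨆ i ∈ ({1, 3, 4} : Set ℕ), ghComponent (pullDot φ) J i) (x y z : V) :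
    antiPart J α y x z = -antiPart J α x y z := by
  simp only [iSup_insert, iSup_singleton, ghComponent, Submodule.mem_sup] at hα
  obtain ⟨α₁, h₁, _, ⟨α₃, h₃, α₄, h₄, rfl⟩, rfl⟩ := hα
  simp only [antiPart, LinearMap.add_apply, ghW1_anti h₁, ghW3_invariant h₃, ghW4_invariant h h₄]
  rw [ghW1_swap h₁]
  ring

/-- Without a $W_1$ component, `antiPart` is twice the $W_2$ component. -/
theorem antiPart_cyclic_of_mem (h : IsOrthogonalComplex φ J)
    (hα : α ∈ ⨆ i ∈ ({2, 3, 4} : Set ℕ), ghComponent (pullDot φ) J i) (x y z : V) :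
    antiPart J α x y z + antiPart J α y z x + antiPart J α z x y = 0 := by
  simp only [iSup_insert, iSup_singleton, ghComponent, Submodule.mem_sup] at hα
  obtain ⟨α₂, h₂, _, ⟨α₃, h₃, α₄, h₄, rfl⟩, rfl⟩ := hα
  simp only [antiPart, LinearMap.add_apply, ghW2_anti h h₂, ghW3_invariant h₃, ghW4_invariant h h₄]
  linear_combination 2 * ghW2_cyclic h₂ x y z

/-- Without a $W_3$ component, `invPart` is twice the $W_4$ component, so only an unknown 1-form
remains. -/
theorem invPart_of_mem (h : IsOrthogonalComplex φ J)
    (hα : α ∈ ⨆ i ∈ ({1, 2, 4} : Set ℕ), ghComponent (pullDot φ) J i) :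
    ∃ θ : V →ₗ[ℝ] ℝ, ∀ x y z, invPart J α x y z = 2 * (pullDot φ x y * θ z - pullDot φ x z * θ y
      - pullDot φ x (J y) * θ (J z) + pullDot φ x (J z) * θ (J y)) := by
  simp only [iSup_insert, iSup_singleton, ghComponent, Submodule.mem_sup] at hα
  obtain ⟨α₁, h₁, _, ⟨α₂, h₂, α₄, h₄, rfl⟩, rfl⟩ := hα
  obtain ⟨θ, hθ⟩ := h₄.2
  refine ⟨θ, fun x y z => ?_⟩
  simp only [invPart, LinearMap.add_apply, ghW2_anti h h₂, ghW1_anti h₁, ghW4_invariant h h₄]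
  rw [hθ]
  ring

theorem trace12_of_mem (h : IsOrthogonalComplex φ J)
    (hα : α ∈ ⨆ i ∈ ({1, 2, 3} : Set ℕ), ghComponent (pullDot φ) J i) (z : V) :
    trace12 φ α z = 0 := by
  simp only [iSup_insert, iSup_singleton, ghComponent, Submodule.mem_sup] at hα
  obtain ⟨α₁, h₁, _, ⟨α₂, h₂, α₃, h₃, rfl⟩, rfl⟩ := hα
  have e1 := ghW1_trace (φ := φ) h₁ z
  have e2 := trace12_eq_zero_of_anti h (ghW2_anti h h₂) z
  have e3 := ghW3_trace h₃ z
  simp only [trace12, LinearMap.sum_apply, LinearMap.add_apply, Finset.sum_add_distrib] at *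
  linarith

/-! ### Criteria for membership -/

/-- The halves are the eigencomponents of the involution $\alpha\mapsto\alpha(J\cdot;J\cdot,\cdot)$;
it preserves the space $W$, so both halves stay in $W$. -/
theorem exists_parts (h : IsOrthogonalComplex φ J) (hα : α ∈ ghTotal J) :
    ∃ β γ : V →ₗ[ℝ] V →ₗ[ℝ] V →ₗ[ℝ] ℝ, α = β + γ ∧ β ∈ ghTotal J ∧ γ ∈ ghTotal J ∧
      (∀ x y z, 2 * β x y z = antiPart J α x y z) ∧ (∀ x y z, 2 * γ x y z = invPart J α x y z) ∧
      (∀ x y z, β (J x) (J y) z = -β x y z) ∧ (∀ x y z, γ (J x) (J y) z = γ x y z) := by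
  have hm := ghTotal_move h hα
  have hs := ghTotal_swap hα
  have e : ∀ x y z, (α.compl₁₂ J J) x y z = α (J x) (J y) z := fun x y z => rfl
  have hJ : α.compl₁₂ J J ∈ ghTotal J := by
    intro x y z
    simp only [e, h.sq, map_neg, LinearMap.neg_apply]
    constructor
    · rw [← hm, hs]
    · rw [hm]
  refine ⟨(1 / 2 : ℝ) • (α + (-1 : ℝ) • α.compl₁₂ J J), (1 / 2 : ℝ) • (α + α.compl₁₂ J J),
    ?_, ?_, ?_, ?_, ?_, ?_, ?_⟩
  · refine LinearMap.ext fun x => LinearMap.ext fun y => LinearMap.ext fun z => ?_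
    simp only [LinearMap.smul_apply, LinearMap.add_apply, smul_eq_mul]
    ring
  · exact Submodule.smul_mem _ _ (Submodule.add_mem _ hα (Submodule.smul_mem _ _ hJ))
  · exact Submodule.smul_mem _ _ (Submodule.add_mem _ hα hJ)
  all_goals
    intro x y z
    simp only [LinearMap.smul_apply, LinearMap.add_apply, e, smul_eq_mul,
      antiPart, invPart, h.sq, map_neg, LinearMap.neg_apply]
    ring

theorem mem_ghW3 (hα : α ∈ ghTotal J)
    (hi : ∀ x y z, α (J x) (J y) z = α x y z) (ht : ∀ z, trace12 φ α z = 0) :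
    α ∈ ghW3 (pullDot φ) J :=
  ⟨hα, hi, fun b hb z => by rw [← trace12_eq φ α b hb, ht]⟩

theorem mem_sup_of_eq {p q : Submodule ℝ (V →ₗ[ℝ] V →ₗ[ℝ] V →ₗ[ℝ] ℝ)}
    {β : V →ₗ[ℝ] V →ₗ[ℝ] V →ₗ[ℝ] ℝ} (hβ : β ∈ q) (hα : α + (-1 : ℝ) • β ∈ p) : α ∈ p ⊔ q := by
  refine Submodule.mem_sup.2 ⟨_, hα, β, hβ, ?_⟩
  refine LinearMap.ext fun x => LinearMap.ext fun y => LinearMap.ext fun z => ?_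
  simp

/-- The $W_1$ component is the skew-symmetrization, which for a tensor skew in its last two slots is
one third of the cyclic sum; the remainder has zero cyclic sum. -/
theorem mem_ghW1_sup_ghW2 (h : IsOrthogonalComplex φ J) (hα : α ∈ ghTotal J)
    (ha : ∀ x y z, α (J x) (J y) z = -α x y z) : α ∈ ghW1 J ⊔ ghW2 J := by
  obtain ⟨β, hβ⟩ := exists_trilinear (fun x y z => 1 / 3 * (α x y z + α y z x + α z x y))
    (by intros; simp only [map_add, LinearMap.add_apply]; ring)
    (by intros; simp only [map_add, LinearMap.add_apply]; ring)
    (by intros; simp only [map_add, LinearMap.add_apply]; ring)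
    (by intros; simp only [map_smul, LinearMap.smul_apply, smul_eq_mul]; ring)
    (by intros; simp only [map_smul, LinearMap.smul_apply, smul_eq_mul]; ring)
    (by intros; simp only [map_smul, LinearMap.smul_apply, smul_eq_mul]; ring)
  have hs := ghTotal_swap hα
  have hm := ghTotal_move h hα
  have hβt : β ∈ ghTotal J := by
    intro x y z
    rw [hβ, hβ, hβ]
    constructor
    · linarith [hs x y z, hs y z x, hs z x y]
    · rw [(hα x y z).2, ha, hm (J z), ha]
      ring
  rw [sup_comm]
  refine mem_sup_of_eq (β := β) ⟨hβt, ?_⟩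
    ⟨Submodule.add_mem _ hα (Submodule.smul_mem _ _ hβt), ?_⟩
  · intro x z
    rw [hβ]
    linarith [hs x x z, hs x z x, hs z x x]
  · intro x y z
    simp only [LinearMap.add_apply, LinearMap.smul_apply, smul_eq_mul, hβ]
    ring

theorem mem_ghW3_sup_ghW4 (h : IsOrthogonalComplex φ J) (hα : α ∈ ghTotal J)
    (hi : ∀ x y z, α (J x) (J y) z = α x y z) :
    α ∈ ghW3 (pullDot φ) J ⊔ ghW4 (pullDot φ) J := by
  -- The factor is $1/(\dim V-2)$: the $W_4$ tensor of $\theta$ has trace $(6-1-0-1)\theta=4\theta$,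
  -- so subtracting it leaves a trace-free tensor.
  set θ : V →ₗ[ℝ] ℝ := (1 / 4 : ℝ) • trace12 φ α with hθ
  obtain ⟨β, hβ⟩ := exists_trilinear (fun x y z => pullDot φ x y * θ z - pullDot φ x z * θ y
      - pullDot φ x (J y) * θ (J z) + pullDot φ x (J z) * θ (J y))
    (by intros; simp only [pullDot_add_left]; ring)
    (by intros; simp only [map_add, pullDot_add_right]; ring)
    (by intros; simp only [map_add, pullDot_add_right]; ring)
    (by intros; simp only [pullDot_smul_left]; ring)
    (by intros; simp only [map_smul, pullDot_smul_right, smul_eq_mul]; ring)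
    (by intros; simp only [map_smul, pullDot_smul_right, smul_eq_mul]; ring)
  have hβt : β ∈ ghTotal J := by
    intro x y z
    rw [hβ, hβ, hβ]
    simp only [h.sq, pullDot_neg_right, map_neg]
    constructor <;> ring
  have hβi : ∀ x y z, β (J x) (J y) z = β x y z := fun x y z => ghW4_apply h x y z hβ
  have hsum : ∀ (y : V) (f : V →ₗ[ℝ] ℝ), ∑ i, pullDot φ (stdVec φ i) y * f (stdVec φ i) = f y := by
    intro y f
    conv_rhs => rw [eq_sum_stdVec φ y]
    simp [pullDot, stdVec, Pi.single_apply]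
  have hβtr : ∀ z, trace12 φ β z = trace12 φ α z := by
    intro z
    have h1 := hsum z θ
    have h2 := hsum (J z) (θ ∘ₗ J)
    simp only [LinearMap.comp_apply, h.sq, map_neg] at h2
    have h3 : trace12 φ α z = 4 * θ z := by simp [hθ]
    simp only [trace12, LinearMap.sum_apply, hβ, Finset.sum_add_distrib, Finset.sum_sub_distrib,
      h1, h2, h.apply_self, stdVec_orthonormal] at h3 ⊢
    rw [h3]
    simp
    ring
  refine mem_sup_of_eq (β := β) ⟨hβt, θ, hβ⟩
    (mem_ghW3 (Submodule.add_mem _ hα (Submodule.smul_mem _ _ hβt)) ?_ ?_)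
  · intro x y z
    simp only [LinearMap.add_apply, LinearMap.smul_apply, hi, hβi]
  · intro z
    have := hβtr z
    simp only [trace12, LinearMap.sum_apply, LinearMap.add_apply, LinearMap.smul_apply, smul_eq_mul,
      Finset.sum_add_distrib, ← Finset.mul_sum] at *
    linarith

theorem trace12_add (β γ : V →ₗ[ℝ] V →ₗ[ℝ] V →ₗ[ℝ] ℝ) (z : V) :
    trace12 φ (β + γ) z = trace12 φ β z + trace12 φ γ z := by
  simp [trace12, LinearMap.sum_apply, Finset.sum_add_distrib]

theorem mem_class1234 (h : IsOrthogonalComplex φ J) (hα : α ∈ ghTotal J) :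
    α ∈ ⨆ i ∈ ({1, 2, 3, 4} : Set ℕ), ghComponent (pullDot φ) J i := by
  obtain ⟨β, γ, rfl, hβ, hγ, -, -, ha, hi⟩ := exists_parts h hα
  simp only [iSup_insert, iSup_singleton, ghComponent]
  rw [← sup_assoc]
  exact Submodule.add_mem_sup (mem_ghW1_sup_ghW2 h hβ ha) (mem_ghW3_sup_ghW4 h hγ hi)

theorem mem_class123 (h : IsOrthogonalComplex φ J) (hα : α ∈ ghTotal J)
    (ht : ∀ z, trace12 φ α z = 0) :
    α ∈ ⨆ i ∈ ({1, 2, 3} : Set ℕ), ghComponent (pullDot φ) J i := by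
  obtain ⟨β, γ, rfl, hβ, hγ, -, -, ha, hi⟩ := exists_parts h hα
  simp only [iSup_insert, iSup_singleton, ghComponent]
  rw [← sup_assoc]
  refine Submodule.add_mem_sup (mem_ghW1_sup_ghW2 h hβ ha) (mem_ghW3 hγ hi fun z => ?_)
  have := ht z
  rwa [trace12_add, trace12_eq_zero_of_anti h ha, zero_add] at this

theorem mem_class23 (h : IsOrthogonalComplex φ J) (hα : α ∈ ghTotal J)
    (ht : ∀ z, trace12 φ α z = 0)
    (hc : ∀ x y z, antiPart J α x y z + antiPart J α y z x + antiPart J α z x y = 0) :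
    α ∈ ⨆ i ∈ ({2, 3} : Set ℕ), ghComponent (pullDot φ) J i := by
  obtain ⟨β, γ, e, hβ, hγ, hβ', -, ha, hi⟩ := exists_parts h hα
  simp only [iSup_insert, iSup_singleton, ghComponent]
  simp only [← hβ'] at hc
  subst e
  refine Submodule.add_mem_sup ⟨hβ, fun x y z => by linarith [hc x y z]⟩
    (mem_ghW3 hγ hi fun z => ?_)
  have := ht z
  rwa [trace12_add, trace12_eq_zero_of_anti h ha, zero_add] at this

theorem mem_class12 (h : IsOrthogonalComplex φ J) (hα : α ∈ ghTotal J)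
    (hi : ∀ x y z, invPart J α x y z = 0) :
    α ∈ ⨆ i ∈ ({1, 2} : Set ℕ), ghComponent (pullDot φ) J i := by
  simp only [iSup_insert, iSup_singleton, ghComponent]
  exact mem_ghW1_sup_ghW2 h hα fun x y z => by linarith [hi x y z, invPart.eq_1 J α x y z]

theorem mem_class2 (hα : α ∈ ghTotal J)
    (hi : ∀ x y z, invPart J α x y z = 0)
    (hc : ∀ x y z, antiPart J α x y z + antiPart J α y z x + antiPart J α z x y = 0) :
    α ∈ ⨆ i ∈ ({2} : Set ℕ), ghComponent (pullDot φ) J i := by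
  simp only [iSup_singleton, ghComponent]
  refine ⟨hα, fun x y z => ?_⟩
  have h1 := hi x y z
  have h2 := hi y z x
  have h3 := hi z x y
  have h4 := hc x y z
  simp only [invPart, antiPart] at h1 h2 h3 h4
  linarith

theorem mem_class3 (hα : α ∈ ghTotal J) (ht : ∀ z, trace12 φ α z = 0)
    (ha : ∀ x y z, antiPart J α x y z = 0) :
    α ∈ ⨆ i ∈ ({3} : Set ℕ), ghComponent (pullDot φ) J i := by
  simp only [iSup_singleton, ghComponent]
  exact mem_ghW3 hα (fun x y z => by linarith [ha x y z, antiPart.eq_1 J α x y z]) ht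

end GrayHervella

/-! ### Self-duality $*\tfrac12\omega^2=\omega$ of a positively oriented orthogonal complex
structure. -/

section Pfaffian

/-- The skew-symmetric matrix with the given entries above the diagonal. -/
def skewMatrix {R : Type*} [Ring R] (b : Fin 6 → Fin 6 → R) : Matrix (Fin 6) (Fin 6) R :=
  !![0, b 0 1, b 0 2, b 0 3, b 0 4, b 0 5;
    -b 0 1, 0, b 1 2, b 1 3, b 1 4, b 1 5;
    -b 0 2, -b 1 2, 0, b 2 3, b 2 4, b 2 5;
    -b 0 3, -b 1 3, -b 2 3, 0, b 3 4, b 3 5;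
    -b 0 4, -b 1 4, -b 2 4, -b 3 4, 0, b 4 5;
    -b 0 5, -b 1 5, -b 2 5, -b 3 5, -b 4 5, 0]

theorem eq_skewMatrix {B : Matrix (Fin 6) (Fin 6) ℝ} (h : ∀ i j, B j i = -B i j) :
    B = skewMatrix B := by
  have h0 : ∀ i, B i i = 0 := fun i => by linarith [h i i]
  ext i j
  fin_cases i <;> fin_cases j <;> first | exact h0 _ | rfl | exact h _ _

/-- The entries above the diagonal of the matrix of 4 × 4 sub-Pfaffians of `skewMatrix b`. -/
def subPfaffian {R : Type*} [Ring R] (b : Fin 6 → Fin 6 → R) : Fin 6 → Fin 6 → R :=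
  ![![0, b 2 3 * b 4 5 - b 2 4 * b 3 5 + b 2 5 * b 3 4, -b 1 3 * b 4 5 + b 1 4 * b 3 5 - b 1 5 * b 3 4, b 1 2 * b 4 5 - b 1 4 * b 2 5 + b 1 5 * b 2 4, -b 1 2 * b 3 5 + b 1 3 * b 2 5 - b 1 5 * b 2 3, b 1 2 * b 3 4 - b 1 3 * b 2 4 + b 1 4 * b 2 3],
    ![-b 2 3 * b 4 5 + b 2 4 * b 3 5 - b 2 5 * b 3 4, 0, b 0 3 * b 4 5 - b 0 4 * b 3 5 + b 0 5 * b 3 4, -b 0 2 * b 4 5 + b 0 4 * b 2 5 - b 0 5 * b 2 4, b 0 2 * b 3 5 - b 0 3 * b 2 5 + b 0 5 * b 2 3, -b 0 2 * b 3 4 + b 0 3 * b 2 4 - b 0 4 * b 2 3],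
    ![b 1 3 * b 4 5 - b 1 4 * b 3 5 + b 1 5 * b 3 4, -b 0 3 * b 4 5 + b 0 4 * b 3 5 - b 0 5 * b 3 4, 0, b 0 1 * b 4 5 - b 0 4 * b 1 5 + b 0 5 * b 1 4, -b 0 1 * b 3 5 + b 0 3 * b 1 5 - b 0 5 * b 1 3, b 0 1 * b 3 4 - b 0 3 * b 1 4 + b 0 4 * b 1 3],
    ![-b 1 2 * b 4 5 + b 1 4 * b 2 5 - b 1 5 * b 2 4, b 0 2 * b 4 5 - b 0 4 * b 2 5 + b 0 5 * b 2 4, -b 0 1 * b 4 5 + b 0 4 * b 1 5 - b 0 5 * b 1 4, 0, b 0 1 * b 2 5 - b 0 2 * b 1 5 + b 0 5 * b 1 2, -b 0 1 * b 2 4 + b 0 2 * b 1 4 - b 0 4 * b 1 2],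
    ![b 1 2 * b 3 5 - b 1 3 * b 2 5 + b 1 5 * b 2 3, -b 0 2 * b 3 5 + b 0 3 * b 2 5 - b 0 5 * b 2 3, b 0 1 * b 3 5 - b 0 3 * b 1 5 + b 0 5 * b 1 3, -b 0 1 * b 2 5 + b 0 2 * b 1 5 - b 0 5 * b 1 2, 0, b 0 1 * b 2 3 - b 0 2 * b 1 3 + b 0 3 * b 1 2],
    ![-b 1 2 * b 3 4 + b 1 3 * b 2 4 - b 1 4 * b 2 3, b 0 2 * b 3 4 - b 0 3 * b 2 4 + b 0 4 * b 2 3, -b 0 1 * b 3 4 + b 0 3 * b 1 4 - b 0 4 * b 1 3, b 0 1 * b 2 4 - b 0 2 * b 1 4 + b 0 4 * b 1 2, -b 0 1 * b 2 3 + b 0 2 * b 1 3 - b 0 3 * b 1 2, 0]]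

/-- The Pfaffian of `skewMatrix b`. -/
def pfaffian (b : Fin 6 → Fin 6 → ℝ) : ℝ := ∑ j, b 0 j * subPfaffian b 0 j

theorem skewMatrix_mul_subPfaffian (b : Fin 6 → Fin 6 → ℝ) :
    skewMatrix b * Matrix.of (subPfaffian b) = -pfaffian b • (1 : Matrix (Fin 6) (Fin 6) ℝ) := by
  ext i j
  rw [Matrix.mul_apply, Fin.sum_univ_six]
  fin_cases i <;> fin_cases j <;>
    simp [skewMatrix, subPfaffian, pfaffian, Fin.sum_univ_succ] <;> ring

/-- If the skew matrix has eigenvalues $\pm i\lambda_k$, both sides equal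
$2\sum_{k<l}\lambda_k^2\lambda_l^2$. This fixes the absolute value of the Pfaffian. -/
theorem sum_subPfaffian_sq (b : Fin 6 → Fin 6 → ℝ) :
    ∑ i, ∑ j, (subPfaffian b i j) ^ 2 =
      ((∑ i, ∑ j, (skewMatrix b i j) ^ 2) ^ 2 / 4 -
        (∑ i, ∑ j, ((skewMatrix b * skewMatrix b) i j) ^ 2) / 2) := by
  simp only [Matrix.mul_apply, Fin.sum_univ_six]
  simp [skewMatrix, subPfaffian]
  ring

/-- The oriented volume of `(u, B u, v, B v, w, B w)`. -/
def complexVolume (B : Matrix (Fin 6) (Fin 6) ℝ) (u v w : Fin 6 → ℝ) : ℝ :=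
  Matrix.det (Matrix.of fun i j =>
    (![u, B.mulVec u, v, B.mulVec v, w, B.mulVec w] : Fin 6 → Fin 6 → ℝ) j i)

theorem det_unit_1_2 (a b c : Fin 6 → ℝ) : Matrix.det (Matrix.of fun i j =>
    (![Pi.single 0 1, a, Pi.single 1 1, b, Pi.single 2 1, c] : Fin 6 → Fin 6 → ℝ) j i) =
      -a 3 * b 4 * c 5 + a 3 * b 5 * c 4 + a 4 * b 3 * c 5 - a 4 * b 5 * c 3 - a 5 * b 3 * c 4 + a 5 * b 4 * c 3 := by
  simp [Matrix.det_succ_column_zero, Fin.sum_univ_succ, Fin.succAbove, Pi.single_apply]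
  ring

theorem det_unit_1_3 (a b c : Fin 6 → ℝ) : Matrix.det (Matrix.of fun i j =>
    (![Pi.single 0 1, a, Pi.single 1 1, b, Pi.single 3 1, c] : Fin 6 → Fin 6 → ℝ) j i) =
      a 2 * b 4 * c 5 - a 2 * b 5 * c 4 - a 4 * b 2 * c 5 + a 4 * b 5 * c 2 + a 5 * b 2 * c 4 - a 5 * b 4 * c 2 := by
  simp [Matrix.det_succ_column_zero, Fin.sum_univ_succ, Fin.succAbove, Pi.single_apply]
  ring

theorem det_unit_1_4 (a b c : Fin 6 → ℝ) : Matrix.det (Matrix.of fun i j =>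
    (![Pi.single 0 1, a, Pi.single 1 1, b, Pi.single 4 1, c] : Fin 6 → Fin 6 → ℝ) j i) =
      -a 2 * b 3 * c 5 + a 2 * b 5 * c 3 + a 3 * b 2 * c 5 - a 3 * b 5 * c 2 - a 5 * b 2 * c 3 + a 5 * b 3 * c 2 := by
  simp [Matrix.det_succ_column_zero, Fin.sum_univ_succ, Fin.succAbove, Pi.single_apply]
  ring

theorem det_unit_1_5 (a b c : Fin 6 → ℝ) : Matrix.det (Matrix.of fun i j =>
    (![Pi.single 0 1, a, Pi.single 1 1, b, Pi.single 5 1, c] : Fin 6 → Fin 6 → ℝ) j i) =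
      a 2 * b 3 * c 4 - a 2 * b 4 * c 3 - a 3 * b 2 * c 4 + a 3 * b 4 * c 2 + a 4 * b 2 * c 3 - a 4 * b 3 * c 2 := by
  simp [Matrix.det_succ_column_zero, Fin.sum_univ_succ, Fin.succAbove, Pi.single_apply]
  ring

theorem det_unit_2_3 (a b c : Fin 6 → ℝ) : Matrix.det (Matrix.of fun i j =>
    (![Pi.single 0 1, a, Pi.single 2 1, b, Pi.single 3 1, c] : Fin 6 → Fin 6 → ℝ) j i) =
      -a 1 * b 4 * c 5 + a 1 * b 5 * c 4 + a 4 * b 1 * c 5 - a 4 * b 5 * c 1 - a 5 * b 1 * c 4 + a 5 * b 4 * c 1 := by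
  simp [Matrix.det_succ_column_zero, Fin.sum_univ_succ, Fin.succAbove, Pi.single_apply]
  ring

theorem det_unit_2_4 (a b c : Fin 6 → ℝ) : Matrix.det (Matrix.of fun i j =>
    (![Pi.single 0 1, a, Pi.single 2 1, b, Pi.single 4 1, c] : Fin 6 → Fin 6 → ℝ) j i) =
      a 1 * b 3 * c 5 - a 1 * b 5 * c 3 - a 3 * b 1 * c 5 + a 3 * b 5 * c 1 + a 5 * b 1 * c 3 - a 5 * b 3 * c 1 := by
  simp [Matrix.det_succ_column_zero, Fin.sum_univ_succ, Fin.succAbove, Pi.single_apply]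
  ring

theorem det_unit_2_5 (a b c : Fin 6 → ℝ) : Matrix.det (Matrix.of fun i j =>
    (![Pi.single 0 1, a, Pi.single 2 1, b, Pi.single 5 1, c] : Fin 6 → Fin 6 → ℝ) j i) =
      -a 1 * b 3 * c 4 + a 1 * b 4 * c 3 + a 3 * b 1 * c 4 - a 3 * b 4 * c 1 - a 4 * b 1 * c 3 + a 4 * b 3 * c 1 := by
  simp [Matrix.det_succ_column_zero, Fin.sum_univ_succ, Fin.succAbove, Pi.single_apply]
  ring

theorem det_unit_3_4 (a b c : Fin 6 → ℝ) : Matrix.det (Matrix.of fun i j =>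
    (![Pi.single 0 1, a, Pi.single 3 1, b, Pi.single 4 1, c] : Fin 6 → Fin 6 → ℝ) j i) =
      -a 1 * b 2 * c 5 + a 1 * b 5 * c 2 + a 2 * b 1 * c 5 - a 2 * b 5 * c 1 - a 5 * b 1 * c 2 + a 5 * b 2 * c 1 := by
  simp [Matrix.det_succ_column_zero, Fin.sum_univ_succ, Fin.succAbove, Pi.single_apply]
  ring

theorem det_unit_3_5 (a b c : Fin 6 → ℝ) : Matrix.det (Matrix.of fun i j =>
    (![Pi.single 0 1, a, Pi.single 3 1, b, Pi.single 5 1, c] : Fin 6 → Fin 6 → ℝ) j i) =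
      a 1 * b 2 * c 4 - a 1 * b 4 * c 2 - a 2 * b 1 * c 4 + a 2 * b 4 * c 1 + a 4 * b 1 * c 2 - a 4 * b 2 * c 1 := by
  simp [Matrix.det_succ_column_zero, Fin.sum_univ_succ, Fin.succAbove, Pi.single_apply]
  ring

theorem det_unit_4_5 (a b c : Fin 6 → ℝ) : Matrix.det (Matrix.of fun i j =>
    (![Pi.single 0 1, a, Pi.single 4 1, b, Pi.single 5 1, c] : Fin 6 → Fin 6 → ℝ) j i) =
      -a 1 * b 2 * c 3 + a 1 * b 3 * c 2 + a 2 * b 1 * c 3 - a 2 * b 3 * c 1 - a 3 * b 1 * c 2 + a 3 * b 2 * c 1 := by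
  simp [Matrix.det_succ_column_zero, Fin.sum_univ_succ, Fin.succAbove, Pi.single_apply]
  ring

/-- Each volume is, up to sign, the $3\times3$ minor with columns $S\ni0$ and rows the complement of
$S$, a sum over perfect matchings between the two. Each of the 15 matchings of six indices arises
from the 4 sets $S$ containing $0$ and one index of each pair, whence the factor 4. This fixes the
sign of the Pfaffian. -/
theorem sum_complexVolume (b : Fin 6 → Fin 6 → ℝ) :
    complexVolume (skewMatrix b) (Pi.single 0 1) (Pi.single 1 1) (Pi.single 2 1) +
    complexVolume (skewMatrix b) (Pi.single 0 1) (Pi.single 1 1) (Pi.single 3 1) +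
    complexVolume (skewMatrix b) (Pi.single 0 1) (Pi.single 1 1) (Pi.single 4 1) +
    complexVolume (skewMatrix b) (Pi.single 0 1) (Pi.single 1 1) (Pi.single 5 1) +
    complexVolume (skewMatrix b) (Pi.single 0 1) (Pi.single 2 1) (Pi.single 3 1) +
    complexVolume (skewMatrix b) (Pi.single 0 1) (Pi.single 2 1) (Pi.single 4 1) +
    complexVolume (skewMatrix b) (Pi.single 0 1) (Pi.single 2 1) (Pi.single 5 1) +
    complexVolume (skewMatrix b) (Pi.single 0 1) (Pi.single 3 1) (Pi.single 4 1) +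
    complexVolume (skewMatrix b) (Pi.single 0 1) (Pi.single 3 1) (Pi.single 5 1) +
    complexVolume (skewMatrix b) (Pi.single 0 1) (Pi.single 4 1) (Pi.single 5 1) =
      -4 * pfaffian b := by
  simp only [complexVolume, Matrix.mulVec_single_one, det_unit_1_2, det_unit_1_3, det_unit_1_4, det_unit_1_5, det_unit_2_3, det_unit_2_4, det_unit_2_5, det_unit_3_4, det_unit_3_5, det_unit_4_5]
  simp [skewMatrix, subPfaffian, pfaffian, Fin.sum_univ_succ]
  ring

theorem sum_skewMatrix_sq {b : Fin 6 → Fin 6 → ℝ} (hsq : skewMatrix b * skewMatrix b = -1) :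
    ∑ i, ∑ j, (skewMatrix b i j) ^ 2 = 6 := by
  have h : ∀ i, ∑ j, (skewMatrix b i j) ^ 2 = -(skewMatrix b * skewMatrix b) i i := by
    intro i
    rw [Matrix.mul_apply, ← Finset.sum_neg_distrib]
    refine Finset.sum_congr rfl fun j _ => ?_
    fin_cases i <;> fin_cases j <;> simp [skewMatrix] <;> ring
  simp [h, hsq]

/-- For a positively oriented orthogonal complex structure, the Hodge dual of `ω ∧ ω / 2` is `ω`. -/
theorem subPfaffian_eq {b : Fin 6 → Fin 6 → ℝ} (hsq : skewMatrix b * skewMatrix b = -1)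
    (hpos : ∀ u v w, 0 ≤ complexVolume (skewMatrix b) u v w) (i j : Fin 6) :
    subPfaffian b i j = -skewMatrix b i j := by
  -- As $B^{-1}=-B$, the sub-Pfaffian matrix, an adjugate of $B$, must be a multiple of $B$.
  have h1 : Matrix.of (subPfaffian b) = pfaffian b • skewMatrix b := by
    have := congrArg (skewMatrix b * ·) (skewMatrix_mul_subPfaffian b)
    simp only [← mul_assoc, hsq] at this
    refine neg_injective ?_
    simpa using this
  have h2 : ∀ i j, subPfaffian b i j = pfaffian b * skewMatrix b i j := fun i j =>
    congrFun (congrFun h1 i) j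
  have h3 := sum_skewMatrix_sq hsq
  have h4 := sum_subPfaffian_sq b
  simp only [h2, mul_pow, ← Finset.mul_sum, h3, hsq] at h4
  have h5 : ∑ i : Fin 6, ∑ j : Fin 6, ((-1 : Matrix (Fin 6) (Fin 6) ℝ) i j) ^ 2 = 6 := by
    simp [Matrix.one_apply]
  rw [h5] at h4
  have h6 : pfaffian b ≤ 0 := by
    have h7 := sum_complexVolume b
    have h8 : ∀ j k, 0 ≤ complexVolume (skewMatrix b) (Pi.single 0 1) (Pi.single j 1)
      (Pi.single k 1) := fun j k => hpos _ _ _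
    linarith [h8 1 2, h8 1 3, h8 1 4, h8 1 5, h8 2 3, h8 2 4, h8 2 5, h8 3 4, h8 3 5, h8 4 5]
  -- The norms give $6\,\mathrm{pf}^2=36/4-6/2=6$. The value is $-1$ because the entry $B_{ij}$ is
  -- $\omega(e_j,e_i)$, so $B$ is minus the coefficient matrix of $\omega$.
  have h9 : pfaffian b = -1 := by nlinarith
  rw [h2, h9, neg_one_mul]

end Pfaffian

/-! ### The identification of orthogonal complex structures on $\mathbb R^6$ with points of
$\mathbb{CP}^3$. -/

section Twistor

open Matrix (mulVec)

/-- The linear map `u u* ↦ |u|² J` from Hermitian `4 × 4` matrices to `6 × 6` skew-symmetric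
matrices, where `J` is the orthogonal complex structure of the point `[u]`. -/
def ofHermitian (q : Fin 4 → Fin 4 → ℂ) : Matrix (Fin 6) (Fin 6) ℂ :=
  !![0, -q 0 0 - q 1 1 + q 2 2 + q 3 3,
      Complex.I * q 3 0 + Complex.I * q 2 1 - Complex.I * q 1 2 - Complex.I * q 0 3,
      q 3 0 - q 2 1 - q 1 2 + q 0 3,
      -Complex.I * q 2 0 + Complex.I * q 3 1 + Complex.I * q 0 2 - Complex.I * q 1 3,
      -q 2 0 - q 3 1 - q 0 2 - q 1 3;
    q 0 0 + q 1 1 - q 2 2 - q 3 3, 0, q 3 0 + q 2 1 + q 1 2 + q 0 3,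
      -Complex.I * q 3 0 + Complex.I * q 2 1 - Complex.I * q 1 2 + Complex.I * q 0 3,
      -q 2 0 + q 3 1 - q 0 2 + q 1 3,
      Complex.I * q 2 0 + Complex.I * q 3 1 - Complex.I * q 0 2 - Complex.I * q 1 3;
    -Complex.I * q 3 0 - Complex.I * q 2 1 + Complex.I * q 1 2 + Complex.I * q 0 3,
      -q 3 0 - q 2 1 - q 1 2 - q 0 3, 0, -q 0 0 + q 1 1 - q 2 2 + q 3 3,
      Complex.I * q 1 0 - Complex.I * q 0 1 + Complex.I * q 3 2 - Complex.I * q 2 3,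
      q 1 0 + q 0 1 - q 3 2 - q 2 3;
    -q 3 0 + q 2 1 + q 1 2 - q 0 3,
      Complex.I * q 3 0 - Complex.I * q 2 1 + Complex.I * q 1 2 - Complex.I * q 0 3,
      q 0 0 - q 1 1 + q 2 2 - q 3 3, 0, q 1 0 + q 0 1 + q 3 2 + q 2 3,
      -Complex.I * q 1 0 + Complex.I * q 0 1 + Complex.I * q 3 2 - Complex.I * q 2 3;
    Complex.I * q 2 0 - Complex.I * q 3 1 - Complex.I * q 0 2 + Complex.I * q 1 3,
      q 2 0 - q 3 1 + q 0 2 - q 1 3,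
      -Complex.I * q 1 0 + Complex.I * q 0 1 - Complex.I * q 3 2 + Complex.I * q 2 3,
      -q 1 0 - q 0 1 - q 3 2 - q 2 3, 0, -q 0 0 + q 1 1 + q 2 2 - q 3 3;
    q 2 0 + q 3 1 + q 0 2 + q 1 3,
      -Complex.I * q 2 0 - Complex.I * q 3 1 + Complex.I * q 0 2 + Complex.I * q 1 3,
      -q 1 0 - q 0 1 + q 3 2 + q 2 3,
      Complex.I * q 1 0 - Complex.I * q 0 1 - Complex.I * q 3 2 + Complex.I * q 2 3,
      q 0 0 - q 1 1 - q 2 2 + q 3 3, 0]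

/-- Four times the projection of `ℂ⁴` onto the line `[u]` of an orthogonal complex structure. -/
def toHermitian (b : Fin 6 → Fin 6 → ℂ) : Matrix (Fin 4) (Fin 4) ℂ :=
  !![1 - b 0 1 - b 2 3 - b 4 5, Complex.I * b 2 4 - Complex.I * b 3 5 + b 2 5 + b 3 4,
      -Complex.I * b 0 4 + Complex.I * b 1 5 - b 0 5 - b 1 4,
      Complex.I * b 0 2 - Complex.I * b 1 3 + b 0 3 + b 1 2;
    -Complex.I * b 2 4 + Complex.I * b 3 5 + b 2 5 + b 3 4, 1 - b 0 1 + b 2 3 + b 4 5,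
      Complex.I * b 0 2 + Complex.I * b 1 3 - b 0 3 + b 1 2,
      Complex.I * b 0 4 + Complex.I * b 1 5 - b 0 5 + b 1 4;
    Complex.I * b 0 4 - Complex.I * b 1 5 - b 0 5 - b 1 4,
      -Complex.I * b 0 2 - Complex.I * b 1 3 - b 0 3 + b 1 2, 1 + b 0 1 - b 2 3 + b 4 5,
      Complex.I * b 2 4 + Complex.I * b 3 5 - b 2 5 + b 3 4;
    -Complex.I * b 0 2 + Complex.I * b 1 3 + b 0 3 + b 1 2,
      -Complex.I * b 0 4 - Complex.I * b 1 5 - b 0 5 + b 1 4,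
      -Complex.I * b 2 4 - Complex.I * b 3 5 - b 2 5 + b 3 4, 1 + b 0 1 + b 2 3 - b 4 5]

-- The map `ofHermitian` kills scalar matrices; fixing the trace to be 4 removes this ambiguity and
-- singles out the preimage `toHermitian`.
set_option maxHeartbeats 1000000 in
theorem ofHermitian_toHermitian (b : Fin 6 → Fin 6 → ℂ) :
    ofHermitian (toHermitian b) = (4 : ℂ) • skewMatrix b := by
  ext i j
  fin_cases i <;> fin_cases j <;> simp only [ofHermitian, toHermitian, skewMatrix,
    Fin.zero_eta, Fin.mk_one, Fin.reduceFinMk,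
    Matrix.of_apply, Matrix.smul_apply, smul_eq_mul, Matrix.cons_val', Matrix.cons_val] <;>
    ring_nf <;> simp only [Complex.I_sq] <;> ring

set_option maxHeartbeats 1000000 in
theorem ofHermitian_smul (c : ℂ) (q : Fin 4 → Fin 4 → ℂ) :
    ofHermitian (c • q) = c • ofHermitian q := by
  ext i j
  fin_cases i <;> fin_cases j <;> simp only [ofHermitian, Fin.zero_eta,
    Fin.mk_one, Fin.reduceFinMk, Matrix.of_apply, Matrix.smul_apply,
    smul_eq_mul, Matrix.cons_val', Matrix.cons_val, Pi.smul_apply] <;> ring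

theorem trace_toHermitian (b : Fin 6 → Fin 6 → ℂ) : (toHermitian b).trace = 4 := by
  simp [Matrix.trace, toHermitian, Fin.sum_univ_four]
  ring

theorem star_toHermitian (b : Fin 6 → Fin 6 → ℝ) (i j : Fin 4) :
    starRingEnd ℂ (toHermitian (fun i j => (b i j : ℂ)) i j) =
      toHermitian (fun i j => (b i j : ℂ)) j i := by
  fin_cases i <;> fin_cases j <;> simp [toHermitian] <;> ring

/-- This is the equation of four times a projection. Off the diagonal it is a combination of the
self-duality equations; on the diagonal the norm of $\omega$ enters as well. -/
theorem toHermitian_sq {b : Fin 6 → Fin 6 → ℂ} (h : ∀ i j, subPfaffian b i j + skewMatrix b i j = 0)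
    (ht : ∑ i, ∑ j, (skewMatrix b i j) ^ 2 = 6) :
    toHermitian b * toHermitian b = (4 : ℂ) • toHermitian b := by
  simp [Fin.sum_univ_six, skewMatrix] at ht

  have h' : ∀ i j, subPfaffian b i j + skewMatrix b i j = 0 := h
  have h01 := h 0 1
  have h02 := h 0 2
  have h03 := h 0 3
  have h04 := h 0 4
  have h05 := h 0 5
  have h12 := h 1 2
  have h13 := h 1 3
  have h14 := h 1 4
  have h15 := h 1 5
  have h23 := h 2 3
  have h24 := h 2 4
  have h25 := h 2 5
  have h34 := h 3 4
  have h35 := h 3 5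
  have h45 := h 4 5
  clear h'
  simp [subPfaffian, skewMatrix] at h01 h02 h03 h04 h05 h12 h13 h14 h15 h23 h24 h25 h34 h35 h45
  ext i j
  rw [Matrix.mul_apply, Fin.sum_univ_four]
  fin_cases i <;> fin_cases j <;> simp [toHermitian]
  · linear_combination 2 * h01 + 2 * h23 + 2 * h45 + ht / 2  +
      (-b 0 2 * b 0 2 + 2 * b 0 2 * b 1 3 - b 0 4 * b 0 4 + 2 * b 0 4 * b 1 5 - b 1 3 * b 1 3 - b 1 5 * b 1 5 - b 2 4 * b 2 4 + 2 * b 2 4 * b 3 5 - b 3 5 * b 3 5) * Complex.I_sq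
  · linear_combination -2 * h25 - 2 * h34 - 2 * Complex.I * h24 + 2 * Complex.I * h35  +
      (-2 * b 0 2 * b 1 5 + 2 * b 0 4 * b 1 3) * Complex.I_sq
  · linear_combination 2 * h05 + 2 * h14 + 2 * Complex.I * h04 - 2 * Complex.I * h15  +
      (-2 * b 0 2 * b 3 5 + 2 * b 1 3 * b 2 4) * Complex.I_sq
  · linear_combination -2 * h03 - 2 * h12 - 2 * Complex.I * h02 + 2 * Complex.I * h13  +
      (-2 * b 0 4 * b 3 5 + 2 * b 1 5 * b 2 4) * Complex.I_sq
  · linear_combination -2 * h25 - 2 * h34 + 2 * Complex.I * h24 - 2 * Complex.I * h35  +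
      (-2 * b 0 2 * b 1 5 + 2 * b 0 4 * b 1 3) * Complex.I_sq
  · linear_combination 2 * h01 - 2 * h23 - 2 * h45 + ht / 2  +
      (-b 0 2 * b 0 2 - 2 * b 0 2 * b 1 3 - b 0 4 * b 0 4 - 2 * b 0 4 * b 1 5 - b 1 3 * b 1 3 - b 1 5 * b 1 5 - b 2 4 * b 2 4 + 2 * b 2 4 * b 3 5 - b 3 5 * b 3 5) * Complex.I_sq
  · linear_combination 2 * h03 - 2 * h12 - 2 * Complex.I * h02 - 2 * Complex.I * h13  +
      (-2 * b 0 4 * b 3 5 - 2 * b 1 5 * b 2 4) * Complex.I_sq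
  · linear_combination 2 * h05 - 2 * h14 - 2 * Complex.I * h04 - 2 * Complex.I * h15  +
      (2 * b 0 2 * b 3 5 + 2 * b 1 3 * b 2 4) * Complex.I_sq
  · linear_combination 2 * h05 + 2 * h14 - 2 * Complex.I * h04 + 2 * Complex.I * h15  +
      (-2 * b 0 2 * b 3 5 + 2 * b 1 3 * b 2 4) * Complex.I_sq
  · linear_combination 2 * h03 - 2 * h12 + 2 * Complex.I * h02 + 2 * Complex.I * h13  +
      (-2 * b 0 4 * b 3 5 - 2 * b 1 5 * b 2 4) * Complex.I_sq
  · linear_combination -2 * h01 + 2 * h23 - 2 * h45 + ht / 2  +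
      (-b 0 2 * b 0 2 - 2 * b 0 2 * b 1 3 - b 0 4 * b 0 4 + 2 * b 0 4 * b 1 5 - b 1 3 * b 1 3 - b 1 5 * b 1 5 - b 2 4 * b 2 4 - 2 * b 2 4 * b 3 5 - b 3 5 * b 3 5) * Complex.I_sq
  · linear_combination 2 * h25 - 2 * h34 - 2 * Complex.I * h24 - 2 * Complex.I * h35  +
      (-2 * b 0 2 * b 1 5 - 2 * b 0 4 * b 1 3) * Complex.I_sq
  · linear_combination -2 * h03 - 2 * h12 + 2 * Complex.I * h02 - 2 * Complex.I * h13  +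
      (-2 * b 0 4 * b 3 5 + 2 * b 1 5 * b 2 4) * Complex.I_sq
  · linear_combination 2 * h05 - 2 * h14 + 2 * Complex.I * h04 + 2 * Complex.I * h15  +
      (2 * b 0 2 * b 3 5 + 2 * b 1 3 * b 2 4) * Complex.I_sq
  · linear_combination 2 * h25 - 2 * h34 + 2 * Complex.I * h24 + 2 * Complex.I * h35  +
      (-2 * b 0 2 * b 1 5 - 2 * b 0 4 * b 1 3) * Complex.I_sq
  · linear_combination -2 * h01 - 2 * h23 + 2 * h45 + ht / 2  +
      (-b 0 2 * b 0 2 + 2 * b 0 2 * b 1 3 - b 0 4 * b 0 4 - 2 * b 0 4 * b 1 5 - b 1 3 * b 1 3 - b 1 5 * b 1 5 - b 2 4 * b 2 4 - 2 * b 2 4 * b 3 5 - b 3 5 * b 3 5) * Complex.I_sq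

/-- The square of the norm of `u`. -/
def normSq4 (u : Fin 4 → ℂ) : ℂ := ∑ i, u i * starRingEnd ℂ (u i)

theorem normSq4_eq (u : Fin 4 → ℂ) : normSq4 u = ((∑ i, Complex.normSq (u i) : ℝ) : ℂ) := by
  simp [normSq4, Complex.mul_conj]

theorem normSq4_ne_zero {u : Fin 4 → ℂ} (hu : u ≠ 0) : normSq4 u ≠ 0 := by
  rw [normSq4_eq, Complex.ofReal_ne_zero]
  intro h
  apply hu
  ext i
  exact Complex.normSq_eq_zero.1
    ((Finset.sum_eq_zero_iff_of_nonneg fun i _ => Complex.normSq_nonneg (u i)).1 h i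
      (Finset.mem_univ i))

/-- The Hermitian matrix `u u*`. -/
def outer (u : Fin 4 → ℂ) (i j : Fin 4) : ℂ := u i * starRingEnd ℂ (u j)

/-- A Hermitian matrix `m` with `m² = 4m` and trace `4` has rank one. -/
theorem exists_outer {m : Matrix (Fin 4) (Fin 4) ℂ} (hm : ∀ i j, starRingEnd ℂ (m i j) = m j i)
    (hsq : m * m = (4 : ℂ) • m) (ht : m.trace = 4) :
    ∃ u : Fin 4 → ℂ, u ≠ 0 ∧ ∀ i j, normSq4 u * m i j = 4 * outer u i j := by
  obtain ⟨k, hk⟩ : ∃ k, m k k ≠ 0 := by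
    by_contra! h
    simp [Matrix.trace, h] at ht
  have hs : ∀ i j, ∑ l, m i l * m l j = 4 * m i j := fun i j => by
    simpa [Matrix.mul_apply] using congrFun (congrFun hsq i) j
  have hn : normSq4 (fun i => m i k) = 4 * m k k := by
    simp only [normSq4, hm, ← hs]
    exact Finset.sum_congr rfl fun i _ => mul_comm _ _
  -- A nonzero column of a rank-one Hermitian matrix spans its image, so column $k$ serves as $u$.
  refine ⟨fun i => m i k, fun h => hk (congrFun h k), ?_⟩
  -- The vanishing of $d$ says that the matrix is determined by its $k$-th row and column, that is,
  -- has rank one. Since $d$ is Hermitian, it suffices that $\operatorname{tr}d^2=0$, and this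
  -- expands to $(16-16-16+16)m_{kk}^2$.
  set d : Fin 4 → Fin 4 → ℂ := fun i j => m k k * m i j - m i k * m k j with hd
  have hdc : ∀ i j, starRingEnd ℂ (d i j) = d j i := by
    intro i j
    simp only [hd, map_sub, map_mul, hm]
    ring
  have htr : ∑ l, m l l = 4 := ht
  have hcube : ∑ i, ∑ j, m i j * m j k * m k i = 16 * m k k := by
    have : ∀ i, ∑ j, m i j * m j k * m k i = 4 * (m k i * m i k) := fun i => by
      rw [← Finset.sum_mul, hs]; ring
    simp only [this, ← Finset.mul_sum, hs]
    ring
  have hcube' : ∑ i, ∑ j, m i k * m k j * m j i = 16 * m k k := by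
    rw [Finset.sum_comm, ← hcube]
    exact Finset.sum_congr rfl fun _ _ => Finset.sum_congr rfl fun _ _ => by ring
  have hsum : ∑ i, ∑ j, d i j * d j i = 0 := by
    have h1 : ∀ i j, d i j * d j i = m k k ^ 2 * (m i j * m j i) -
        m k k * (m i j * m j k * m k i) - m k k * (m i k * m k j * m j i) +
        (m k i * m i k) * (m k j * m j k) := fun i j => by
      simp only [hd]; ring
    have h2 : ∑ i, ∑ j, d i j * d j i = m k k ^ 2 * (∑ i, ∑ j, m i j * m j i) -
        m k k * (∑ i, ∑ j, m i j * m j k * m k i) - m k k * (∑ i, ∑ j, m i k * m k j * m j i) +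
        (∑ i, m k i * m i k) * ∑ j, m k j * m j k := by
      simp only [h1, Finset.sum_add_distrib, Finset.sum_sub_distrib, Finset.mul_sum,
        Finset.sum_mul]
      congr 1
      exact Finset.sum_comm
    rw [h2, hcube, hcube']
    simp only [hs, ← Finset.mul_sum, htr]
    ring
  have hzero : ∀ i j, d i j = 0 := by
    have h1 : ∑ i, ∑ j, Complex.normSq (d i j) = 0 := by
      have : ((∑ i, ∑ j, Complex.normSq (d i j) : ℝ) : ℂ) = 0 := by
        rw [← hsum]
        push_cast
        exact Finset.sum_congr rfl fun i _ => Finset.sum_congr rfl fun j _ => by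
          rw [← hdc i j, Complex.mul_conj]
      exact_mod_cast this
    intro i j
    have h2 := (Finset.sum_eq_zero_iff_of_nonneg fun i _ =>
      Finset.sum_nonneg fun j _ => Complex.normSq_nonneg (d i j)).1 h1 i (Finset.mem_univ i)
    exact Complex.normSq_eq_zero.1 ((Finset.sum_eq_zero_iff_of_nonneg fun j _ =>
      Complex.normSq_nonneg (d i j)).1 h2 j (Finset.mem_univ j))
  intro i j
  have := hzero i j
  simp only [hd] at this
  simp only [hn, outer, hm]
  linear_combination 4 * this

/-- The matrix `B` is the orthogonal complex structure of the point `[u]`. -/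
def IsTwistor (B : Matrix (Fin 6) (Fin 6) ℝ) (u : Fin 4 → ℂ) : Prop :=
  ∀ i j, normSq4 u * (B i j : ℂ) = ofHermitian (outer u) i j

theorem exists_isTwistor_skewMatrix {b : Fin 6 → Fin 6 → ℝ}
    (hsq : skewMatrix b * skewMatrix b = -1)
    (hpos : ∀ u v w, 0 ≤ complexVolume (skewMatrix b) u v w) :
    ∃ u : Fin 4 → ℂ, u ≠ 0 ∧ IsTwistor (skewMatrix b) u := by
  have hcast : ∀ i j, skewMatrix (fun i j => (b i j : ℂ)) i j = ((skewMatrix b i j : ℝ) : ℂ) := by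
    intro i j
    fin_cases i <;> fin_cases j <;>
      first | exact Complex.ofReal_zero.symm | exact (Complex.ofReal_neg _).symm | rfl
  have hcast' : ∀ i j, subPfaffian (fun i j => (b i j : ℂ)) i j =
      ((subPfaffian b i j : ℝ) : ℂ) := by
    intro i j
    fin_cases i <;> fin_cases j <;> simp only [subPfaffian, Fin.zero_eta,
      Fin.mk_one, Fin.reduceFinMk, Matrix.cons_val', Matrix.cons_val] <;>
      push_cast <;> rfl
  obtain ⟨u, hu, h⟩ := exists_outer (star_toHermitian b)
    (toHermitian_sq (fun i j => by rw [hcast, hcast', subPfaffian_eq hsq hpos]; simp) (by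
      simp only [hcast]
      exact_mod_cast sum_skewMatrix_sq hsq))
    (trace_toHermitian _)
  refine ⟨u, hu, fun i j => ?_⟩
  obtain ⟨m, hm⟩ : ∃ m : Fin 4 → Fin 4 → ℂ, m = toHermitian (fun i j => (b i j : ℂ)) := ⟨_, rfl⟩
  have h3 : normSq4 u • m = (4 : ℂ) • outer u :=
    funext fun i => funext fun j => by rw [hm]; exact h i j
  have h4 := congrArg ofHermitian h3
  rw [ofHermitian_smul, ofHermitian_smul, hm, ofHermitian_toHermitian] at h4
  have h5 := congrFun (congrFun h4 i) j
  simp only [Matrix.smul_apply, smul_eq_mul, hcast] at h5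
  linear_combination (1 / 4) * h5

/-- Every positively oriented orthogonal complex structure on `ℝ⁶` is a point of `ℂP³`. -/
theorem exists_isTwistor {B : Matrix (Fin 6) (Fin 6) ℝ} (hskew : ∀ i j, B j i = -B i j)
    (hsq : B * B = -1) (hpos : ∀ u v w, 0 ≤ complexVolume B u v w) :
    ∃ u : Fin 4 → ℂ, u ≠ 0 ∧ IsTwistor B u := by
  have hB := eq_skewMatrix hskew
  rw [hB] at hsq hpos ⊢
  exact exists_isTwistor_skewMatrix hsq hpos

/-- The contraction of `ū` with an element of `⋀²ℂ⁴`. -/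
def contraction (u : Fin 4 → ℂ) (x : Fin 6 → ℂ) : Fin 4 → ℂ :=
  let s := fun i => starRingEnd ℂ (u i)
  let p01 := x 0 - Complex.I * x 1
  let p23 := x 0 + Complex.I * x 1
  let p02 := x 2 - Complex.I * x 3
  let p31 := x 2 + Complex.I * x 3
  let p03 := x 4 - Complex.I * x 5
  let p12 := x 4 + Complex.I * x 5
  ![-(s 1 * p01) - s 2 * p02 - s 3 * p03, s 0 * p01 - s 2 * p12 + s 3 * p31,
    s 0 * p02 + s 1 * p12 - s 3 * p23, s 0 * p03 - s 1 * p31 + s 2 * p23]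

/-- Contracting with $\bar u$ and wedging with $u$ is $|u|^2$ times the projection onto $V_u$. With
the next lemma this identifies $V_u$ with the $-i$-eigenspace of $J$ on vectors. -/
theorem klein_contraction (u : Fin 4 → ℂ) (x : Fin 6 → ℂ) (i : Fin 6) :
    2 * klein u (contraction u x) i =
      normSq4 u * x i + Complex.I * (ofHermitian (outer u)).mulVec x i := by
  rw [mulVec, dotProduct, Fin.sum_univ_six]
  fin_cases i <;> simp [klein, contraction, normSq4, outer, ofHermitian, Fin.sum_univ_four] <;>
    ring_nf <;> simp only [Complex.I_sq] <;> ring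

theorem ofHermitian_mulVec_klein (u v : Fin 4 → ℂ) (i : Fin 6) :
    (ofHermitian (outer u)).mulVec (klein u v) i = -Complex.I * (normSq4 u * klein u v i) := by
  rw [mulVec, dotProduct, Fin.sum_univ_six]
  fin_cases i <;> simp [klein, normSq4, outer, ofHermitian, Fin.sum_univ_four] <;>
    ring_nf <;> simp only [Complex.I_sq] <;> ring

end Twistor

/-! ### The polynomial conditions on $u$ imposed by the Koszul form. -/

section Conditions

/-- The trilinear form `g([x, y], z)` on the Lie algebra. -/
def structureForm {R : Type*} [CommRing R] (x y z : Fin 6 → R) : R :=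
  -(x 0 * y 2 - x 2 * y 0 + (x 3 * y 1 - x 1 * y 3)) * z 4 -
    (x 0 * y 3 - x 3 * y 0 + (x 1 * y 2 - x 2 * y 1)) * z 5

/-- The trilinear form `2 g(∇_x y, z)` on the Lie algebra. -/
def koszul {R : Type*} [CommRing R] (x y z : Fin 6 → R) : R :=
  structureForm x y z - structureForm y z x + structureForm z x y

theorem christoffel_dotProduct (x y z : Fin 6 → ℝ) :
    christoffel x y ⬝ᵥ z = koszul x y z / 2 := by
  simp [christoffel, bracket, dotProduct, Fin.sum_univ_succ, Pi.single_apply, koszul,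
    structureForm]
  ring

/-- The complex vector with real part `x` and imaginary part `y`. -/
def toComplexVec (x y : Fin 6 → ℝ) (i : Fin 6) : ℂ := x i + Complex.I * y i

theorem structureForm_toComplexVec (x x' y y' z z' : Fin 6 → ℝ) :
    structureForm (toComplexVec x x') (toComplexVec y y') (toComplexVec z z') =
      ((structureForm x y z - structureForm x y' z' - structureForm x' y z' -
        structureForm x' y' z : ℝ) : ℂ) +
      Complex.I * ((structureForm x y z' + structureForm x y' z + structureForm x' y z -
        structureForm x' y' z' : ℝ) : ℂ) := by
  apply Complex.ext <;> simp [structureForm, toComplexVec] <;> ring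

theorem koszul_toComplexVec (x x' y y' z z' : Fin 6 → ℝ) :
    koszul (toComplexVec x x') (toComplexVec y y') (toComplexVec z z') =
      ((koszul x y z - koszul x y' z' - koszul x' y z' - koszul x' y' z : ℝ) : ℂ) +
      Complex.I * ((koszul x y z' + koszul x y' z + koszul x' y z - koszul x' y' z' : ℝ) : ℂ) := by
  simp only [koszul, structureForm_toComplexVec]
  push_cast
  ring

/-- The complex vector with the given coordinates with respect to `v⁰¹, v⁰², v⁰³, v²³, v³¹, v¹²`. -/
def ofPlucker (p : Fin 6 → ℂ) : Fin 6 → ℂ :=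
  ![(p 0 + p 3) / 2, Complex.I * (p 0 - p 3) / 2, (p 1 + p 4) / 2, Complex.I * (p 1 - p 4) / 2,
    (p 2 + p 5) / 2, Complex.I * (p 2 - p 5) / 2]

/-- The complex Heisenberg structure leaves only two monomials in Plücker coordinates, which makes
the conditions below short. -/
theorem structureForm_ofPlucker (p q r : Fin 6 → ℂ) :
    structureForm (ofPlucker p) (ofPlucker q) (ofPlucker r) =
      -((p 3 * q 4 - p 4 * q 3) * r 2 + (p 0 * q 1 - p 1 * q 0) * r 5) / 2 := by
  simp only [structureForm, ofPlucker, Matrix.cons_val]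
  ring_nf
  simp only [Complex.I_sq]
  ring

/-- The Plücker coordinates of `u ∧ v`. -/
def plucker (u v : Fin 4 → ℂ) : Fin 6 → ℂ :=
  ![u 0 * v 1 - u 1 * v 0, u 0 * v 2 - u 2 * v 0, u 0 * v 3 - u 3 * v 0,
    u 2 * v 3 - u 3 * v 2, u 3 * v 1 - u 1 * v 3, u 1 * v 2 - u 2 * v 1]

theorem klein_eq (u v : Fin 4 → ℂ) : klein u v = ofPlucker (plucker u v) := rfl

/-- The complex conjugate of `u ∧ v`. -/
def kleinConj (u v : Fin 4 → ℂ) (i : Fin 6) : ℂ := starRingEnd ℂ (klein u v i)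

theorem kleinConj_eq (u v : Fin 4 → ℂ) : kleinConj u v =
    -- Conjugation exchanges $v^{01},v^{02},v^{03}$ with $v^{23},v^{31},v^{12}$; this is the shift
    -- by 3 in `Fin 6`.
    ofPlucker (fun i => starRingEnd ℂ (plucker u v (i + 3))) := by
  ext i
  fin_cases i <;> simp [kleinConj, klein_eq, ofPlucker, plucker, Complex.conj_ofNat] <;>
    ring

/-- The Hermitian product of `u ∧ a` and `u ∧ b`. -/
def kleinInner (u a b : Fin 4 → ℂ) : ℂ := ∑ i, kleinConj u a i * klein u b i

theorem kleinInner_eq (u a b : Fin 4 → ℂ) : kleinInner u a b =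
    (normSq4 u * (∑ i, starRingEnd ℂ (a i) * b i) -
      (∑ i, starRingEnd ℂ (a i) * u i) * ∑ i, starRingEnd ℂ (u i) * b i) / 2 := by
  rw [kleinInner, kleinConj_eq, klein_eq]
  simp [Fin.sum_univ_succ, ofPlucker, plucker, normSq4]
  ring_nf
  simp only [Complex.I_sq]
  ring

theorem koszul_klein_cyclic {u : Fin 4 → ℂ} (hu : u 3 = 0) (a b c : Fin 4 → ℂ) :
    koszul (klein u a) (klein u b) (klein u c) + koszul (klein u b) (klein u c) (klein u a) +
      koszul (klein u c) (klein u a) (klein u b) = 0 := by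
  simp only [koszul, klein_eq, structureForm_ofPlucker]
  simp [plucker, hu]
  ring

/-- The cyclic sum is alternating in $a,b,c$ modulo $u$, so one triple of basis vectors suffices;
the one omitting $v^3$ gives $u_3^3/2$. -/
theorem eq_zero_of_koszul_cyclic {u : Fin 4 → ℂ}
    (h : ∀ a b c, koszul (klein u a) (klein u b) (klein u c) +
      koszul (klein u b) (klein u c) (klein u a) +
      koszul (klein u c) (klein u a) (klein u b) = 0) : u 3 = 0 := by
  have h1 := h (Pi.single 1 1) (Pi.single 2 1) (Pi.single 0 1)
  simp only [koszul, klein_eq, structureForm_ofPlucker] at h1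
  simp [plucker] at h1
  have h2 : u 3 ^ 3 = 0 := by linear_combination 2 * h1
  simpa using h2

theorem koszul_klein_eq_zero {u : Fin 4 → ℂ}
    (hu : (u 0 = 0 ∧ u 3 = 0) ∨ (u 1 = 0 ∧ u 2 = 0 ∧ u 3 = 0)) (a b c : Fin 4 → ℂ) :
    koszul (klein u a) (klein u b) (klein u c) = 0 := by
  simp only [koszul, klein_eq, structureForm_ofPlucker]
  rcases hu with ⟨h0, h3⟩ | ⟨h1, h2, h3⟩
  · simp [plucker, h0, h3]
    ring
  · simp [plucker, h1, h2, h3]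

/-- Skewness alone already forces the points where the whole form vanishes on $V_u$: this is why the
classes with $W_1$ allowed besides $W_3$, $W_4$ are no larger than the Hermitian one. -/
theorem eq_zero_of_koszul_swap {u : Fin 4 → ℂ}
    (h : ∀ a b c, koszul (klein u b) (klein u a) (klein u c) =
      -koszul (klein u a) (klein u b) (klein u c)) :
    (u 0 = 0 ∧ u 3 = 0) ∨ (u 1 = 0 ∧ u 2 = 0 ∧ u 3 = 0) := by
  simp only [koszul, klein_eq, structureForm_ofPlucker] at h
  have h1 := h (Pi.single 1 1) (Pi.single 1 1) (Pi.single 2 1)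
  have h2 := h (Pi.single 2 1) (Pi.single 2 1) (Pi.single 1 1)
  have h3 := h (Pi.single 1 1) (Pi.single 3 1) (Pi.single 2 1)
  have h4 := h (Pi.single 0 1) (Pi.single 1 1) (Pi.single 2 1)
  simp [plucker] at h1 h2 h3 h4
  have e1 : u 0 ^ 2 * u 2 = 0 := by linear_combination -(1 / 2) * h1
  have e2 : u 0 ^ 2 * u 1 = 0 := by linear_combination -(1 / 2) * h2
  have e3 : u 3 ^ 2 * u 0 = 0 := by linear_combination -(1 / 2) * h3
  have e4 : u 3 ^ 3 = u 0 * u 1 * u 2 := by linear_combination -h4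
  by_cases h0 : u 0 = 0
  · left
    simpa [h0] using e4
  · right
    simpa [h0, and_comm, and_assoc, and_left_comm] using And.intro e1 (And.intro e2 e3)

/-- A vector whose conjugate is orthogonal to `u`, `b` and `c`. -/
def crossProduct4 (u b c : Fin 4 → ℂ) (i : Fin 4) : ℂ := starRingEnd ℂ
  ((![u 1 * (b 2 * c 3 - b 3 * c 2) - u 2 * (b 1 * c 3 - b 3 * c 1) + u 3 * (b 1 * c 2 - b 2 * c 1),
    -(u 0 * (b 2 * c 3 - b 3 * c 2) - u 2 * (b 0 * c 3 - b 3 * c 0) + u 3 * (b 0 * c 2 - b 2 * c 0)),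
    u 0 * (b 1 * c 3 - b 3 * c 1) - u 1 * (b 0 * c 3 - b 3 * c 0) + u 3 * (b 0 * c 1 - b 1 * c 0),
    -(u 0 * (b 1 * c 2 - b 2 * c 1) - u 1 * (b 0 * c 2 - b 2 * c 0) + u 2 * (b 0 * c 1 - b 1 * c 0))] :
    Fin 4 → ℂ) i)

theorem kleinInner_crossProduct4_left (u b c : Fin 4 → ℂ) :
    kleinInner u (crossProduct4 u b c) b = 0 := by
  rw [kleinInner_eq]
  simp only [crossProduct4, Complex.conj_conj, Fin.sum_univ_four, Matrix.cons_val]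
  ring

theorem kleinInner_crossProduct4_right (u b c : Fin 4 → ℂ) :
    kleinInner u (crossProduct4 u b c) c = 0 := by
  rw [kleinInner_eq]
  simp only [crossProduct4, Complex.conj_conj, Fin.sum_univ_four, Matrix.cons_val]
  ring

/-- The $W_4$ part drops out when the conjugated vector is orthogonal to the other two, so the
hypothesis is what survives of the absence of $W_3$. For given $b,c$ the vector `crossProduct4`
supplies such an $a$. -/
theorem point_of_koszul_conj {u : Fin 4 → ℂ} (hu : u ≠ 0)
    (h : ∀ a b c, kleinInner u a b = 0 → kleinInner u a c = 0 →
      koszul (kleinConj u a) (klein u b) (klein u c) = 0) :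
    (u 0 = 0 ∧ u 1 = 0 ∧ u 2 = 0) ∨
      (u 3 = 0 ∧ Complex.normSq (u 0) = Complex.normSq (u 1) + Complex.normSq (u 2)) := by
  have h' : ∀ b c, koszul (kleinConj u (crossProduct4 u b c)) (klein u b) (klein u c) = 0 :=
    fun b c => h _ _ _ (kleinInner_crossProduct4_left u b c) (kleinInner_crossProduct4_right u b c)
  simp only [koszul, kleinConj_eq, klein_eq, structureForm_ofPlucker] at h'
  have h1 := h' (Pi.single 0 1) (Pi.single 1 1)
  have h2 := h' (Pi.single 0 1) (Pi.single 2 1)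
  have h3 := h' (Pi.single 1 1) (Pi.single 2 1)
  -- The expression in $b,c$ is symmetric, so after subtracting values at basis pairs these two give
  -- its polarized cross terms. They are needed only when $u_3\ne0$.
  have h4 := h' (Pi.single 1 1) (Pi.single 0 1 + Pi.single 2 1)
  have h5 := h' (Pi.single 2 1) (Pi.single 0 1 + Pi.single 1 1)
  simp [plucker, crossProduct4] at h1 h2 h3 h4 h5
  set n := fun i => Complex.normSq (u i) with hn
  have hnn : ∀ i, 0 ≤ n i := fun i => Complex.normSq_nonneg _
  have hc : ∀ i, u i * starRingEnd ℂ (u i) = (n i : ℂ) := fun i => Complex.mul_conj _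
  have hpos : ∀ i, u i ≠ 0 → 0 < n i := fun i hi => Complex.normSq_pos.2 hi
  have hz : ∀ i (r : ℝ), u i ^ 2 * (r : ℂ) = 0 → u i ≠ 0 → r = 0 := fun i r hr hi => by
    simpa [hi] using hr
  have f1 := hz 2 (-n 0 + n 1 + n 2 + n 3) (by
    push_cast
    simp only [← hc]
    linear_combination 2 * h1)
  have f2 := hz 1 (-n 0 + n 1 + n 2 + n 3) (by
    push_cast
    simp only [← hc]
    linear_combination 2 * h2)
  have f3 := hz 0 (-n 0 + n 1 + n 2 - n 3) (by
    push_cast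
    simp only [← hc]
    linear_combination 2 * h3)
  change _ ∨ (_ ∧ n 0 = n 1 + n 2)
  by_cases hu3 : u 3 = 0
  · right
    refine ⟨hu3, ?_⟩
    have hn3 : n 3 = 0 := by simp [hn, hu3]
    by_contra hne
    apply hu
    have g0 : u 0 = 0 := by
      by_contra h0
      exact hne (by linarith [f3 h0])
    have g1 : u 1 = 0 := by
      by_contra h0
      exact hne (by linarith [f2 h0])
    have g2 : u 2 = 0 := by
      by_contra h0
      exact hne (by linarith [f1 h0])
    ext i
    fin_cases i
    exacts [g0, g1, g2, hu3]
  · left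
    have g0 : u 0 = 0 := by
      -- If $u_0\neq0$, then $|u_0|^2=|u_1|^2+|u_2|^2-|u_3|^2$. A nonzero $u_1$ or $u_2$ would give
      -- the same with $+|u_3|^2$, and $u_1=u_2=0$ would make the right side negative.
      by_contra h0
      have e0 := f3 h0
      by_cases k1 : u 1 = 0
      · by_cases k2 : u 2 = 0
        · have n1 : n 1 = 0 := by simp [hn, k1]
          have n2 : n 2 = 0 := by simp [hn, k2]
          linarith [hpos 0 h0, hnn 3]
        · linarith [f1 k2, hpos 3 hu3]
      · linarith [f2 k1, hpos 3 hu3]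
    simp only [g0] at h1 h2 h3 h4 h5
    have g1 : u 3 ^ 3 * starRingEnd ℂ (u 1) = 0 := by
      linear_combination -(h4 - h1 - h3)
    have g2 : u 3 ^ 3 * starRingEnd ℂ (u 2) = 0 := by
      linear_combination (h5 - h2 - h3)
    simp [hu3] at g1 g2
    exact ⟨g0, g1, g2⟩

theorem koszul_conj_eq_zero_vertex {u : Fin 4 → ℂ} (hu : u 0 = 0 ∧ u 1 = 0 ∧ u 2 = 0)
    (a b c : Fin 4 → ℂ) : koszul (kleinConj u a) (klein u b) (klein u c) = 0 := by
  simp only [koszul, kleinConj_eq, klein_eq, structureForm_ofPlucker]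
  simp [plucker, hu]
  try ring

theorem koszul_conj_eq_zero_sphere {u : Fin 4 → ℂ} (hu : u 3 = 0)
    (hu' : Complex.normSq (u 0) = Complex.normSq (u 1) + Complex.normSq (u 2))
    (a b c : Fin 4 → ℂ) : koszul (kleinConj u a) (klein u b) (klein u c) = 0 := by
  have h0 : u 0 * starRingEnd ℂ (u 0) =
      u 1 * starRingEnd ℂ (u 1) + u 2 * starRingEnd ℂ (u 2) := by
    simp only [Complex.mul_conj, hu']
    push_cast
    ring
  simp only [koszul, kleinConj_eq, klein_eq, structureForm_ofPlucker]
  simp [plucker, hu]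
  -- For $u_3=0$ the form factors as $\tfrac12\bar a_3$ times the $3\times3$ determinant of the
  -- first three coordinates of $u,b,c$, times $|u_0|^2-|u_1|^2-|u_2|^2$.
  linear_combination (starRingEnd ℂ (a 3) * (u 0 * (b 1 * c 2 - b 2 * c 1) -
    u 1 * (b 0 * c 2 - b 2 * c 0) + u 2 * (b 0 * c 1 - b 1 * c 0)) / 2) * h0

end Conditions

/-! ### Matrices of invariant structures and the coordinates of vertices, edges and faces. -/

section Points

/-- `B` is the matrix of `J` in the invariant frame. -/
def HasMatrix (J : EndField) (B : Matrix (Fin 6) (Fin 6) ℝ) : Prop :=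
  ∀ (m : IwasawaManifold) (x : T m), coframe m (J m x) = B.mulVec (coframe m x)

/-- `B` is an orthogonal complex structure on `ℝ⁶`. -/
structure IsComplexMatrix (B : Matrix (Fin 6) (Fin 6) ℝ) : Prop where
  sq : B * B = -1
  skew : ∀ i j, B j i = -B i j

theorem exists_hasMatrix {J : EndField} (hJ : J ∈ Z) :
    ∃ B, HasMatrix J B ∧ IsComplexMatrix B ∧ ∀ u v w, 0 ≤ complexVolume B u v w := by
  obtain ⟨⟨a, ha⟩, h⟩ := hJ
  -- The given coefficients describe the action on 1-forms, so vectors transform by the transpose.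
  have hB : HasMatrix J a.transpose := by
    intro m x
    ext j
    rw [ha]
    rfl
  set B := a.transpose
  refine ⟨B, hB, ⟨?_, ?_⟩, ?_⟩
  · refine Matrix.ext_of_mulVec_single fun j => ?_
    have h1 := congrArg (coframe (quot 0)) (h.sq (quot 0) (frame (Pi.single j 1) (quot 0)))
    rw [hB, hB, map_neg, coframe_frame] at h1
    rw [← Matrix.mulVec_mulVec, h1, Matrix.neg_mulVec, Matrix.one_mulVec]
  · intro i j
    have h1 := h.orthogonal (quot 0) (frame (Pi.single i 1) (quot 0))
      (J (quot 0) (frame (Pi.single j 1) (quot 0)))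
    rw [h.sq] at h1
    simp only [metric, map_neg, hB _ _, coframe_frame] at h1
    simp [Pi.single_apply] at h1
    linarith
  · intro u v w
    have h1 := h.positive (quot 0) (frame u (quot 0)) (frame v (quot 0)) (frame w (quot 0))
    have h2 : complexVolume B u v w = volume (quot 0) ![frame u (quot 0),
        J (quot 0) (frame u (quot 0)), frame v (quot 0), J (quot 0) (frame v (quot 0)),
        frame w (quot 0), J (quot 0) (frame w (quot 0))] := by
      rw [complexVolume, volume]
      congr 2
      ext i j
      fin_cases j
      · exact congrFun (coframe_frame u _).symm i
      · exact congrFun ((hB _ _).trans (by rw [coframe_frame]; rfl)).symm i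
      · exact congrFun (coframe_frame v _).symm i
      · exact congrFun ((hB _ _).trans (by rw [coframe_frame]; rfl)).symm i
      · exact congrFun (coframe_frame w _).symm i
      · exact congrFun ((hB _ _).trans (by rw [coframe_frame]; rfl)).symm i
    rwa [h2]

variable {J : EndField} {B : Matrix (Fin 6) (Fin 6) ℝ} {u : Fin 4 → ℂ}

theorem IsComplexMatrix.mulVec_mulVec (h : IsComplexMatrix B) (x : Fin 6 → ℝ) :
    B.mulVec (B.mulVec x) = -x := by
  rw [Matrix.mulVec_mulVec, h.sq, Matrix.neg_mulVec, Matrix.one_mulVec]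

theorem IsComplexMatrix.dotProduct_mulVec (h : IsComplexMatrix B) (x y : Fin 6 → ℝ) :
    x ⬝ᵥ B.mulVec y = -(B.mulVec x ⬝ᵥ y) := by
  have : B.transpose = -B := by
    ext i j
    exact h.skew i j
  rw [Matrix.dotProduct_mulVec, ← Matrix.mulVec_transpose, this, Matrix.neg_mulVec,
    neg_dotProduct]

/-- The `(0, 1)`-vector with real part `x`. -/
def antiholomorphic (B : Matrix (Fin 6) (Fin 6) ℝ) (x : Fin 6 → ℝ) : Fin 6 → ℂ :=
  toComplexVec x (B.mulVec x)

theorem ofHermitian_outer_im (u : Fin 4 → ℂ) (i j : Fin 6) :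
    (ofHermitian (outer u) i j).im = 0 := by
  fin_cases i <;> fin_cases j <;> simp only [ofHermitian, Fin.zero_eta, Fin.mk_one,
    Fin.reduceFinMk, Matrix.of_apply, Matrix.cons_val', Matrix.cons_val, outer] <;>
    simp <;> ring

theorem klein_smul (u v : Fin 4 → ℂ) (c : ℂ) : klein u (c • v) = c • klein u v := by
  ext i
  fin_cases i <;> simp [klein] <;> ring

theorem IsTwistor.mulVec_ofReal (h : IsTwistor B u) (x : Fin 6 → ℝ) (i : Fin 6) :
    (ofHermitian (outer u)).mulVec (fun j => (x j : ℂ)) i = normSq4 u * (B.mulVec x i : ℝ) := by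
  simp only [Matrix.mulVec, dotProduct, ← h _ _]
  push_cast
  rw [Finset.mul_sum]
  exact Finset.sum_congr rfl fun j _ => by ring

theorem IsTwistor.antiholomorphic_eq (hu : u ≠ 0) (h : IsTwistor B u) (x : Fin 6 → ℝ) :
    ∃ a, antiholomorphic B x = klein u a := by
  refine ⟨(2 / normSq4 u) • contraction u (fun j => (x j : ℂ)), ?_⟩
  rw [klein_smul]
  ext i
  have h1 := klein_contraction u (fun j => (x j : ℂ)) i
  rw [h.mulVec_ofReal] at h1
  have h2 := normSq4_ne_zero hu
  simp only [Pi.smul_apply, smul_eq_mul, antiholomorphic, toComplexVec]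
  field_simp
  linear_combination -h1

theorem IsTwistor.klein_eq (hu : u ≠ 0) (h : IsTwistor B u) (a : Fin 4 → ℂ) :
    ∃ x, klein u a = antiholomorphic B x := by
  -- The equation $B(u\wedge a)=-i\,u\wedge a$ says that the imaginary part is $B$ applied to the
  -- real part.
  refine ⟨fun i => (klein u a i).re, ?_⟩
  have hre : ∀ i, klein u a i = ((klein u a i).re : ℂ) + Complex.I * ((klein u a i).im : ℂ) :=
    fun i => by rw [mul_comm, Complex.re_add_im]
  ext i
  have h1 := ofHermitian_mulVec_klein u a i
  have h2 : (ofHermitian (outer u)).mulVec (klein u a) i =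
      (ofHermitian (outer u)).mulVec (fun j => ((klein u a j).re : ℂ)) i + Complex.I *
      (ofHermitian (outer u)).mulVec (fun j => ((klein u a j).im : ℂ)) i := by
    simp only [Matrix.mulVec, dotProduct, Finset.mul_sum, ← Finset.sum_add_distrib]
    refine Finset.sum_congr rfl fun j _ => ?_
    conv_lhs => rw [hre]
    ring
  rw [h2, h.mulVec_ofReal, h.mulVec_ofReal] at h1
  have h3 : (B.mulVec (fun j => (klein u a j).re) i : ℂ) +
      Complex.I * (B.mulVec (fun j => (klein u a j).im) i : ℂ) = -Complex.I * klein u a i :=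
    mul_left_cancel₀ (normSq4_ne_zero hu) (by linear_combination h1)
  have h4 := congrArg Complex.re h3
  simp at h4
  rw [antiholomorphic, toComplexVec, h4]
  exact hre i

/-- Projecting a basis vector $e_j$ to $V_u$ gives $\tfrac12(|u|^2e_j+iHe_j)$ with $H$ the real
matrix `ofHermitian (outer u)`. If this equals $y+iBy$, comparing real and imaginary parts gives
$|u|^2Be_j=He_j$. -/
theorem isTwistor_of_klein_eq (h : ∀ a, ∃ x, klein u a = antiholomorphic B x) :
    IsTwistor B u := by
  intro i j
  obtain ⟨y, hy⟩ := h (contraction u (fun k => ((Pi.single j 1 : Fin 6 → ℝ) k : ℂ)))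
  have him := ofHermitian_outer_im u
  have h0 : ∀ k, (ofHermitian (outer u)).mulVec
      (fun k => ((Pi.single j 1 : Fin 6 → ℝ) k : ℂ)) k = ofHermitian (outer u) k j := by
    intro k
    have hs : (fun k => ((Pi.single j 1 : Fin 6 → ℝ) k : ℂ)) = Pi.single j 1 := by
      ext k
      by_cases hk : k = j <;> simp [hk]
    rw [hs, Matrix.mulVec_single_one]
    rfl
  have h1 : ∀ k, 2 * (y k + Complex.I * (B.mulVec y k : ℝ)) =
      normSq4 u * ((Pi.single j 1 : Fin 6 → ℝ) k : ℂ) +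
        Complex.I * ofHermitian (outer u) k j := by
    intro k
    have h := klein_contraction u (fun k => ((Pi.single j 1 : Fin 6 → ℝ) k : ℂ)) k
    rw [hy, h0] at h
    exact h
  rw [normSq4_eq] at h1 ⊢
  set r : ℝ := ∑ i, Complex.normSq (u i)
  have h2 : ∀ k, 2 * y k = r * (Pi.single j 1 : Fin 6 → ℝ) k := fun k => by
    have := congrArg Complex.re (h1 k)
    simpa [him] using this
  have h3 : 2 * B.mulVec y i = (ofHermitian (outer u) i j).re := by
    have := congrArg Complex.im (h1 i)
    simpa using this
  have h4 : r * B i j = 2 * B.mulVec y i := by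
    have : (2 : ℝ) • y = r • (Pi.single j 1 : Fin 6 → ℝ) := funext h2
    have h5 := congrArg (fun v => B.mulVec v i) this
    simp only [Matrix.mulVec_smul, Pi.smul_apply, smul_eq_mul, Matrix.mulVec_single_one] at h5
    exact h5.symm
  rw [h3] at h4
  apply Complex.ext
  · rw [← h4]
    simp
  · simp [him]

/-- $J$ acts on forms by the transpose, which is $-B$ by skewness. Hence $i$-eigenforms correspond
under the metric to $-i$-eigenvectors, that is, to $(0,1)$-vectors. -/
theorem eigenform_iff (hB : HasMatrix J B) (hc : IsComplexMatrix B) (c : Fin 6 → ℂ) :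
    (∀ (m : IwasawaManifold) (x : T m),
      ∑ j, c j * (e j m (J m x) : ℂ) = Complex.I * ∑ j, c j * (e j m x : ℂ)) ↔
      ∃ x, c = antiholomorphic B x := by
  have he : ∀ (m : IwasawaManifold) (x : T m) j, e j m x = coframe m x j := fun _ _ _ => rfl
  simp only [he, hB _ _]
  constructor
  · intro h
    refine ⟨fun i => (c i).re, funext fun i => ?_⟩
    have h1 := h (quot 0) (frame (Pi.single i 1) (quot 0))
    simp only [coframe_frame, Matrix.mulVec_single_one] at h1
    have h2 := congrArg Complex.re h1
    simp [Pi.single_apply] at h2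
    rw [antiholomorphic, toComplexVec]
    have h3 : B.mulVec (fun i => (c i).re) i = (c i).im := by
      rw [Matrix.mulVec, dotProduct, ← neg_neg (c i).im, ← h2, ← Finset.sum_neg_distrib]
      refine Finset.sum_congr rfl fun j _ => ?_
      rw [hc.skew j i]
      ring
    rw [h3, mul_comm, Complex.re_add_im]
  · rintro ⟨x, rfl⟩ m y
    have h1 := hc.dotProduct_mulVec x (coframe m y)
    have h2 := hc.dotProduct_mulVec (B.mulVec x) (coframe m y)
    rw [hc.mulVec_mulVec, neg_dotProduct, neg_neg] at h2
    simp only [dotProduct] at h1 h2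
    have h1' : ∑ i, (x i : ℂ) * (B.mulVec (coframe m y) i : ℝ) =
      -∑ i, (B.mulVec x i : ℂ) * (coframe m y i : ℝ) := by exact_mod_cast h1
    have h2' : ∑ i, (B.mulVec x i : ℂ) * (B.mulVec (coframe m y) i : ℝ) =
      ∑ i, (x i : ℂ) * (coframe m y i : ℝ) := by exact_mod_cast h2
    simp only [antiholomorphic, toComplexVec, add_mul, mul_assoc, Finset.sum_add_distrib,
      ← Finset.mul_sum, h1', h2']
    linear_combination -(∑ i, (B.mulVec x i : ℂ) * (coframe m y i : ℝ)) * Complex.I_sq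

theorem isPoint_iff (hB : HasMatrix J B) (hc : IsComplexMatrix B) (hu : u ≠ 0) :
    IsPoint J u ↔ IsTwistor B u := by
  simp only [IsPoint, eigenform_iff hB hc]
  constructor
  · exact fun h => isTwistor_of_klein_eq fun a => (h _).2 ⟨a, rfl⟩
  · intro h c
    constructor
    · rintro ⟨x, rfl⟩
      exact h.antiholomorphic_eq hu x
    · rintro ⟨a, rfl⟩
      exact h.klein_eq hu a

theorem IsTwistor.toHermitian_diag (h : IsTwistor B u) (i : Fin 4) :
    normSq4 u * toHermitian (fun i j => (B i j : ℂ)) i i = 4 * (u i * starRingEnd ℂ (u i)) := by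
  have h1 := h 0 1
  have h2 := h 2 3
  have h3 := h 4 5
  simp only [ofHermitian, Matrix.of_apply, Matrix.cons_val', Matrix.cons_val, outer] at h1 h2 h3
  have h4 : normSq4 u = u 0 * starRingEnd ℂ (u 0) + u 1 * starRingEnd ℂ (u 1) +
    u 2 * starRingEnd ℂ (u 2) + u 3 * starRingEnd ℂ (u 3) := by simp [normSq4, Fin.sum_univ_four]
  fin_cases i <;> simp only [toHermitian, Fin.zero_eta, Fin.mk_one,
    Fin.reduceFinMk, Matrix.of_apply, Matrix.cons_val', Matrix.cons_val]
  · linear_combination h4 - h1 - h2 - h3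
  · linear_combination h4 - h1 + h2 + h3
  · linear_combination h4 + h1 - h2 + h3
  · linear_combination h4 + h1 + h2 - h3

/-- Whether a coordinate vanishes is read off from $B$ alone. Different representatives of the same
structure can thus be compared without proving that $u$ is unique up to scale. -/
theorem IsTwistor.apply_eq_zero_iff (hu : u ≠ 0) (h : IsTwistor B u) (i : Fin 4) :
    u i = 0 ↔ toHermitian (fun i j => (B i j : ℂ)) i i = 0 := by
  have h1 := h.toHermitian_diag i
  constructor
  · intro h0
    rw [h0, zero_mul, mul_zero] at h1
    exact (mul_eq_zero.1 h1).resolve_left (normSq4_ne_zero hu)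
  · intro h0
    rw [h0, mul_zero] at h1
    simpa using h1.symm

theorem mem_face_iff (hJ : J ∈ Z) (hB : HasMatrix J B) (hc : IsComplexMatrix B) (hu : u ≠ 0)
    (h : IsTwistor B u) (i : Fin 4) : J ∈ face i ↔ u i = 0 := by
  constructor
  · rintro ⟨-, v, hv, hvi, hp⟩
    rw [isPoint_iff hB hc hv] at hp
    exact (h.apply_eq_zero_iff hu i).2 ((hp.apply_eq_zero_iff hv i).1 hvi)
  · exact fun hi => ⟨hJ, u, hu, hi, (isPoint_iff hB hc hu).2 h⟩

theorem mem_edge12_iff (hJ : J ∈ Z) (hB : HasMatrix J B) (hc : IsComplexMatrix B) (hu : u ≠ 0)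
    (h : IsTwistor B u) : J ∈ edge 1 2 ↔ u 0 = 0 ∧ u 3 = 0 := by
  constructor
  · rintro ⟨-, v, hv, hvi, hp⟩
    rw [isPoint_iff hB hc hv] at hp
    exact ⟨(h.apply_eq_zero_iff hu _).2 ((hp.apply_eq_zero_iff hv _).1
        (hvi 0 (by decide) (by decide))),
      (h.apply_eq_zero_iff hu _).2 ((hp.apply_eq_zero_iff hv _).1 (hvi 3 (by decide) (by decide)))⟩
  · rintro ⟨h0, h3⟩
    refine ⟨hJ, u, hu, fun k h1 h2 => ?_, (isPoint_iff hB hc hu).2 h⟩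
    fin_cases k
    exacts [h0, absurd rfl h1, absurd rfl h2, h3]

theorem fundamentalForm_eq (hB : HasMatrix J B) (m : IwasawaManifold) (x y : T m) :
    fundamentalForm J m x y = ∑ i, ∑ j, B i j * coframe m x j * coframe m y i := by
  simp only [fundamentalForm, metric, hB _ _, Matrix.mulVec, dotProduct, Finset.sum_mul]

theorem fundamentalForm_frame (hB : HasMatrix J B) (i j : Fin 6) :
    fundamentalForm J (quot 0) (frame (Pi.single j 1) (quot 0)) (frame (Pi.single i 1) (quot 0)) =
      B i j := by
  rw [fundamentalForm_eq hB]
  simp [Pi.single_apply]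

theorem IsTwistor.eq_re (hu : u ≠ 0) (h : IsTwistor B u) (i j : Fin 6) :
    (B i j : ℂ) = ofHermitian (outer u) i j / normSq4 u := by
  rw [← h, mul_div_cancel_left₀ _ (normSq4_ne_zero hu)]

/-- The matrix of the almost complex structure with fundamental form `diagForm ε`. -/
def diagMatrix (ε : Fin 3 → ℝ) : Matrix (Fin 6) (Fin 6) ℝ :=
  !![0, -ε 0, 0, 0, 0, 0;
    ε 0, 0, 0, 0, 0, 0;
    0, 0, 0, -ε 1, 0, 0;
    0, 0, ε 1, 0, 0, 0;
    0, 0, 0, 0, 0, -ε 2;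
    0, 0, 0, 0, ε 2, 0]

theorem fundamentalForm_diagMatrix {ε : Fin 3 → ℝ} (hB : HasMatrix J (diagMatrix ε)) :
    fundamentalForm J = diagForm ε := by
  ext m x y
  rw [fundamentalForm_eq hB]
  simp [Fin.sum_univ_six, diagMatrix, diagForm, wedge, e]
  ring

theorem mem_vertex0_iff (hJ : J ∈ Z) (hB : HasMatrix J B) (hu : u ≠ 0)
    (h : IsTwistor B u) : J ∈ vertex 0 ↔ u 1 = 0 ∧ u 2 = 0 ∧ u 3 = 0 := by
  constructor
  · rintro ⟨-, hf⟩
    have hij : ∀ i j, B i j = diagForm ![1, 1, 1] (quot 0) (frame (Pi.single j 1) (quot 0))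
        (frame (Pi.single i 1) (quot 0)) := fun i j => by
      rw [← fundamentalForm_frame hB, hf]
      rfl
    have h1 := hij 0 1
    have h2 := hij 2 3
    have h3 := hij 4 5
    simp [diagForm, wedge, e] at h1 h2 h3
    simp only [h.apply_eq_zero_iff hu]
    simp [toHermitian, h1, h2, h3]
  · rintro ⟨h1, h2, h3⟩
    refine ⟨hJ, ?_⟩
    have h0 : u 0 * starRingEnd ℂ (u 0) ≠ 0 := by
      have := normSq4_ne_zero hu
      simpa [normSq4, Fin.sum_univ_four, h1, h2, h3] using this
    have hb : B = diagMatrix ![1, 1, 1] := by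
      ext i j
      apply Complex.ofReal_injective
      rw [h.eq_re hu, div_eq_iff (normSq4_ne_zero hu)]
      fin_cases i <;> fin_cases j <;> simp only [ofHermitian, diagMatrix, Fin.zero_eta, Fin.mk_one,
        Fin.reduceFinMk, Matrix.of_apply, Matrix.cons_val', Matrix.cons_val, outer, normSq4,
        Fin.sum_univ_four, h1, h2, h3] <;> simp
    subst hb
    exact fundamentalForm_diagMatrix hB

theorem mem_vertex3_iff (hJ : J ∈ Z) (hB : HasMatrix J B) (hu : u ≠ 0)
    (h : IsTwistor B u) : J ∈ vertex 3 ↔ u 0 = 0 ∧ u 1 = 0 ∧ u 2 = 0 := by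
  constructor
  · rintro ⟨-, hf⟩
    have hij : ∀ i j, B i j = diagForm ![-1, -1, 1] (quot 0) (frame (Pi.single j 1) (quot 0))
        (frame (Pi.single i 1) (quot 0)) := fun i j => by
      rw [← fundamentalForm_frame hB, hf]
      rfl
    have h1 := hij 0 1
    have h2 := hij 2 3
    have h3 := hij 4 5
    simp [diagForm, wedge, e] at h1 h2 h3
    simp only [h.apply_eq_zero_iff hu]
    simp [toHermitian, h1, h2, h3]
  · rintro ⟨h1, h2, h3⟩
    refine ⟨hJ, ?_⟩
    have h0 : u 3 * starRingEnd ℂ (u 3) ≠ 0 := by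
      have := normSq4_ne_zero hu
      simpa [normSq4, Fin.sum_univ_four, h1, h2, h3] using this
    have hb : B = diagMatrix ![-1, -1, 1] := by
      ext i j
      apply Complex.ofReal_injective
      rw [h.eq_re hu, div_eq_iff (normSq4_ne_zero hu)]
      fin_cases i <;> fin_cases j <;> simp only [ofHermitian, diagMatrix, Fin.zero_eta, Fin.mk_one,
        Fin.reduceFinMk, Matrix.of_apply, Matrix.cons_val', Matrix.cons_val, outer, normSq4,
        Fin.sum_univ_four, h1, h2, h3] <;> simp
    subst hb
    exact fundamentalForm_diagMatrix hB

end Points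

/-! ### The sphere $\mathcal S$ as the locus $u_3=0$, $|u_0|^2=|u_1|^2+|u_2|^2$. -/

section Sphere

variable {J : EndField} {B : Matrix (Fin 6) (Fin 6) ℝ} {u : Fin 4 → ℂ}

theorem plusPart_zero_zero (P : Matrix (Fin 4) (Fin 4) ℝ) : plusPart P 0 0 =
    (P 0 0 * P 1 1 - P 0 1 * P 1 0 + (P 2 0 * P 3 1 - P 2 1 * P 3 0) +
      (P 0 2 * P 1 3 - P 0 3 * P 1 2 + (P 2 2 * P 3 3 - P 2 3 * P 3 2))) / 2 := by
  simp [plusPart, selfDual, Matrix.trace, Matrix.mul_apply, Fin.sum_univ_succ]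
  ring

theorem sum_mul_of_mem {P : Matrix (Fin 4) (Fin 4) ℝ}
    (hP : P ∈ Matrix.specialOrthogonalGroup (Fin 4) ℝ) (i j : Fin 4) :
    P 0 i * P 0 j + P 1 i * P 1 j + P 2 i * P 2 j + P 3 i * P 3 j = if i = j then 1 else 0 := by
  have h := (Matrix.mem_orthogonalGroup_iff' _ _).1 (Matrix.mem_specialOrthogonalGroup_iff.1 hP).1
  simpa [Matrix.mul_apply, Fin.sum_univ_four, Matrix.one_apply] using congrFun (congrFun h i) j

/-- Twice the difference of the two sides is a sum of four squares, as the columns of $P$ are unit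
vectors. -/
theorem selfDual_le_one {P : Matrix (Fin 4) (Fin 4) ℝ}
    (hP : P ∈ Matrix.specialOrthogonalGroup (Fin 4) ℝ) (i j : Fin 4) :
    P 0 i * P 1 j - P 0 j * P 1 i + (P 2 i * P 3 j - P 2 j * P 3 i) ≤ 1 := by
  have h1 := sum_mul_of_mem hP i i
  have h2 := sum_mul_of_mem hP j j
  simp only [if_true] at h1 h2
  linarith [sq_nonneg (P 1 j - P 0 i), sq_nonneg (P 0 j + P 1 i), sq_nonneg (P 3 j - P 2 i),
    sq_nonneg (P 2 j + P 3 i)]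

theorem outer_smul (c : ℂ) (u : Fin 4 → ℂ) (i j : Fin 4) :
    outer (c • u) i j = (c * starRingEnd ℂ c) * outer u i j := by
  simp [outer]
  ring

theorem normSq4_smul (c : ℂ) (u : Fin 4 → ℂ) :
    normSq4 (c • u) = (c * starRingEnd ℂ c) * normSq4 u := by
  rw [normSq4, normSq4, Finset.mul_sum]
  exact Finset.sum_congr rfl fun i _ => outer_smul c u i i

theorem IsTwistor.smul (h : IsTwistor B u) (c : ℂ) : IsTwistor B (c • u) := by
  intro i j
  have h1 : outer (c • u) = fun i j => (c * starRingEnd ℂ c) * outer u i j := by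
    ext i j
    exact outer_smul c u i j
  have h2 : ofHermitian (outer (c • u)) = (c * starRingEnd ℂ c) • ofHermitian (outer u) := by
    rw [h1]
    exact ofHermitian_smul _ _
  rw [normSq4_smul, h2, mul_assoc, h]
  rfl

/-- The rotation `P` for which `omegaForm P 0 1` is the point `[1, a + ib, c + id, 0]`. -/
def sphereRotation (a b c d : ℝ) : Matrix (Fin 4) (Fin 4) ℝ :=
  !![d, c, a, b; -c, d, -b, a; -b, -a, c, d; a, -b, -d, c]

theorem sphereRotation_mem {a b c d : ℝ} (h : a ^ 2 + b ^ 2 + c ^ 2 + d ^ 2 = 1) :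
    sphereRotation a b c d ∈ Matrix.specialOrthogonalGroup (Fin 4) ℝ := by
  rw [Matrix.mem_specialOrthogonalGroup_iff, Matrix.mem_orthogonalGroup_iff]
  constructor
  · ext i j
    fin_cases i <;> fin_cases j <;>
      simp [sphereRotation, Matrix.mul_apply, Fin.sum_univ_four] <;>
      first | ring1 | linear_combination h
  · simp [sphereRotation, Matrix.det_succ_row_zero, Fin.sum_univ_succ, Fin.succAbove]
    -- With $s=a^2+b^2+c^2+d^2$ the determinant is $s^2$, and $s^2-1=(s+1)(s-1)$.
    linear_combination (a ^ 2 + b ^ 2 + c ^ 2 + d ^ 2 + 1) * h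

theorem plusPart_sphereRotation {a b c d : ℝ} (h : a ^ 2 + b ^ 2 + c ^ 2 + d ^ 2 = 1) :
    plusPart (sphereRotation a b c d) 0 0 = 1 := by
  rw [plusPart_zero_zero]
  simp only [sphereRotation, Matrix.of_apply, Matrix.cons_val', Matrix.cons_val]
  linear_combination h

/-- The matrix of the almost complex structure `[1, a + ib, c + id, 0]`. -/
def sphereMatrix (a b c d : ℝ) : Matrix (Fin 6) (Fin 6) ℝ :=
  !![0, -(a * a + b * b), b * c - a * d, -(b * d + a * c), d, -c;
    a * a + b * b, 0, a * c + b * d, b * c - a * d, -c, -d;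
    a * d - b * c, -(a * c + b * d), 0, -(c * c + d * d), -b, a;
    b * d + a * c, a * d - b * c, c * c + d * d, 0, a, b;
    -d, c, b, -a, 0, 0;
    c, d, -a, -b, 0, 0]

theorem fundamentalForm_sphereMatrix {a b c d : ℝ} (hB : HasMatrix J (sphereMatrix a b c d)) :
    fundamentalForm J = omegaForm (sphereRotation a b c d) 0 1 := by
  ext m x y
  rw [fundamentalForm_eq hB]
  simp [Fin.sum_univ_succ, sphereMatrix, sphereRotation, omegaForm, rotated, wedge, e]
  ring

theorem IsTwistor.eq_sphereMatrix {a b c d : ℝ} (h1 : a ^ 2 + b ^ 2 + c ^ 2 + d ^ 2 = 1)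
    (h : IsTwistor B ![1, ⟨a, b⟩, ⟨c, d⟩, 0]) : B = sphereMatrix a b c d := by
  have hn : normSq4 ![1, ⟨a, b⟩, ⟨c, d⟩, 0] = 2 := by
    apply Complex.ext
    · simp [normSq4, Fin.sum_univ_succ]
      linear_combination h1
    · simp [normSq4, Fin.sum_univ_succ]
      ring
  ext i j
  have h2 := congrArg Complex.re (h i j)
  rw [hn] at h2
  have h3 : B i j = (ofHermitian (outer ![1, ⟨a, b⟩, ⟨c, d⟩, 0]) i j).re / 2 := by
    rw [← h2]
    simp
  rw [h3]
  fin_cases i <;> fin_cases j <;> simp only [ofHermitian, sphereMatrix, Fin.zero_eta, Fin.mk_one,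
    Fin.reduceFinMk, Matrix.of_apply, Matrix.cons_val', Matrix.cons_val, outer] <;> simp <;>
    first | ring1 | linear_combination h1 / 2 | linear_combination -h1 / 2 |
      linear_combination h1 | linear_combination -h1

theorem mem_sphereS_iff (hJ : J ∈ Z) (hB : HasMatrix J B) (hu : u ≠ 0) (h : IsTwistor B u) :
    J ∈ sphereS ↔ u 3 = 0 ∧
      Complex.normSq (u 0) = Complex.normSq (u 1) + Complex.normSq (u 2) := by
  constructor
  · rintro ⟨-, P, hP, hp, hf⟩
    have hij : ∀ i j, B i j = omegaForm P 0 1 (quot 0) (frame (Pi.single j 1) (quot 0))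
        (frame (Pi.single i 1) (quot 0)) := fun i j => by
      rw [← fundamentalForm_frame hB, hf]
    have h1 := hij 0 1
    have h2 := hij 2 3
    have h3 := hij 4 5
    simp [omegaForm, rotated, wedge, e, Fin.sum_univ_four] at h1 h2 h3
    rw [plusPart_zero_zero] at hp
    have h4 := selfDual_le_one hP 0 1
    have h5 := selfDual_le_one hP 2 3
    -- The entry of $P_+$ is the average of the pairings of $f^{12}$ and $f^{34}$ with
    -- $e^{12}+e^{34}$. Each is at most 1, so both equal 1; the second is $-(B_{01}+B_{23})$.
    have h6 : B 0 1 + B 2 3 = -1 := by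
      linarith
    have h7 := h 4 5
    have hu3 : u 3 = 0 := by
      rw [h.apply_eq_zero_iff hu]
      have : 1 + B 0 1 + B 2 3 - B 4 5 = 0 := by linarith
      simp only [toHermitian, Matrix.of_apply, Matrix.cons_val', Matrix.cons_val]
      exact_mod_cast this
    refine ⟨hu3, ?_⟩
    rw [h3] at h7
    simp only [ofHermitian, Matrix.of_apply, Matrix.cons_val', Matrix.cons_val, outer, hu3,
      Complex.mul_conj] at h7
    simp only [Complex.normSq_zero] at h7
    have h8 := congrArg Complex.re h7
    simp at h8
    linarith
  · rintro ⟨h3, hn⟩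
    have h0 : u 0 ≠ 0 := by
      intro h0
      rw [h0, Complex.normSq_zero] at hn
      have h1 : Complex.normSq (u 1) = 0 := by
        linarith [Complex.normSq_nonneg (u 1), Complex.normSq_nonneg (u 2)]
      have h2 : Complex.normSq (u 2) = 0 := by
        linarith [Complex.normSq_nonneg (u 1), Complex.normSq_nonneg (u 2)]
      rw [Complex.normSq_eq_zero] at h1 h2
      apply hu
      ext i
      fin_cases i
      exacts [h0, h1, h2, h3]
    -- Rescaling to $u_0=1$ turns the condition into $|u_1|^2+|u_2|^2=1$, the unit 3-sphere of
    -- parameters of `sphereRotation`.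
    have hv : (u 0)⁻¹ • u = ![1, ⟨(u 1 / u 0).re, (u 1 / u 0).im⟩,
        ⟨(u 2 / u 0).re, (u 2 / u 0).im⟩, 0] := by
      ext i
      fin_cases i
      · exact inv_mul_cancel₀ h0
      · exact (div_eq_inv_mul _ _).symm
      · exact (div_eq_inv_mul _ _).symm
      · exact (congrArg _ h3).trans (mul_zero _)
    have h4 := h.smul (u 0)⁻¹
    rw [hv] at h4
    have h5 : Complex.normSq (u 1 / u 0) + Complex.normSq (u 2 / u 0) = 1 := by
      rw [Complex.normSq_div, Complex.normSq_div, ← add_div, ← hn, div_self]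
      simpa using h0
    have h6 : (u 1 / u 0).re ^ 2 + (u 1 / u 0).im ^ 2 + (u 2 / u 0).re ^ 2 +
        (u 2 / u 0).im ^ 2 = 1 := by
      rw [← h5, Complex.normSq_apply, Complex.normSq_apply]
      ring
    have hb := h4.eq_sphereMatrix h6
    subst hb
    exact ⟨hJ, _, sphereRotation_mem h6, plusPart_sphereRotation h6,
      fundamentalForm_sphereMatrix hB⟩

end Sphere

/-! ### The tensor $\nabla\omega$ in terms of the Koszul form on $V_u$ and its conjugate. -/

section CovariantDerivative

/-- The tensor `∇ω` in the invariant frame, for the almost complex structure with matrix `B`. -/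
def nablaForm (B : Matrix (Fin 6) (Fin 6) ℝ) (x y z : Fin 6 → ℝ) : ℝ :=
  (koszul x (B.mulVec y) z + koszul x y (B.mulVec z)) / 2

theorem koszul_swap {R : Type*} [CommRing R] (x y z : Fin 6 → R) :
    koszul x z y = -koszul x y z := by
  simp only [koszul, structureForm]
  ring

theorem koszul_neg_left {R : Type*} [CommRing R] (x y z : Fin 6 → R) :
    koszul (-x) y z = -koszul x y z := by
  simp only [koszul, structureForm, Pi.neg_apply]
  ring

theorem koszul_neg_middle {R : Type*} [CommRing R] (x y z : Fin 6 → R) :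
    koszul x (-y) z = -koszul x y z := by
  simp only [koszul, structureForm, Pi.neg_apply]
  ring

theorem koszul_neg_right {R : Type*} [CommRing R] (x y z : Fin 6 → R) :
    koszul x y (-z) = -koszul x y z := by
  simp only [koszul, structureForm, Pi.neg_apply]
  ring

section Algebra

variable {V : Type} [AddCommGroup V] [Module ℝ V] {φ : V ≃ₗ[ℝ] (Fin 6 → ℝ)} {J : V →ₗ[ℝ] V}
  {B : Matrix (Fin 6) (Fin 6) ℝ} {α : V →ₗ[ℝ] V →ₗ[ℝ] V →ₗ[ℝ] ℝ} {u : Fin 4 → ℂ}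

variable (φ J B α) in
/-- `α` is the tensor `∇ω` of the complex structure `J` with matrix `B`. -/
structure IsNabla : Prop where
  complex : IsComplexMatrix B
  map : ∀ x, φ (J x) = B.mulVec (φ x)
  apply : ∀ x y z, α x y z = nablaForm B (φ x) (φ y) (φ z)

theorem exists_nablaForm (φ : V ≃ₗ[ℝ] (Fin 6 → ℝ)) (B : Matrix (Fin 6) (Fin 6) ℝ) :
    ∃ α : V →ₗ[ℝ] V →ₗ[ℝ] V →ₗ[ℝ] ℝ, ∀ x y z, α x y z = nablaForm B (φ x) (φ y) (φ z) := by
  apply exists_trilinear (fun x y z => nablaForm B (φ x) (φ y) (φ z)) <;> intros <;>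
    simp only [nablaForm, map_add, map_smul, Matrix.mulVec_add, Matrix.mulVec_smul, koszul,
      structureForm, Pi.add_apply, Pi.smul_apply, smul_eq_mul] <;> ring

theorem pullDot_eq (x y : V) : pullDot φ x y = φ x ⬝ᵥ φ y := rfl

theorem IsNabla.isOrthogonalComplex (h : IsNabla φ J B α) : IsOrthogonalComplex φ J := by
  constructor
  · intro x
    apply φ.injective
    rw [h.map, h.map, h.complex.mulVec_mulVec, map_neg]
  · intro x y
    rw [pullDot_eq, pullDot_eq, h.map, h.map, h.complex.dotProduct_mulVec, h.complex.mulVec_mulVec,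
      neg_dotProduct, neg_neg]

theorem IsNabla.mem_ghTotal (h : IsNabla φ J B α) : α ∈ ghTotal J := by
  intro x y z
  simp only [h.apply, h.map, nablaForm, h.complex.mulVec_mulVec, koszul_neg_middle,
    koszul_neg_right]
  rw [koszul_swap (φ x) (B.mulVec (φ y)) (φ z), koszul_swap (φ x) (φ y) (B.mulVec (φ z))]
  constructor <;> ring

theorem IsNabla.antiPart_move_left (h : IsNabla φ J B α) (x y z : V) :
    antiPart J α (J x) y z = antiPart J α x (J y) z := by
  simp only [antiPart, h.isOrthogonalComplex.sq, map_neg, LinearMap.neg_apply]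
  ring

theorem IsNabla.antiPart_move_right (h : IsNabla φ J B α) (x y z : V) :
    antiPart J α x y (J z) = antiPart J α x (J y) z := by
  have hm := ghTotal_move h.isOrthogonalComplex h.mem_ghTotal
  simp only [antiPart]
  rw [hm, hm]

/-- The imaginary part is a multiple of `antiPart`, so conditions on that real tensor and on the
complex form over $V_u$ can be exchanged. -/
theorem IsNabla.koszul_antiholomorphic (h : IsNabla φ J B α) (x y z : V) :
    koszul (antiholomorphic B (φ x)) (antiholomorphic B (φ y)) (antiholomorphic B (φ z)) =
      2 * (-(antiPart J α x (J y) z : ℂ) + Complex.I * (antiPart J α x y z : ℂ)) := by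
  simp only [antiholomorphic, koszul_toComplexVec, antiPart, h.apply, h.map, nablaForm,
    h.complex.mulVec_mulVec, koszul_neg_middle, Matrix.mulVec_neg]
  push_cast
  ring

theorem conj_antiholomorphic (B : Matrix (Fin 6) (Fin 6) ℝ) (x : Fin 6 → ℝ) (i : Fin 6) :
    starRingEnd ℂ (antiholomorphic B x i) = toComplexVec x (-B.mulVec x) i := by
  simp [antiholomorphic, toComplexVec]

theorem IsNabla.koszul_conj_antiholomorphic (h : IsNabla φ J B α) (x y z : V) :
    koszul (toComplexVec (φ x) (-B.mulVec (φ x))) (antiholomorphic B (φ y))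
      (antiholomorphic B (φ z)) =
      2 * (-(invPart J α x (J y) z : ℂ) + Complex.I * (invPart J α x y z : ℂ)) := by
  simp only [antiholomorphic, koszul_toComplexVec, invPart, h.apply, h.map, nablaForm,
    h.complex.mulVec_mulVec, koszul_neg_left, koszul_neg_middle,
    Matrix.mulVec_neg]
  push_cast
  ring

theorem exists_klein_eq (hu : u ≠ 0) (ht : IsTwistor B u) (φ : V ≃ₗ[ℝ] (Fin 6 → ℝ))
    (a : Fin 4 → ℂ) : ∃ x : V, klein u a = antiholomorphic B (φ x) := by
  obtain ⟨x, hx⟩ := ht.klein_eq hu a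
  exact ⟨φ.symm x, by rw [φ.apply_symm_apply, hx]⟩

theorem IsNabla.koszul_klein_swap (h : IsNabla φ J B α) (hu : u ≠ 0) (ht : IsTwistor B u)
    (hs : ∀ x y z, antiPart J α y x z = -antiPart J α x y z) (a b c : Fin 4 → ℂ) :
    koszul (klein u b) (klein u a) (klein u c) =
      -koszul (klein u a) (klein u b) (klein u c) := by
  obtain ⟨x, hx⟩ := exists_klein_eq hu ht φ a
  obtain ⟨y, hy⟩ := exists_klein_eq hu ht φ b
  obtain ⟨z, hz⟩ := exists_klein_eq hu ht φ c
  rw [hx, hy, hz, h.koszul_antiholomorphic, h.koszul_antiholomorphic, hs x y, hs (J x) y,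
    h.antiPart_move_left]
  push_cast
  ring

theorem IsNabla.koszul_klein_cyclic (h : IsNabla φ J B α) (hu : u ≠ 0) (ht : IsTwistor B u)
    (hs : ∀ x y z, antiPart J α x y z + antiPart J α y z x + antiPart J α z x y = 0)
    (a b c : Fin 4 → ℂ) :
    koszul (klein u a) (klein u b) (klein u c) + koszul (klein u b) (klein u c) (klein u a) +
      koszul (klein u c) (klein u a) (klein u b) = 0 := by
  obtain ⟨x, hx⟩ := exists_klein_eq hu ht φ a
  obtain ⟨y, hy⟩ := exists_klein_eq hu ht φ b
  obtain ⟨z, hz⟩ := exists_klein_eq hu ht φ c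
  rw [hx, hy, hz, h.koszul_antiholomorphic, h.koszul_antiholomorphic, h.koszul_antiholomorphic]
  have h1 := hs x y z
  have h2 := hs (J x) y z
  rw [h.antiPart_move_left, h.antiPart_move_right] at h2
  have h1' : (antiPart J α x y z + antiPart J α y z x + antiPart J α z x y : ℂ) = 0 := by
    exact_mod_cast h1
  have h2' : (antiPart J α x (J y) z + antiPart J α y (J z) x + antiPart J α z (J x) y : ℂ) = 0 := by
    exact_mod_cast h2
  linear_combination 2 * Complex.I * h1' - 2 * h2'

theorem IsNabla.antiPart_cyclic (h : IsNabla φ J B α) (hu : u ≠ 0) (ht : IsTwistor B u)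
    (hk : ∀ a b c, koszul (klein u a) (klein u b) (klein u c) +
      koszul (klein u b) (klein u c) (klein u a) +
      koszul (klein u c) (klein u a) (klein u b) = 0) (x y z : V) :
    antiPart J α x y z + antiPart J α y z x + antiPart J α z x y = 0 := by
  obtain ⟨a, ha⟩ := ht.antiholomorphic_eq hu (φ x)
  obtain ⟨b, hb⟩ := ht.antiholomorphic_eq hu (φ y)
  obtain ⟨c, hc⟩ := ht.antiholomorphic_eq hu (φ z)
  have h1 := hk a b c
  rw [← ha, ← hb, ← hc, h.koszul_antiholomorphic, h.koszul_antiholomorphic,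
    h.koszul_antiholomorphic] at h1
  have h2 := congrArg Complex.im h1
  simp at h2
  linarith

theorem IsNabla.antiPart_eq_zero (h : IsNabla φ J B α) (hu : u ≠ 0) (ht : IsTwistor B u)
    (hk : ∀ a b c, koszul (klein u a) (klein u b) (klein u c) = 0) (x y z : V) :
    antiPart J α x y z = 0 := by
  obtain ⟨a, ha⟩ := ht.antiholomorphic_eq hu (φ x)
  obtain ⟨b, hb⟩ := ht.antiholomorphic_eq hu (φ y)
  obtain ⟨c, hc⟩ := ht.antiholomorphic_eq hu (φ z)
  have h1 := hk a b c
  rw [← ha, ← hb, ← hc, h.koszul_antiholomorphic] at h1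
  have h2 := congrArg Complex.im h1
  simpa using h2

theorem IsNabla.invPart_eq_zero (h : IsNabla φ J B α) (hu : u ≠ 0) (ht : IsTwistor B u)
    (hk : ∀ a b c, koszul (kleinConj u a) (klein u b) (klein u c) = 0) (x y z : V) :
    invPart J α x y z = 0 := by
  obtain ⟨a, ha⟩ := ht.antiholomorphic_eq hu (φ x)
  obtain ⟨b, hb⟩ := ht.antiholomorphic_eq hu (φ y)
  obtain ⟨c, hc⟩ := ht.antiholomorphic_eq hu (φ z)
  have h1 := hk a b c
  have h0 : kleinConj u a = toComplexVec (φ x) (-B.mulVec (φ x)) := by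
    ext i
    rw [kleinConj, ← ha, conj_antiholomorphic]
  rw [h0, ← hb, ← hc, h.koszul_conj_antiholomorphic] at h1
  have h2 := congrArg Complex.im h1
  simpa using h2

/-- Hermitian orthogonality in $V_u$ thus means real orthogonality of $x$ to both $y$ and $Jy$,
exactly what makes a $W_4$ tensor vanish. -/
theorem IsNabla.kleinInner_eq (h : IsNabla φ J B α) {a b : Fin 4 → ℂ} {x y : V}
    (ha : klein u a = antiholomorphic B (φ x)) (hb : klein u b = antiholomorphic B (φ y)) :
    kleinInner u a b =
      2 * ((pullDot φ x y : ℂ) + Complex.I * (pullDot φ x (J y) : ℂ)) := by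
  have h1 := h.isOrthogonalComplex.orthogonal x y
  have h2 := h.isOrthogonalComplex.skew x y
  simp only [pullDot, h.map] at h1 h2 ⊢
  have h1' : ∑ i, (B.mulVec (φ x) i : ℂ) * B.mulVec (φ y) i = ∑ i, (φ x i : ℂ) * φ y i := by
    exact_mod_cast h1
  have h2' : ∑ i, (B.mulVec (φ x) i : ℂ) * φ y i = -∑ i, (φ x i : ℂ) * B.mulVec (φ y) i := by
    exact_mod_cast h2
  have h3 : ∀ i, kleinConj u a i * klein u b i = (φ x i : ℂ) * φ y i +
      (B.mulVec (φ x) i : ℂ) * B.mulVec (φ y) i + Complex.I * ((φ x i : ℂ) * B.mulVec (φ y) i)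
      - Complex.I * ((B.mulVec (φ x) i : ℂ) * φ y i) := by
    intro i
    rw [kleinConj, ha, hb, conj_antiholomorphic]
    simp only [antiholomorphic, toComplexVec, Pi.neg_apply, Complex.ofReal_neg]
    ring_nf
    simp only [Complex.I_sq]
    ring
  rw [kleinInner, Finset.sum_congr rfl fun i _ => h3 i]
  simp only [Finset.sum_add_distrib, Finset.sum_sub_distrib, ← Finset.mul_sum, h1', h2']
  push_cast
  ring

theorem IsNabla.koszul_conj_klein (h : IsNabla φ J B α) (hu : u ≠ 0) (ht : IsTwistor B u)
    {θ : V →ₗ[ℝ] ℝ} (hθ : ∀ x y z, invPart J α x y z = 2 * (pullDot φ x y * θ z -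
      pullDot φ x z * θ y - pullDot φ x (J y) * θ (J z) + pullDot φ x (J z) * θ (J y)))
    (a b c : Fin 4 → ℂ) (hb : kleinInner u a b = 0) (hc : kleinInner u a c = 0) :
    koszul (kleinConj u a) (klein u b) (klein u c) = 0 := by
  obtain ⟨x, hx⟩ := exists_klein_eq hu ht φ a
  obtain ⟨y, hy⟩ := exists_klein_eq hu ht φ b
  obtain ⟨z, hz⟩ := exists_klein_eq hu ht φ c
  have h0 : kleinConj u a = toComplexVec (φ x) (-B.mulVec (φ x)) := by
    ext i
    rw [kleinConj, hx, conj_antiholomorphic]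
  have hsplit : ∀ r s : ℝ, 2 * ((r : ℂ) + Complex.I * s) = 0 → r = 0 ∧ s = 0 := by
    intro r s hrs
    have h1 := congrArg Complex.re hrs
    have h2 := congrArg Complex.im hrs
    simp at h1 h2
    exact ⟨h1, h2⟩
  rw [h.kleinInner_eq hx hy] at hb
  rw [h.kleinInner_eq hx hz] at hc
  obtain ⟨hb1, hb2⟩ := hsplit _ _ hb
  obtain ⟨hc1, hc2⟩ := hsplit _ _ hc
  rw [h0, hy, hz, h.koszul_conj_antiholomorphic, hθ, hθ, h.isOrthogonalComplex.sq,
    pullDot_neg_right, hb1, hb2, hc1, hc2]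
  simp

/-- Only the fifth and sixth components can occur, because all brackets lie in the centre spanned by
$e_5,e_6$. -/
theorem IsNabla.trace12_apply (h : IsNabla φ J B α) (z : V) : trace12 φ α z =
    -((B 2 0 + B 1 3) * φ z 4 + (B 3 0 + B 2 1) * φ z 5) := by
  have hs := h.complex.skew
  have e1 : ∀ i, φ (stdVec φ i) = Pi.single i 1 := fun i => φ.apply_symm_apply _
  have e2 : ∀ i, B.mulVec (Pi.single i 1) = fun j => B j i := fun i => by
    rw [Matrix.mulVec_single_one]
    rfl
  simp only [trace12, LinearMap.sum_apply, h.apply, nablaForm, e1, e2]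
  generalize φ z = z'
  generalize B.mulVec z' = w
  simp [Fin.sum_univ_six, koszul, structureForm, Pi.single_apply]
  linear_combination z' 2 / 2 * (hs 0 4 + hs 1 5) + z' 3 / 2 * (hs 0 5 - hs 1 4) -
    z' 0 / 2 * (hs 2 4 + hs 3 5) + z' 1 / 2 * (hs 3 4 - hs 2 5) +
    z' 4 / 2 * (hs 0 2 + hs 1 3) + z' 5 / 2 * (hs 0 3 + hs 1 2)

theorem IsNabla.trace12_eq_zero_iff (h : IsNabla φ J B α) (hu : u ≠ 0) (ht : IsTwistor B u) :
    (∀ z, trace12 φ α z = 0) ↔ u 0 = 0 ∨ u 3 = 0 := by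
  have h1 : normSq4 u * ((B 2 0 : ℂ) + B 1 3) =
      2 * Complex.I * (outer u 0 3 - outer u 3 0) := by
    rw [mul_add, ht, ht]
    simp only [ofHermitian, Matrix.of_apply, Matrix.cons_val', Matrix.cons_val]
    ring
  have h2 : normSq4 u * ((B 3 0 : ℂ) + B 2 1) = -2 * (outer u 3 0 + outer u 0 3) := by
    rw [mul_add, ht, ht]
    simp only [ofHermitian, Matrix.of_apply, Matrix.cons_val', Matrix.cons_val]
    ring
  constructor
  · intro h0
    have h3 := h0 (φ.symm (Pi.single 4 1))
    have h4 := h0 (φ.symm (Pi.single 5 1))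
    rw [h.trace12_apply, φ.apply_symm_apply] at h3 h4
    simp at h3 h4
    have h3' : ((B 2 0 : ℂ) + B 1 3) = 0 := by
      rw [← Complex.ofReal_add, show B 2 0 + B 1 3 = 0 by linarith, Complex.ofReal_zero]
    have h4' : ((B 3 0 : ℂ) + B 2 1) = 0 := by
      rw [← Complex.ofReal_add, show B 3 0 + B 2 1 = 0 by linarith, Complex.ofReal_zero]
    rw [h3', mul_zero] at h1
    rw [h4', mul_zero] at h2
    -- The two real coefficients are, up to the factor $|u|^2$, multiples of the imaginary and real
    -- parts of $u_0\bar u_3$.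
    have h5 : outer u 0 3 = 0 := by
      linear_combination (1 / 4) * Complex.I * h1 + (1 / 4) * h2 +
        (1 / 2) * (outer u 0 3 - outer u 3 0) * Complex.I_sq
    simpa [outer] using h5
  · intro h0 z
    have h5 : outer u 0 3 = 0 ∧ outer u 3 0 = 0 := by
      rcases h0 with h0 | h0 <;> simp [outer, h0]
    rw [h5.1, h5.2] at h1 h2
    have h6 : B 2 0 + B 1 3 = 0 := by
      have := (mul_eq_zero.1 (h1.trans (by ring))).resolve_left (normSq4_ne_zero hu)
      exact_mod_cast this
    have h7 : B 3 0 + B 2 1 = 0 := by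
      have := (mul_eq_zero.1 (h2.trans (by ring))).resolve_left (normSq4_ne_zero hu)
      exact_mod_cast this
    rw [h.trace12_apply, h6, h7]
    ring

end Algebra

end CovariantDerivative

/-! ### Passage to the manifold and determination of the classes. -/

section Classes

/-- The invariant coframe at `m` as a linear equivalence. -/
def coframeEquiv (m : IwasawaManifold) : T m ≃ₗ[ℝ] (Fin 6 → ℝ) where
  toFun := coframe m
  map_add' := map_add _
  map_smul' := map_smul _
  invFun c := frame c m
  left_inv x := frame_coframe m x
  right_inv c := coframe_frame c m

variable {J : EndField} {B : Matrix (Fin 6) (Fin 6) ℝ} {u : Fin 4 → ℂ} {m : IwasawaManifold}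

theorem mvfderiv_dotProduct {a b : IwasawaManifold → Fin 6 → ℝ}
    (ha : MDifferentiableAt 𝓘(ℝ, C3) 𝓘(ℝ, Fin 6 → ℝ) a m)
    (hb : MDifferentiableAt 𝓘(ℝ, C3) 𝓘(ℝ, Fin 6 → ℝ) b m) (x : T m) :
    mvfderiv 𝓘(ℝ, C3) (fun p => a p ⬝ᵥ b p) m x =
      mvfderiv 𝓘(ℝ, C3) a m x ⬝ᵥ b m + a m ⬝ᵥ mvfderiv 𝓘(ℝ, C3) b m x := by
  have h1 : (fun p => a p ⬝ᵥ b p) = ∑ i, (fun p => a p i) * (fun p => b p i) := by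
    ext1 p
    simp [dotProduct]
  have h3 : ∀ i, mvfderiv 𝓘(ℝ, C3) ((fun p => a p i) * (fun p => b p i)) m x =
      a m i * mvfderiv 𝓘(ℝ, C3) b m x i + b m i * mvfderiv 𝓘(ℝ, C3) a m x i := by
    intro i
    rw [mvfderiv_mul (mvfderiv_component ha i).1 (mvfderiv_component hb i).1]
    simp [(mvfderiv_component ha i).2, (mvfderiv_component hb i).2]
  rw [h1, mvfderiv_sum fun i => (mvfderiv_component ha i).1.mul (mvfderiv_component hb i).1,
    sum_apply]
  simp only [h3, dotProduct, Finset.sum_add_distrib]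
  rw [add_comm]
  congr 1
  exact Finset.sum_congr rfl fun i _ => mul_comm _ _

theorem mvfderiv_mulVec {a : IwasawaManifold → Fin 6 → ℝ}
    (ha : MDifferentiableAt 𝓘(ℝ, C3) 𝓘(ℝ, Fin 6 → ℝ) a m) (B : Matrix (Fin 6) (Fin 6) ℝ) :
    MDifferentiableAt 𝓘(ℝ, C3) 𝓘(ℝ, Fin 6 → ℝ) (fun p => B.mulVec (a p)) m ∧
    ∀ x, mvfderiv 𝓘(ℝ, C3) (fun p => B.mulVec (a p)) m x =
      B.mulVec (mvfderiv 𝓘(ℝ, C3) a m x) := by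
  have h := ((LinearMap.toContinuousLinearMap B.mulVecLin).hasMFDerivAt (x := a m)).comp m
    ha.hasMFDerivAt
  refine ⟨h.mdifferentiableAt, fun x => ?_⟩
  have h2 : mfderiv 𝓘(ℝ, C3) 𝓘(ℝ, Fin 6 → ℝ) (fun p => B.mulVec (a p)) m = _ := h.mfderiv
  unfold mvfderiv
  rw [h2]
  rfl

theorem christoffel_skew (x y z : Fin 6 → ℝ) : y ⬝ᵥ christoffel x z = -(koszul x y z / 2) := by
  rw [← christoffel_dotProduct]
  linarith [christoffel_metric x y z]

/-- The matrix $B$ is constant, so the derivatives of the components of $Y$ and $Y'$ cancel and only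
the Christoffel terms remain. -/
theorem covariantDerivative_eq (hB : HasMatrix J B) (hc : IsComplexMatrix B)
    {Y Y' : ∀ p : IwasawaManifold, T p} (hY : FieldDiffAt Y m) (hY' : FieldDiffAt Y' m)
    (x : T m) : mvfderiv 𝓘(ℝ, C3) (fun p => fundamentalForm J p (Y p) (Y' p)) m x -
      fundamentalForm J m (leviCivita Y m x) (Y' m) -
      fundamentalForm J m (Y m) (leviCivita Y' m x) =
      nablaForm B (coframe m x) (coframe m (Y m)) (coframe m (Y' m)) := by
  have hf : ∀ (p : IwasawaManifold) (y z : T p), fundamentalForm J p y z =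
      B.mulVec (coframe p y) ⬝ᵥ coframe p z := fun p y z => by
    rw [← hB]
    rfl
  have h1 := mdifferentiable_coframe hY
  have h2 := mdifferentiable_coframe hY'
  simp only [hf]
  rw [mvfderiv_dotProduct (mvfderiv_mulVec h1 B).1 h2, (mvfderiv_mulVec h1 B).2,
    leviCivita_apply, leviCivita_apply, Matrix.mulVec_add, add_dotProduct, dotProduct_add,
    christoffel_skew, ← neg_eq_iff_eq_neg.2 (hc.dotProduct_mulVec (christoffel _ _) _),
    christoffel_dotProduct, nablaForm]
  ring

theorem isCovariantDerivativeAt_iff (hB : HasMatrix J B) (hc : IsComplexMatrix B)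
    {α : T m →ₗ[ℝ] T m →ₗ[ℝ] T m →ₗ[ℝ] ℝ} :
    IsCovariantDerivativeAt (fundamentalForm J) m α ↔
      IsNabla (coframeEquiv m) (J m : T m →ₗ[ℝ] T m) B α := by
  constructor
  · refine fun h => ⟨hc, fun x => hB m x, fun x y z => ?_⟩
    -- The tensor is determined by invariant fields, through which every tangent vector extends.
    have h1 := h (frame (coframe m y)) (frame (coframe m z)) (mdifferentiable_frame _ m)
      (mdifferentiable_frame _ m) x
    rw [covariantDerivative_eq hB hc (mdifferentiable_frame _ m) (mdifferentiable_frame _ m),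
      frame_coframe, frame_coframe] at h1
    exact h1
  · intro h Y Y' hY hY' x
    rw [covariantDerivative_eq hB hc hY hY']
    exact h.apply x _ _

theorem mem_ghClass (hJ : J ∈ Z) (hB : HasMatrix J B) (hc : IsComplexMatrix B) {S : Set ℕ}
    (h : ∀ (m : IwasawaManifold) (α : T m →ₗ[ℝ] T m →ₗ[ℝ] T m →ₗ[ℝ] ℝ),
      IsNabla (coframeEquiv m) (J m : T m →ₗ[ℝ] T m) B α →
      α ∈ ⨆ i ∈ S, ghComponent (pullDot (coframeEquiv m)) (J m : T m →ₗ[ℝ] T m) i) :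
    J ∈ ghClass S := by
  refine ⟨hJ, fun m => ?_⟩
  obtain ⟨α, hα⟩ := exists_nablaForm (coframeEquiv m) B
  have hn : IsNabla (coframeEquiv m) (J m : T m →ₗ[ℝ] T m) B α := ⟨hc, fun x => hB m x, hα⟩
  exact ⟨α, (isCovariantDerivativeAt_iff hB hc).2 hn, h m α hn⟩

/-- The necessary conditions concern only $u$, which does not depend on the point, so a single point
is enough. -/
theorem exists_of_mem_ghClass (hB : HasMatrix J B) (hc : IsComplexMatrix B) {S : Set ℕ}
    (h : J ∈ ghClass S) : ∃ (m : IwasawaManifold) (α : T m →ₗ[ℝ] T m →ₗ[ℝ] T m →ₗ[ℝ] ℝ),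
      IsNabla (coframeEquiv m) (J m : T m →ₗ[ℝ] T m) B α ∧
      α ∈ ⨆ i ∈ S, ghComponent (pullDot (coframeEquiv m)) (J m : T m →ₗ[ℝ] T m) i := by
  obtain ⟨α, h1, h2⟩ := h.2 (quot 0)
  exact ⟨quot 0, α, (isCovariantDerivativeAt_iff hB hc).1 h1, h2⟩

theorem exists_point (hJ : J ∈ Z) : ∃ B u, HasMatrix J B ∧ IsComplexMatrix B ∧ u ≠ 0 ∧
    IsTwistor B u := by
  obtain ⟨B, hB, hc, hpos⟩ := exists_hasMatrix hJ
  obtain ⟨u, hu, ht⟩ := exists_isTwistor hc.skew hc.sq hpos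
  exact ⟨B, u, hB, hc, hu, ht⟩

theorem ghClass_mono {S S' : Set ℕ} (h : S ⊆ S') : ghClass S ⊆ ghClass S' := by
  rintro J ⟨hJ, h1⟩
  refine ⟨hJ, fun m => ?_⟩
  obtain ⟨α, h2, h3⟩ := h1 m
  exact ⟨α, h2, SetLike.le_def.1 (biSup_mono fun i hi => h hi) h3⟩

theorem ghClass_1234 : ghClass {1, 2, 3, 4} = Z := by
  refine Set.Subset.antisymm (fun J h => h.1) fun J hJ => ?_
  obtain ⟨B, u, hB, hc, hu, ht⟩ := exists_point hJ
  exact mem_ghClass hJ hB hc fun m α h => mem_class1234 h.isOrthogonalComplex h.mem_ghTotal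

theorem ghClass_123_subset : ghClass {1, 2, 3} ⊆ face 0 ∪ face 3 := by
  intro J h
  obtain ⟨B, u, hB, hc, hu, ht⟩ := exists_point h.1
  obtain ⟨m, α, hn, hα⟩ := exists_of_mem_ghClass hB hc h
  exact ((hn.trace12_eq_zero_iff hu ht).1 (trace12_of_mem hn.isOrthogonalComplex hα)).imp
    (mem_face_iff h.1 hB hc hu ht 0).2 (mem_face_iff h.1 hB hc hu ht 3).2

theorem face_zero_subset : face 0 ⊆ ghClass {1, 2, 3} := by
  intro J h
  have hJ := h.1
  obtain ⟨B, u, hB, hc, hu, ht⟩ := exists_point hJ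
  rw [mem_face_iff hJ hB hc hu ht] at h
  exact mem_ghClass hJ hB hc fun m α hn => mem_class123 hn.isOrthogonalComplex hn.mem_ghTotal
    ((hn.trace12_eq_zero_iff hu ht).2 (Or.inl h))

theorem face_three_subset : face 3 ⊆ ghClass {2, 3} := by
  intro J h
  have hJ := h.1
  obtain ⟨B, u, hB, hc, hu, ht⟩ := exists_point hJ
  rw [mem_face_iff hJ hB hc hu ht] at h
  exact mem_ghClass hJ hB hc fun m α hn => mem_class23 hn.isOrthogonalComplex hn.mem_ghTotal
    ((hn.trace12_eq_zero_iff hu ht).2 (Or.inr h))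
    (hn.antiPart_cyclic hu ht (koszul_klein_cyclic h))

theorem ghClass_234_subset : ghClass {2, 3, 4} ⊆ face 3 := by
  intro J h
  obtain ⟨B, u, hB, hc, hu, ht⟩ := exists_point h.1
  obtain ⟨m, α, hn, hα⟩ := exists_of_mem_ghClass hB hc h
  rw [mem_face_iff h.1 hB hc hu ht]
  exact eq_zero_of_koszul_cyclic
    (hn.koszul_klein_cyclic hu ht (antiPart_cyclic_of_mem hn.isOrthogonalComplex hα))

theorem sphereS_subset : sphereS ⊆ ghClass {2} := by
  intro J h
  have hJ := h.1
  obtain ⟨B, u, hB, hc, hu, ht⟩ := exists_point hJ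
  rw [mem_sphereS_iff hJ hB hu ht] at h
  exact mem_ghClass hJ hB hc fun m α hn => mem_class2 hn.mem_ghTotal
    (hn.invPart_eq_zero hu ht (koszul_conj_eq_zero_sphere h.1 h.2))
    (hn.antiPart_cyclic hu ht (koszul_klein_cyclic h.1))

theorem vertex_three_subset : vertex 3 ⊆ ghClass {1, 2} := by
  intro J h
  have hJ := h.1
  obtain ⟨B, u, hB, hc, hu, ht⟩ := exists_point hJ
  rw [mem_vertex3_iff hJ hB hu ht] at h
  exact mem_ghClass hJ hB hc fun m α hn => mem_class12 hn.isOrthogonalComplex hn.mem_ghTotal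
    (hn.invPart_eq_zero hu ht (koszul_conj_eq_zero_vertex h))

theorem ghClass_124_subset : ghClass {1, 2, 4} ⊆ vertex 3 ∪ sphereS := by
  intro J h
  obtain ⟨B, u, hB, hc, hu, ht⟩ := exists_point h.1
  obtain ⟨m, α, hn, hα⟩ := exists_of_mem_ghClass hB hc h
  obtain ⟨θ, hθ⟩ := invPart_of_mem hn.isOrthogonalComplex hα
  exact (point_of_koszul_conj hu (hn.koszul_conj_klein hu ht hθ)).imp
    (mem_vertex3_iff h.1 hB hu ht).2 (mem_sphereS_iff h.1 hB hu ht).2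

theorem mem_vertex_union_edge_iff (hJ : J ∈ Z) (hB : HasMatrix J B) (hc : IsComplexMatrix B)
    (hu : u ≠ 0) (ht : IsTwistor B u) : J ∈ vertex 0 ∪ edge 1 2 ↔
      (u 0 = 0 ∧ u 3 = 0) ∨ (u 1 = 0 ∧ u 2 = 0 ∧ u 3 = 0) := by
  rw [Set.mem_union, mem_vertex0_iff hJ hB hu ht, mem_edge12_iff hJ hB hc hu ht, or_comm]

theorem vertex_union_edge_subset : vertex 0 ∪ edge 1 2 ⊆ ghClass {3} := by
  intro J h
  have hJ : J ∈ Z := h.elim And.left And.left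
  obtain ⟨B, u, hB, hc, hu, ht⟩ := exists_point hJ
  rw [mem_vertex_union_edge_iff hJ hB hc hu ht] at h
  exact mem_ghClass hJ hB hc fun m α hn => mem_class3 hn.mem_ghTotal
    ((hn.trace12_eq_zero_iff hu ht).2 (Or.inr (h.elim And.right fun h => h.2.2)))
    (hn.antiPart_eq_zero hu ht (koszul_klein_eq_zero h))

theorem ghClass_134_subset : ghClass {1, 3, 4} ⊆ vertex 0 ∪ edge 1 2 := by
  intro J h
  obtain ⟨B, u, hB, hc, hu, ht⟩ := exists_point h.1
  obtain ⟨m, α, hn, hα⟩ := exists_of_mem_ghClass hB hc h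
  rw [mem_vertex_union_edge_iff h.1 hB hc hu ht]
  exact eq_zero_of_koszul_swap
    (hn.koszul_klein_swap hu ht (antiPart_swap_of_mem hn.isOrthogonalComplex hα))

/-- A common point would have $\nabla\omega\in(W_1\oplus W_2)\cap W_3=0$; so there is no invariant
Kähler structure, which empties the four classes inside $W_1\oplus W_4$. -/
theorem disjoint_vertex_union_edge :
    Disjoint (vertex 3 ∪ sphereS) (vertex 0 ∪ edge 1 2) := by
  rw [Set.disjoint_left]
  intro J h1 h2
  have hJ : J ∈ Z := h1.elim And.left And.left
  obtain ⟨B, u, hB, hc, hu, ht⟩ := exists_point hJ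
  rw [mem_vertex_union_edge_iff hJ hB hc hu ht] at h2
  rw [Set.mem_union, mem_vertex3_iff hJ hB hu ht, mem_sphereS_iff hJ hB hu ht] at h1
  have hne : ¬(u 0 = 0 ∧ u 1 = 0 ∧ u 2 = 0 ∧ u 3 = 0) := by
    rintro ⟨e0, e1, e2, e3⟩
    apply hu
    ext i
    fin_cases i
    exacts [e0, e1, e2, e3]
  have hz : ∀ i, Complex.normSq (u i) = 0 ↔ u i = 0 := fun i => Complex.normSq_eq_zero
  have hnn : ∀ i, 0 ≤ Complex.normSq (u i) := fun i => Complex.normSq_nonneg _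
  rcases h1 with h1 | ⟨h3, hn⟩
  · exact hne ⟨h1.1, h1.2.1, h1.2.2, h2.elim And.right fun h => h.2.2⟩
  · rcases h2 with ⟨e0, -⟩ | ⟨e1, e2, -⟩
    · rw [(hz 0).2 e0] at hn
      exact hne ⟨e0, (hz 1).1 (by linarith [hnn 1, hnn 2]), (hz 2).1 (by linarith [hnn 1, hnn 2]),
        h3⟩
    · rw [(hz 1).2 e1, (hz 2).2 e2, add_zero] at hn
      exact hne ⟨(hz 0).1 hn, e1, e2, h3⟩

theorem disjoint_vertex_three_face : Disjoint (vertex 3) (face 3) := by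
  rw [Set.disjoint_left]
  intro J h1 h2
  have hJ := h1.1
  obtain ⟨B, u, hB, hc, hu, ht⟩ := exists_point hJ
  rw [mem_face_iff hJ hB hc hu ht] at h2
  rw [mem_vertex3_iff hJ hB hu ht] at h1
  apply hu
  ext i
  fin_cases i
  exacts [h1.1, h1.2.1, h1.2.2, h2]

/-- Forbidding $W_3$ leaves $\omega_3$ and $\mathcal S$; forbidding $W_1$ as well requires $u_3=0$,
which removes $\omega_3$. -/
theorem ghClass_eq_sphereS {S : Set ℕ} (h1 : {2} ⊆ S) (h2 : S ⊆ {1, 2, 4})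
    (h3 : S ⊆ {2, 3, 4}) : ghClass S = sphereS := by
  refine Set.Subset.antisymm (fun J h => ?_) (sphereS_subset.trans (ghClass_mono h1))
  exact (ghClass_124_subset (ghClass_mono h2 h)).resolve_left fun h4 =>
    Set.disjoint_left.1 disjoint_vertex_three_face h4 (ghClass_234_subset (ghClass_mono h3 h))

theorem ghClass_eq_vertex_union_sphereS {S : Set ℕ} (h1 : {1, 2} ⊆ S) (h2 : S ⊆ {1, 2, 4}) :
    ghClass S = vertex 3 ∪ sphereS := by
  refine Set.Subset.antisymm ((ghClass_mono h2).trans ghClass_124_subset)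
    (Set.union_subset (vertex_three_subset.trans (ghClass_mono h1))
      (sphereS_subset.trans (ghClass_mono (Set.Subset.trans ?_ h1))))
  simp

theorem ghClass_eq_vertex_union_edge {S : Set ℕ} (h1 : {3} ⊆ S) (h2 : S ⊆ {1, 3, 4}) :
    ghClass S = vertex 0 ∪ edge 1 2 :=
  Set.Subset.antisymm ((ghClass_mono h2).trans ghClass_134_subset)
    (vertex_union_edge_subset.trans (ghClass_mono h1))

theorem ghClass_eq_face {S : Set ℕ} (h1 : {2, 3} ⊆ S) (h2 : S ⊆ {2, 3, 4}) :
    ghClass S = face 3 :=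
  Set.Subset.antisymm ((ghClass_mono h2).trans ghClass_234_subset)
    (face_three_subset.trans (ghClass_mono h1))

theorem ghClass_eq_empty {S : Set ℕ} (h1 : S ⊆ {1, 2, 4}) (h2 : S ⊆ {1, 3, 4}) :
    ghClass S = ∅ :=
  Set.eq_empty_of_forall_notMem fun _ h => Set.disjoint_left.1 disjoint_vertex_union_edge
    (ghClass_124_subset (ghClass_mono h1 h)) (ghClass_134_subset (ghClass_mono h2 h))

theorem ghClass_123 : ghClass {1, 2, 3} = face 0 ∪ face 3 := by
  refine Set.Subset.antisymm ghClass_123_subset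
    (Set.union_subset face_zero_subset (face_three_subset.trans (ghClass_mono ?_)))
  simp

end Classes

end Iwasawa

end

theorem corollary1 :
    Iwasawa.ghClass ∅ = ∅ ∧
    Iwasawa.ghClass {1} = ∅ ∧ Iwasawa.ghClass {4} = ∅ ∧ Iwasawa.ghClass {1, 4} = ∅ ∧
    Iwasawa.ghClass {2} = Iwasawa.sphereS ∧ Iwasawa.ghClass {2, 4} = Iwasawa.sphereS ∧
    Iwasawa.ghClass {1, 2} = Iwasawa.vertex 3 ∪ Iwasawa.sphereS ∧
    Iwasawa.ghClass {1, 2, 4} = Iwasawa.vertex 3 ∪ Iwasawa.sphereS ∧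
    Iwasawa.ghClass {3} = Iwasawa.vertex 0 ∪ Iwasawa.edge 1 2 ∧
    Iwasawa.ghClass {1, 3} = Iwasawa.vertex 0 ∪ Iwasawa.edge 1 2 ∧
    Iwasawa.ghClass {3, 4} = Iwasawa.vertex 0 ∪ Iwasawa.edge 1 2 ∧
    Iwasawa.ghClass {1, 3, 4} = Iwasawa.vertex 0 ∪ Iwasawa.edge 1 2 ∧
    Iwasawa.ghClass {2, 3} = Iwasawa.face 3 ∧ Iwasawa.ghClass {2, 3, 4} = Iwasawa.face 3 ∧
    Iwasawa.ghClass {1, 2, 3} = Iwasawa.face 0 ∪ Iwasawa.face 3 ∧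
    Iwasawa.ghClass {1, 2, 3, 4} = Iwasawa.Z ∧
    Iwasawa.ghClass {3, 4} ⊆ Iwasawa.ghClass {1, 2, 3} := by
  refine ⟨Iwasawa.ghClass_eq_empty ?_ ?_, Iwasawa.ghClass_eq_empty ?_ ?_,
    Iwasawa.ghClass_eq_empty ?_ ?_, Iwasawa.ghClass_eq_empty ?_ ?_,
    Iwasawa.ghClass_eq_sphereS ?_ ?_ ?_, Iwasawa.ghClass_eq_sphereS ?_ ?_ ?_,
    Iwasawa.ghClass_eq_vertex_union_sphereS ?_ ?_, Iwasawa.ghClass_eq_vertex_union_sphereS ?_ ?_,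
    Iwasawa.ghClass_eq_vertex_union_edge ?_ ?_, Iwasawa.ghClass_eq_vertex_union_edge ?_ ?_,
    Iwasawa.ghClass_eq_vertex_union_edge ?_ ?_, Iwasawa.ghClass_eq_vertex_union_edge ?_ ?_,
    Iwasawa.ghClass_eq_face ?_ ?_, Iwasawa.ghClass_eq_face ?_ ?_,
    Iwasawa.ghClass_123, Iwasawa.ghClass_1234, ?_⟩
  -- Hermitian structures already lie in the class of $W_3$ alone, which is contained in the
  -- cosymplectic class. The other goals are inclusions of index sets.
  on_goal -1 =>
    rw [Iwasawa.ghClass_eq_vertex_union_edge (S := {3, 4}) (by grind) (by grind)]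
    refine Iwasawa.vertex_union_edge_subset.trans (Iwasawa.ghClass_mono ?_)
  all_goals grind
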